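/- A polygonal 2-tree is a (finite simple) graph obtained as follows: every cycle is a polygonal 2-tree; and if $H$ is a polygonal 2-tree, $uv\in E(H)$, and $P$ is a path between $u$ and $v$ with $|E(P)|\ge 2$, $E(H)\cap E(P)=\emptyset$ and $V(H)\cap V(P)=\{u,v\}$, then $H\cup P$ is a polygonal 2-tree. A cycle basis of a graph $G$ is a minimal set of Eulerian subgraphs (all degrees even) of $G$ such that every cycle of $G$ is the exclusive-or of a subset of them. A fundamental cycle of a spanning tree $T$ of $G$ consists of an edge $uv\in E(G)\setminus E(T)$ and the path between $u$ and $v$ in $T$. A fundamental cycle basis of $G$ is a cycle basis that is the set of all fundamental cycles of some spanning tree of $G$; it is minimum if it minimizes $\mathrm{size}(\mathcal B)=\sum_{C\in\mathcal B}|E(C)|$ among all fundamental cycle bases of $G$. Corollary (minimum fundamental cycle basis). There is an algorithm that, given a polygonal 2-tree $G$ on $n$ vertices (by its number of vertices and a list of its edges, in any order), outputs a minimum fundamental cycle basis $\mathcal B$ of $G$ (as a list of its cycles, each given by a list of its edges) in $O(n\log n+\mathrm{size}(\mathcal B))$ time. Here the algorithm is one fixed program of a random access machine with words of $O(\log n)$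 bits (all numbers in it are below $n^{c}$ for a constant $c$), whose steps are the operations on words: constant, copy, addition, subtraction, multiplication, division, indirect load and store, and comparison. -/

import Mathlib

namespace PolyTree

/-! ## Polygonal 2-trees -/

section Graphs

variable {V : Type*}

/-- The subgraphs of `G` that are polygonal 2-trees: a cycle is a polygonal 2-tree, and adding to a
polygonal 2-tree `H` with an edge `uv` a path with at least two edges between `u` and `v`, having no
edge in common with `H` and only the vertices `u`, `v` in common with `H`, gives a polygonal
2-tree. -/
inductive IsPolygonalSubgraph (G : SimpleGraph V) : G.Subgraph → Prop
  | cycle {v : V} (w : G.Walk v v) (hw : w.IsCycle) : IsPolygonalSubgraph G w.toSubgraph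
  | addPath {H : G.Subgraph} (hH : IsPolygonalSubgraph G H) {u v : V} (huv : H.Adj u v)
      (p : G.Walk u v) (hp : p.IsPath) (hlen : 2 ≤ p.length)
      (hE : H.edgeSet ∩ p.toSubgraph.edgeSet = ∅)
      (hV : H.verts ∩ p.toSubgraph.verts = {u, v}) :
      IsPolygonalSubgraph G (H ⊔ p.toSubgraph)

/-- `G` is a polygonal 2-tree. -/
def IsPolygonalTwoTree (G : SimpleGraph V) : Prop := IsPolygonalSubgraph G ⊤

/-! ## Cycle bases

Subgraphs without isolated vertices (in particular cycles) are represented by their edge sets. -/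

variable [DecidableEq V]

/-- `C` is the edge set of a cycle of `G`. -/
def IsCycleOf (G : SimpleGraph V) (C : Finset (Sym2 V)) : Prop :=
  ∃ (v : V) (w : G.Walk v v), w.IsCycle ∧ C = w.edges.toFinset

/-- `D` is the edge set of an Eulerian subgraph of `G`: all degrees are even. -/
def IsEulerianOf (G : SimpleGraph V) (D : Finset (Sym2 V)) : Prop :=
  (D : Set (Sym2 V)) ⊆ G.edgeSet ∧ ∀ v : V, Even (D.filter (fun e => v ∈ e)).card

/-- `B` consists of Eulerian subgraphs of `G`, and every cycle of `G` is the exclusive-or of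
the members of some subset `S` of `B`. -/
def GeneratesCycles (G : SimpleGraph V) (B : Finset (Finset (Sym2 V))) : Prop :=
  (∀ D ∈ B, IsEulerianOf G D) ∧
  ∀ C, IsCycleOf G C → ∃ S ⊆ B, ∀ e : Sym2 V, e ∈ C ↔ Odd (S.filter (fun D => e ∈ D)).card

/-- A cycle basis of `G` is a minimal set of Eulerian subgraphs generating all the cycles. -/
def IsCycleBasis (G : SimpleGraph V) (B : Finset (Finset (Sym2 V))) : Prop :=
  Minimal (GeneratesCycles G) B

/-- `T` is (the edge relation of) a spanning tree of `G`. -/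
def IsSpanningTree (G T : SimpleGraph V) : Prop := T ≤ G ∧ T.IsTree

/-- `C` is the edge set of a fundamental cycle of the spanning tree `T`: a non-tree edge `uv`
together with the path between `u` and `v` in `T`. -/
def IsFundamentalCycle (G T : SimpleGraph V) (C : Finset (Sym2 V)) : Prop :=
  ∃ (u v : V) (p : T.Walk u v), G.Adj u v ∧ ¬ T.Adj u v ∧ p.IsPath ∧
    C = insert s(u, v) p.edges.toFinset

/-- A fundamental cycle basis of `G` is a cycle basis that consists of the fundamental cycles of
some spanning tree of `G`. -/
def IsFundamentalCycleBasis (G : SimpleGraph V) (B : Finset (Finset (Sym2 V))) : Prop :=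
  IsCycleBasis G B ∧ ∃ T, IsSpanningTree G T ∧ ∀ C, C ∈ B ↔ IsFundamentalCycle G T C

/-- The number of edges in `B`, counted with multiplicity. -/
def size (B : Finset (Finset (Sym2 V))) : ℕ := ∑ C ∈ B, C.card

/-- A minimum fundamental cycle basis. -/
def IsMinFundamentalCycleBasis (G : SimpleGraph V) (B : Finset (Finset (Sym2 V))) : Prop :=
  IsFundamentalCycleBasis G B ∧ ∀ B', IsFundamentalCycleBasis G B' → size B ≤ size B'

end Graphs

/-! ## A word RAM with a step count

A program uses finitely many registers and finitely many arrays (all named in its text). Registers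
and array cells hold words, that is natural numbers below a bound `W`. -/

/-- Register contents, and array contents: `mem a i` is cell `i` of array `a`. -/
structure State where
  reg : ℕ → ℕ
  mem : ℕ → ℕ → ℕ

/-- Elementary operations; `d`, `x`, `y` are names of registers and `a` is the name of an array.
Indirect addressing is by the content of register `x` in `load` and `store`. -/
inductive Op
  | const (d k : ℕ)
  | copy (d x : ℕ)
  | add (d x y : ℕ)
  | sub (d x y : ℕ)
  | mul (d x y : ℕ)
  | div (d x y : ℕ)
  | load (d a x : ℕ)
  | store (a x y : ℕ)

/-- Write `v` to register `d`; this is impossible if `v` does not fit in a word. -/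
def State.write (W : ℕ) (s : State) (d v : ℕ) : Option State :=
  if v < W then some { s with reg := Function.update s.reg d v } else none

/-- The effect of an elementary operation with words below `W`; `none` in case of overflow.
Subtraction is truncated at zero and division is rounded down. -/
def Op.run (W : ℕ) (s : State) : Op → Option State
  | .const d k => s.write W d k
  | .copy d x => s.write W d (s.reg x)
  | .add d x y => s.write W d (s.reg x + s.reg y)
  | .sub d x y => s.write W d (s.reg x - s.reg y)
  | .mul d x y => s.write W d (s.reg x * s.reg y)
  | .div d x y => s.write W d (s.reg x / s.reg y)
  | .load d a x => s.write W d (s.mem a (s.reg x))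
  | .store a x y =>
      some { s with mem := Function.update s.mem a
                      (Function.update (s.mem a) (s.reg x) (s.reg y)) }

/-- Tests comparing the contents of two registers. -/
inductive Test
  | eq (x y : ℕ)
  | lt (x y : ℕ)

def Test.holds (s : State) : Test → Prop
  | .eq x y => s.reg x = s.reg y
  | .lt x y => s.reg x < s.reg y

/-- Programs. -/
inductive Program
  | op (o : Op)
  | seq (P Q : Program)
  | ite (b : Test) (P Q : Program)
  | loop (b : Test) (P : Program)

/-- `Runs W P s s' t`: on words below `W`, the program `P` started in state `s` halts in state `s'`
after `t` steps. Each elementary operation and each evaluation of a test is one step. -/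
inductive Runs (W : ℕ) : Program → State → State → ℕ → Prop
  | op {o : Op} {s s' : State} (h : o.run W s = some s') : Runs W (.op o) s s' 1
  | seq {P Q : Program} {s s' s'' : State} {t t' : ℕ}
      (hP : Runs W P s s' t) (hQ : Runs W Q s' s'' t') : Runs W (.seq P Q) s s'' (t + t')
  | iteTrue {b : Test} {P Q : Program} {s s' : State} {t : ℕ}
      (hb : b.holds s) (hP : Runs W P s s' t) : Runs W (.ite b P Q) s s' (t + 1)
  | iteFalse {b : Test} {P Q : Program} {s s' : State} {t : ℕ}
      (hb : ¬ b.holds s) (hQ : Runs W Q s s' t) : Runs W (.ite b P Q) s s' (t + 1)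
  | loopDone {b : Test} {P : Program} {s : State}
      (hb : ¬ b.holds s) : Runs W (.loop b P) s s 1
  | loopStep {b : Test} {P : Program} {s s' s'' : State} {t t' : ℕ}
      (hb : b.holds s) (hP : Runs W P s s' t) (hL : Runs W (.loop b P) s' s'' t') :
      Runs W (.loop b P) s s'' (t + t' + 1)

/-! ## Input and output -/

/-- The initial state: the input `l` is in array `0`, everything else is zero. -/
def State.init (l : List ℕ) : State where
  reg := fun _ => 0
  mem := fun a i => if a = 0 then l.getD i 0 else 0

/-- The output word sequence `l` is at the beginning of array `1`. -/
def State.Outputs (s : State) (l : List ℕ) : Prop :=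
  ∀ (i : ℕ) (hi : i < l.length), s.mem 1 i = l[i]

section Encoding

variable {n : ℕ}

/-- The list `L` of pairs enumerates the edge set `S`, each edge once, in any order, each edge
being given by its two ends in any order. -/
def Enumerates (L : List (Fin n × Fin n)) (S : Set (Sym2 (Fin n))) : Prop :=
  (L.map (fun p => s(p.1, p.2))).Nodup ∧ ∀ e, e ∈ S ↔ e ∈ L.map (fun p => s(p.1, p.2))

/-- The number of edges, followed by the two ends of each edge. -/
def encodeEdges (L : List (Fin n × Fin n)) : List ℕ :=
  L.length :: L.flatMap (fun p => [(p.1 : ℕ), (p.2 : ℕ)])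

/-- `l` is an encoding of the graph `G` with vertices `0, …, n - 1`: the number of vertices and an
edge list. -/
def EncodesGraph (G : SimpleGraph (Fin n)) (l : List ℕ) : Prop :=
  ∃ L : List (Fin n × Fin n), Enumerates L G.edgeSet ∧ l = n :: encodeEdges L

/-- `l` is an encoding of the set `B` of cycles: the number of cycles, and an edge list for each
cycle, with every cycle listed once. -/
def EncodesCycles (B : Finset (Finset (Sym2 (Fin n)))) (l : List ℕ) : Prop :=
  ∃ (Bs : List (Finset (Sym2 (Fin n)))) (Ls : List (List (Fin n × Fin n))),
    Bs.Nodup ∧ (∀ C, C ∈ B ↔ C ∈ Bs) ∧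
    List.Forall₂ (fun L C => Enumerates L (C : Set (Sym2 (Fin n)))) Ls Bs ∧
    l = Ls.length :: Ls.flatMap encodeEdges

end Encoding

end PolyTree

/-!
# Minimum fundamental cycle bases of polygonal 2-trees

**The combinatorics.** A polygonal 2-tree is taken apart by eliminating vertices of degree two. The
eliminated vertex `v` and its neighbours `u`, `w` span a triangle with the edge `uw`, which is added
as a *virtual* edge if it is missing. There is always a vertex of degree two, any of them may be
taken, and every virtual edge ends up on exactly two of the `n - 2` triangles (`Reducible.elim`,
`ElimInv.step`, `ElimInv.exists_layout`). What remains to be known about the graph is in a `Scheme`: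
the list of the triangles, by the numbers of their edges.

For a spanning tree, let `dist h` be the distance in the tree of the ends of the edge `h`. The
fundamental cycle of a non-tree edge `h` has `dist h + 1` edges, so up to a constant the size of the
basis is `∑ c h * dist h`, where `c` is one on real edges and zero on virtual ones
(`Layout.size_add`). The tree misses an edge `e i` of every triangle, a different one for each
(`Scheme.Tree.exists_choice`), and the path of `e i` is composed of the paths of the other two edges
of the triangle (`Scheme.Tree.path_choice`). Hence for all weights `a` on the triangles,

  `∑ c h * dist h = ∑ c h + ∑ a i + ∑ slack h * (dist h - 1)`,

where the slack of a chosen edge `h = e i` is `c h - a i` plus the weights of the other triangles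
with the edge `h`, and `dist h = 1` for all edges that are not chosen (`Scheme.Tree.sum_eq`). This
is linear programming duality: the dual constraints say that the weight of a triangle is, for each
of its edges `h`, at most `c h` plus the weights of the other triangles with the edge `h`. If they
hold, `∑ c h + ∑ a i` is a lower bound for all spanning trees, and it is attained by a choice of
edges for which they are tight. Such weights and such a choice are found by dynamic programming on
the tree-like structure of the triangles: `a i` is the least size of a cut through an edge of the
`i`-th triangle, counting only this edge and the part of the graph beyond it (`Scheme.Tables.a_le`,
`Scheme.Tables.a_e`). All virtual edges are chosen, so the edges that are not chosen form a spanning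
tree of the graph, and its fundamental cycles form a minimum fundamental cycle basis
(`Layout.exists_basis`).

**The program.** The two neighbours of a vertex of degree two are computed from their sum and the
sum of their squares, which are easy to maintain, and the edge between two vertices is looked up in
a table with `n * n` cells; the memory is zero at the start, so nothing has to be initialized. The
elimination (`progFront_wp`) and the two passes of the dynamic program (`progUp_wp`, `progDown_wp`)
take `O(n)` steps. A fundamental cycle is written by expanding its edge on a stack: a chosen edge is
replaced by the other two edges of its triangle, and any other edge is written. Since a path with
`d` edges is obtained in `2 * d - 1` rounds, the output takes `O(n + size)` steps (`progOut_wp`).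
The total is linear in `n + size`, which is within the bound because `1 ≤ log n`.

The program is verified in a weakest-precondition calculus (`WP`): each piece has a lemma, with a
name in `_wp`, about the state in which it halts and the number of its steps.
-/

namespace PolyTree

/-! ### A weakest-precondition calculus for the word RAM -/

/-- The state with `v` written to register `d`. -/
def State.set (s : State) (d v : ℕ) : State := { s with reg := Function.update s.reg d v }

/-- The state with `v` written to cell `i` of array `a`. -/
def State.put (s : State) (a i v : ℕ) : State :=
  { s with mem := Function.update s.mem a (Function.update (s.mem a) i v) }

@[simp] lemma State.set_reg (s : State) (d v r : ℕ) :
    (s.set d v).reg r = if r = d then v else s.reg r := by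
  simp [State.set, Function.update_apply]

@[simp] lemma State.set_mem (s : State) (d v : ℕ) : (s.set d v).mem = s.mem := rfl

@[simp] lemma State.put_reg (s : State) (a i v : ℕ) : (s.put a i v).reg = s.reg := rfl

@[simp] lemma State.put_mem (s : State) (a i v b : ℕ) :
    (s.put a i v).mem b = if b = a then Function.update (s.mem a) i v else s.mem b := by
  by_cases h : b = a
  · subst h; simp [State.put]
  · simp [State.put, h]

/-- `P`, started in `s`, halts in a state and after a number of steps satisfying `Q`. -/
def WP (W : ℕ) (P : Program) (Q : State → ℕ → Prop) (s : State) : Prop :=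
  ∃ s' t, Runs W P s s' t ∧ Q s' t

lemma WP.mono {W : ℕ} {P : Program} {Q Q' : State → ℕ → Prop} {s : State}
    (h : WP W P Q s) (hQ : ∀ s' t, Q s' t → Q' s' t) : WP W P Q' s := by
  obtain ⟨s', t, h1, h2⟩ := h
  exact ⟨s', t, h1, hQ _ _ h2⟩

lemma WP.seq {W : ℕ} {P R : Program} {Q : State → ℕ → Prop} {s : State}
    (h : WP W P (fun s1 t1 => WP W R (fun s2 t2 => Q s2 (t1 + t2)) s1) s) :
    WP W (.seq P R) Q s := by
  obtain ⟨s1, t1, h1, s2, t2, h2, h3⟩ := h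
  exact ⟨s2, t1 + t2, .seq h1 h2, h3⟩

lemma WP.ite {W : ℕ} {b : Test} {P R : Program} {Q : State → ℕ → Prop} {s : State}
    (h1 : b.holds s → WP W P (fun s' t => Q s' (t + 1)) s)
    (h2 : ¬ b.holds s → WP W R (fun s' t => Q s' (t + 1)) s) : WP W (.ite b P R) Q s := by
  by_cases hb : b.holds s
  · obtain ⟨s', t, h3, h4⟩ := h1 hb
    exact ⟨s', t + 1, .iteTrue hb h3, h4⟩
  · obtain ⟨s', t, h3, h4⟩ := h2 hb
    exact ⟨s', t + 1, .iteFalse hb h3, h4⟩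

/-- A loop that makes `N` rounds, the `i`-th one with at most `c i` steps. -/
lemma WP.loop {W : ℕ} {b : Test} {P : Program} {Q : State → ℕ → Prop}
    (I : ℕ → State → Prop) (c : ℕ → ℕ) (N : ℕ) {s : State} (h0 : I 0 s)
    (hstep : ∀ i < N, ∀ s, I i s → b.holds s ∧ WP W P (fun s' t => I (i + 1) s' ∧ t ≤ c i) s)
    (hend : ∀ s, I N s → ¬ b.holds s)
    (hQ : ∀ s' t, I N s' → t ≤ ∑ i ∈ Finset.range N, (c i + 1) + 1 → Q s' t) :
    WP W (.loop b P) Q s := by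
  have key : ∀ k ≤ N, ∀ s, I (N - k) s → ∃ s' t, Runs W (.loop b P) s s' t ∧ I N s' ∧
      t ≤ ∑ i ∈ Finset.Ico (N - k) N, (c i + 1) + 1 := by
    intro k
    induction k with
    | zero =>
      intro _ s hs
      exact ⟨s, 1, .loopDone (hend s (by simpa using hs)), by simpa using hs, by simp⟩
    | succ k ih =>
      intro hk s hs
      obtain ⟨hb, s1, t1, hr, hI, ht⟩ := hstep (N - (k + 1)) (by omega) s hs
      have he : N - (k + 1) + 1 = N - k := by omega
      rw [he] at hI
      obtain ⟨s2, t2, hr2, hI2, ht2⟩ := ih (by omega) s1 hI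
      refine ⟨s2, t1 + t2 + 1, .loopStep hb hr hr2, hI2, ?_⟩
      rw [Finset.sum_eq_sum_Ico_succ_bot (by omega), he]
      omega
  obtain ⟨s', t, h1, h2, h3⟩ := key N le_rfl s (by simpa using h0)
  refine ⟨s', t, h1, hQ _ _ h2 ?_⟩
  simpa using h3

/-- A nonempty sequence of elementary operations as a program. -/
def block : Op → List Op → Program
  | o, [] => .op o
  | o, o' :: os => .seq (.op o) (block o' os)

/-- The weakest precondition of a single operation. -/
def Op.wp (W : ℕ) (Q : State → Prop) (s : State) : Op → Prop
  | .const d k => k < W ∧ Q (s.set d k)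
  | .copy d x => s.reg x < W ∧ Q (s.set d (s.reg x))
  | .add d x y => s.reg x + s.reg y < W ∧ Q (s.set d (s.reg x + s.reg y))
  | .sub d x y => s.reg x - s.reg y < W ∧ Q (s.set d (s.reg x - s.reg y))
  | .mul d x y => s.reg x * s.reg y < W ∧ Q (s.set d (s.reg x * s.reg y))
  | .div d x y => s.reg x / s.reg y < W ∧ Q (s.set d (s.reg x / s.reg y))
  | .load d a x => s.mem a (s.reg x) < W ∧ Q (s.set d (s.mem a (s.reg x)))
  | .store a x y => Q (s.put a (s.reg x) (s.reg y))

lemma Op.wp_run {W : ℕ} {Q : State → Prop} {s : State} {o : Op} (h : o.wp W Q s) :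
    ∃ s', o.run W s = some s' ∧ Q s' := by
  cases o <;> simp_all [Op.wp, Op.run, State.write, State.set, State.put]

lemma WP.op {W : ℕ} {Q : State → ℕ → Prop} {o : Op} {s : State}
    (h : o.wp W (fun s' => Q s' 1) s) : WP W (.op o) Q s := by
  obtain ⟨s', h1, h2⟩ := Op.wp_run h
  exact ⟨s', 1, .op h1, h2⟩

/-- The weakest precondition of a sequence of operations. -/
def wpOps (W : ℕ) (Q : State → Prop) : List Op → State → Prop
  | [], s => Q s
  | o :: os, s => o.wp W (wpOps W Q os) s

lemma WP.block {W : ℕ} {Q : State → ℕ → Prop} (o : Op) (os : List Op) {s : State}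
    (h : wpOps W (fun s' => Q s' (os.length + 1)) (o :: os) s) :
    WP W (block o os) Q s := by
  induction os generalizing o s Q with
  | nil =>
    obtain ⟨s', h1, h2⟩ := Op.wp_run h
    exact ⟨s', 1, .op h1, by simpa [wpOps] using h2⟩
  | cons o' os ih =>
    obtain ⟨s', h1, h2⟩ := Op.wp_run h
    apply WP.seq
    refine ⟨s', 1, .op h1, ?_⟩
    apply ih o'
    have he : ∀ k, 1 + (k + 1) = k + 1 + 1 := by omega
    simpa [he] using h2

/-! ### Triangle schemes: the combinatorics of a vertex elimination -/

/-- The record of the elimination of the vertices of a graph one by one, down to a single edge.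
Edges are named by numbers below `N`. The `i`-th step eliminates a vertex that lies on only two
remaining edges `L i` and `R i`, and `B i` is the edge between its two neighbours, so `L i`, `R i`,
`B i` form a triangle. -/
structure Scheme where
  K : ℕ
  N : ℕ
  L : ℕ → ℕ
  R : ℕ → ℕ
  B : ℕ → ℕ
  L_lt : ∀ i < K, L i < N
  R_lt : ∀ i < K, R i < N
  B_lt : ∀ i < K, B i < N
  LR : ∀ i < K, L i ≠ R i
  LB : ∀ i < K, L i ≠ B i
  RB : ∀ i < K, R i ≠ B i
  L_fresh : ∀ i j, i < j → j < K → L i ≠ L j ∧ L i ≠ R j ∧ L i ≠ B j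
  R_fresh : ∀ i j, i < j → j < K → R i ≠ L j ∧ R i ≠ R j ∧ R i ≠ B j
  card : N = 2 * K + 1

namespace Scheme

variable (S : Scheme)

/-- The edges of the `i`-th triangle. -/
def tri (i : ℕ) : Finset ℕ := {S.L i, S.R i, S.B i}

lemma mem_tri {S : Scheme} {i h : ℕ} : h ∈ S.tri i ↔ h = S.L i ∨ h = S.R i ∨ h = S.B i := by
  simp [tri]

lemma tri_lt {i h : ℕ} (hi : i < S.K) (hh : h ∈ S.tri i) : h < S.N := by
  have := S.L_lt i hi; have := S.R_lt i hi; have := S.B_lt i hi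
  rw [mem_tri] at hh; omega

lemma sum_tri {M : Type*} [AddCommMonoid M] (f : ℕ → M) {i : ℕ} (hi : i < S.K) :
    ∑ h ∈ S.tri i, f h = f (S.L i) + (f (S.R i) + f (S.B i)) := by
  rw [tri, Finset.sum_insert, Finset.sum_insert, Finset.sum_singleton]
  · simpa using S.RB i hi
  · simpa using ⟨S.LR i hi, S.LB i hi⟩

/-- A cut: a set of edges meeting every triangle in an even number of edges. -/
def IsCut (β : ℕ → Bool) : Prop := ∀ i < S.K, β (S.B i) = xor (β (S.L i)) (β (S.R i))

/-- The edges that remain after the first `i` eliminations. -/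
def E (i : ℕ) : Finset ℕ := (Finset.range S.N).filter fun h => ∀ j < i, h ≠ S.L j ∧ h ≠ S.R j

lemma mem_E {S : Scheme} {i h : ℕ} :
    h ∈ S.E i ↔ h < S.N ∧ ∀ j < i, h ≠ S.L j ∧ h ≠ S.R j := by simp [E]

lemma E_zero : S.E 0 = Finset.range S.N := by simp [E]

lemma mem_E_succ {S : Scheme} {i h : ℕ} (hi : i < S.K) :
    h ∈ S.E i ↔ h ∈ S.E (i + 1) ∨ h = S.L i ∨ h = S.R i := by
  have h1 := S.L_lt i hi; have h2 := S.R_lt i hi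
  simp only [mem_E, Nat.lt_succ_iff_lt_or_eq]
  constructor
  · rintro ⟨h3, h4⟩
    by_cases h5 : h = S.L i ∨ h = S.R i
    · exact Or.inr h5
    · left
      push Not at h5
      refine ⟨h3, ?_⟩
      rintro j (hj | rfl)
      · exact h4 j hj
      · exact h5
  · rintro (⟨h3, h4⟩ | rfl | rfl)
    · exact ⟨h3, fun j hj => h4 j (Or.inl hj)⟩
    · exact ⟨h1, fun j hj => ⟨(S.L_fresh j i hj hi).1.symm, (S.R_fresh j i hj hi).1.symm⟩⟩
    · exact ⟨h2, fun j hj => ⟨(S.L_fresh j i hj hi).2.1.symm, (S.R_fresh j i hj hi).2.1.symm⟩⟩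

lemma L_notMem_E {i : ℕ} : S.L i ∉ S.E (i + 1) := by
  intro h; exact ((mem_E.1 h).2 i (by omega)).1 rfl

lemma R_notMem_E {i : ℕ} : S.R i ∉ S.E (i + 1) := by
  intro h; exact ((mem_E.1 h).2 i (by omega)).2 rfl

lemma B_mem_E {i : ℕ} (hi : i < S.K) : S.B i ∈ S.E (i + 1) := by
  refine mem_E.2 ⟨S.B_lt i hi, fun j hj => ?_⟩
  rcases Nat.lt_succ_iff_lt_or_eq.1 hj with hj | rfl
  · exact ⟨(S.L_fresh j i hj hi).2.2.symm, (S.R_fresh j i hj hi).2.2.symm⟩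
  · exact ⟨(S.LB j hi).symm, (S.RB j hi).symm⟩

lemma E_eq_insert {i : ℕ} (hi : i < S.K) :
    S.E i = insert (S.L i) (insert (S.R i) (S.E (i + 1))) := by
  ext h
  rw [mem_E_succ hi]
  simp only [Finset.mem_insert]
  tauto

lemma card_E {i : ℕ} (hi : i ≤ S.K) : (S.E i).card = 2 * (S.K - i) + 1 := by
  induction i with
  | zero => simp [E_zero, S.card]
  | succ i ih =>
    have h := ih (by omega)
    rw [S.E_eq_insert (by omega), Finset.card_insert_of_notMem, Finset.card_insert_of_notMem] at h
    · omega
    · exact S.R_notMem_E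
    · simp only [Finset.mem_insert, not_or]
      exact ⟨S.LR i (by omega), S.L_notMem_E⟩

/-- `e` assigns to the triangles from the `i`-th on different edges of theirs. -/
structure IsChoice (i : ℕ) (e : ℕ → ℕ) : Prop where
  mem : ∀ j, i ≤ j → j < S.K → e j ∈ S.tri j
  inj : ∀ j k, i ≤ j → j < S.K → i ≤ k → k < S.K → e j = e k → j = k

/-- The remaining edges that are not chosen. -/
def T (i : ℕ) (e : ℕ → ℕ) : Finset ℕ := (S.E i).filter fun h => ∀ j, i ≤ j → j < S.K → e j ≠ h

variable {S}

lemma mem_T {i h : ℕ} {e : ℕ → ℕ} :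
    h ∈ S.T i e ↔ h ∈ S.E i ∧ ∀ j, i ≤ j → j < S.K → e j ≠ h := by simp [T]

lemma IsChoice.succ {i : ℕ} {e : ℕ → ℕ} (he : S.IsChoice i e) : S.IsChoice (i + 1) e :=
  ⟨fun j h1 h2 => he.mem j (by omega) h2,
    fun j k h1 h2 h3 h4 => he.inj j k (by omega) h2 (by omega) h4⟩

lemma tri_subset_E {i j : ℕ} (hij : i ≤ j) (hj : j < S.K) {h : ℕ} (hh : h ∈ S.tri j) :
    h ∈ S.E i := by
  refine mem_E.2 ⟨S.tri_lt hj hh, fun k hk => ?_⟩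
  have h1 := S.L_fresh k j (by omega) hj
  have h2 := S.R_fresh k j (by omega) hj
  rw [mem_tri] at hh
  grind

/-- If an edge at the eliminated vertex is chosen, the other one is a pendant edge of the graph of
the edges that are not chosen. -/
lemma T_succ_LR {i : ℕ} (hi : i < S.K) {e : ℕ → ℕ} (he : S.IsChoice i e) (x y : ℕ)
    (hxy : x = S.L i ∧ y = S.R i ∨ x = S.R i ∧ y = S.L i) (hx : e i = x) {h : ℕ} :
    h ∈ S.T i e ↔ h ∈ S.T (i + 1) e ∨ h = y := by
  have h1 := S.L_notMem_E (i := i); have h2 := S.R_notMem_E (i := i)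
  have h3 : ∀ j, i + 1 ≤ j → j < S.K → e j ∈ S.E (i + 1) :=
    fun j hj hj' => tri_subset_E hj hj' (he.mem j (by omega) hj')
  have h4 := S.LR i hi
  rw [mem_T, mem_T, mem_E_succ hi]
  constructor
  · rintro ⟨h5, h6⟩
    have := h6 i le_rfl hi
    by_cases h7 : h ∈ S.E (i + 1)
    · exact Or.inl ⟨h7, fun j hj => h6 j (by omega)⟩
    · grind
  · rintro (⟨h5, h6⟩ | rfl)
    · refine ⟨Or.inl h5, fun j hj hj' => ?_⟩
      rcases Nat.eq_or_lt_of_le hj with rfl | hj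
      · grind
      · exact h6 j hj hj'
    · refine ⟨by grind, fun j hj hj' => ?_⟩
      rcases Nat.eq_or_lt_of_le hj with rfl | hj
      · grind
      · have := h3 j hj hj'
        grind

/-- If the base of a triangle is chosen, the graph of the edges that are not chosen arises by
subdividing the base. -/
lemma T_succ_B {i : ℕ} (hi : i < S.K) {e : ℕ → ℕ} (he : S.IsChoice i e) (hx : e i = S.B i)
    {h : ℕ} :
    h ∈ S.T i e ↔ (h ∈ S.T (i + 1) e ∧ h ≠ S.B i) ∨ h = S.L i ∨ h = S.R i := by
  have h1 := S.L_notMem_E (i := i); have h2 := S.R_notMem_E (i := i)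
  have h3 : ∀ j, i + 1 ≤ j → j < S.K → e j ∈ S.E (i + 1) :=
    fun j hj hj' => tri_subset_E hj hj' (he.mem j (by omega) hj')
  have h4 := S.LB i hi
  have h4' := S.RB i hi
  rw [mem_T, mem_T, mem_E_succ hi]
  constructor
  · rintro ⟨h5, h6⟩
    have := h6 i le_rfl hi
    rcases h5 with h5 | h5
    · exact Or.inl ⟨⟨h5, fun j hj => h6 j (by omega)⟩, by grind⟩
    · exact Or.inr h5
  · rintro (⟨⟨h5, h6⟩, h7⟩ | h5)
    · refine ⟨Or.inl h5, fun j hj hj' => ?_⟩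
      rcases Nat.eq_or_lt_of_le hj with rfl | hj
      · grind
      · exact h6 j hj hj'
    · refine ⟨Or.inr h5, fun j hj hj' => ?_⟩
      rcases Nat.eq_or_lt_of_le hj with rfl | hj
      · grind
      · have := h3 j hj hj'
        grind

/-- A cut that avoids the edges that are not chosen is empty: these edges form a connected graph. -/
lemma cut_zero {β : ℕ → Bool} (hβ : S.IsCut β) {e : ℕ → ℕ} {i : ℕ} (hi : i ≤ S.K)
    (he : S.IsChoice i e) (h0 : ∀ h ∈ S.T i e, β h = false) : ∀ h ∈ S.E i, β h = false := by
  induction hi using Nat.decreasingInduction with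
  | self =>
    intro h hh
    exact h0 h (mem_T.2 ⟨hh, fun j h1 h2 => by omega⟩)
  | of_succ i hi ih =>
    have hc := hβ i hi
    have hm := he.mem i le_rfl hi
    rw [mem_tri] at hm
    have hB := S.B_mem_E hi
    have h1 : ∀ h ∈ S.T (i + 1) e, β h = false := by
      intro h hh
      rcases hm with hx | hx | hx
      · exact h0 h ((T_succ_LR hi he _ _ (Or.inl ⟨rfl, rfl⟩) hx).2 (Or.inl hh))
      · exact h0 h ((T_succ_LR hi he _ _ (Or.inr ⟨rfl, rfl⟩) hx).2 (Or.inl hh))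
      · by_cases hb : h = S.B i
        · have h2 := h0 _ ((T_succ_B hi he hx).2 (Or.inr (Or.inl rfl)))
          have h3 := h0 _ ((T_succ_B hi he hx).2 (Or.inr (Or.inr rfl)))
          rw [hb, hc, h2, h3]; rfl
        · exact h0 h ((T_succ_B hi he hx).2 (Or.inl ⟨hh, hb⟩))
    have h2 := ih he.succ h1
    have h3 := h2 _ hB
    intro h hh
    rw [mem_E_succ hi] at hh
    rcases hm with hx | hx | hx
    · have := h0 _ ((T_succ_LR hi he _ _ (Or.inl ⟨rfl, rfl⟩) hx).2 (Or.inr rfl))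
      grind
    · have := h0 _ ((T_succ_LR hi he _ _ (Or.inr ⟨rfl, rfl⟩) hx).2 (Or.inr rfl))
      grind
    · have h4 := h0 _ ((T_succ_B hi he hx).2 (Or.inr (Or.inl rfl)))
      have h5 := h0 _ ((T_succ_B hi he hx).2 (Or.inr (Or.inr rfl)))
      grind

/-- A cut with at most one unchosen edge, such as the fundamental cut of an edge of a spanning
tree, contains the chosen edge of every triangle that it meets. -/
lemma cut_choice {β : ℕ → Bool} (hβ : S.IsCut β) {e : ℕ → ℕ} {i : ℕ} (hi : i ≤ S.K)
    (he : S.IsChoice i e)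
    (h1 : ∀ h ∈ S.T i e, ∀ h' ∈ S.T i e, β h = true → β h' = true → h = h') :
    ∀ j, i ≤ j → j < S.K → ∀ h ∈ S.tri j, β h = true → β (e j) = true := by
  induction hi using Nat.decreasingInduction with
  | self => intro j h1 h2; omega
  | of_succ i hi ih =>
    have hc := hβ i hi
    have hm := he.mem i le_rfl hi
    rw [mem_tri] at hm
    have hB := S.B_mem_E hi
    -- if both edges at the eliminated vertex are chosen or not, the base edge takes their place
    have side : ∀ x y, (x = S.L i ∧ y = S.R i ∨ x = S.R i ∧ y = S.L i) → e i = x →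
        (∀ j, i ≤ j → j < S.K → ∀ h ∈ S.tri j, β h = true → β (e j) = true) := by
      intro x y hxy hx
      have hT := fun h => T_succ_LR hi he x y hxy hx (h := h)
      have h2 : ∀ h ∈ S.T (i + 1) e, ∀ h' ∈ S.T (i + 1) e, β h = true → β h' = true → h = h' :=
        fun h hh h' hh' => h1 h ((hT h).2 (Or.inl hh)) h' ((hT h').2 (Or.inl hh'))
      intro j hj hj' h hh hβh
      rcases Nat.eq_or_lt_of_le hj with rfl | hj
      · by_contra hne
        have hBt : β (S.B i) = true := by rw [mem_tri] at hh; grind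
        have hyt : β y = true := by grind
        have : ∃ t ∈ S.T (i + 1) e, β t = true := by
          by_contra hcon
          push Not at hcon
          have := cut_zero hβ (by omega) he.succ (by simpa using hcon) _ hB
          simp [this] at hBt
        obtain ⟨t, ht, hβt⟩ := this
        have hty := h1 t ((hT t).2 (Or.inl ht)) y ((hT y).2 (Or.inr rfl)) hβt hyt
        have h3 := (mem_T.1 ht).1
        have h4 := S.L_notMem_E (i := i); have h5 := S.R_notMem_E (i := i)
        grind
      · exact ih he.succ h2 j hj hj' h hh hβh
    rcases hm with hx | hx | hx
    · exact side _ _ (Or.inl ⟨rfl, rfl⟩) hx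
    · exact side _ _ (Or.inr ⟨rfl, rfl⟩) hx
    · have hT := fun h => T_succ_B hi he hx (h := h)
      have hL := (hT (S.L i)).2 (Or.inr (Or.inl rfl))
      have hR := (hT (S.R i)).2 (Or.inr (Or.inr rfl))
      have h4 := S.L_notMem_E (i := i); have h5 := S.R_notMem_E (i := i)
      have hLR := S.LR i hi
      have h2 : ∀ h ∈ S.T (i + 1) e, ∀ h' ∈ S.T (i + 1) e, β h = true → β h' = true → h = h' := by
        have aux : ∀ h ∈ S.T (i + 1) e, β h = true → β (S.B i) = true → h = S.B i := by
          intro h hh hb hbB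
          by_contra hne
          have h6 := (hT h).2 (Or.inl ⟨hh, hne⟩)
          have h7 := h1 h h6 _ hL hb
          have h8 := h1 h h6 _ hR hb
          have h9 := (mem_T.1 hh).1
          have h10 : β (S.L i) = true ∨ β (S.R i) = true := by
            rw [hc] at hbB
            revert hbB
            cases β (S.L i) <;> cases β (S.R i) <;> simp
          grind
        intro h hh h' hh' hb hb'
        by_cases hbB : β (S.B i) = true
        · rw [aux h hh hb hbB, aux h' hh' hb' hbB]
        · have n1 : h ≠ S.B i := by rintro rfl; exact hbB hb
          have n2 : h' ≠ S.B i := by rintro rfl; exact hbB hb'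
          exact h1 h ((hT h).2 (Or.inl ⟨hh, n1⟩)) h' ((hT h').2 (Or.inl ⟨hh', n2⟩)) hb hb'
      intro j hj hj' h hh hβh
      rcases Nat.eq_or_lt_of_le hj with rfl | hj
      · by_contra hne
        rw [mem_tri] at hh
        have := h1 _ hL _ hR
        grind
      · exact ih he.succ h2 j hj hj' h hh hβh

end Scheme

namespace Scheme
variable {S : Scheme}

/-- Every edge of `T` is separated by a cut from the other ones. -/
def IsAcyclic (S : Scheme) (T : Finset ℕ) : Prop :=
  ∀ t ∈ T, ∃ β, S.IsCut β ∧ β t = true ∧ ∀ t' ∈ T, t' ≠ t → β t' = false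

lemma IsAcyclic.mono {T T' : Finset ℕ} (hT : S.IsAcyclic T) (h : T' ⊆ T) : S.IsAcyclic T' := by
  intro t ht
  obtain ⟨β, h1, h2, h3⟩ := hT t (h ht)
  exact ⟨β, h1, h2, fun t' ht' => h3 t' (h ht')⟩

lemma IsChoice.cons {i : ℕ} {e : ℕ → ℕ} (he : S.IsChoice (i + 1) e) {x : ℕ}
    (hx : x ∈ S.tri i) (hne : ∀ j, i + 1 ≤ j → j < S.K → e j ≠ x) :
    S.IsChoice i (fun j => if j = i then x else e j) := by
  refine ⟨fun j h1 h2 => ?_, fun j k h1 h2 h3 h4 h => ?_⟩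
  · by_cases hj : j = i
    · simpa [hj] using hx
    · simpa [hj] using he.mem j (by omega) h2
  · by_cases hj : j = i <;> by_cases hk : k = i
    · omega
    · simp only [hj, hk, if_true, if_false] at h
      exact absurd h.symm (hne k (by omega) h4)
    · simp only [hj, hk, if_true, if_false] at h
      exact absurd h (hne j (by omega) h2)
    · simp only [hj, hk, if_false] at h
      exact he.inj j k (by omega) h2 (by omega) h4 h

/-- A spanning tree misses an edge of every triangle, a different one for each. -/
lemma exists_choice {i : ℕ} (hi : i ≤ S.K) {T : Finset ℕ} (hTE : T ⊆ S.E i)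
    (hT : S.IsAcyclic T) :
    T.card ≤ S.K - i + 1 ∧ (T.card = S.K - i + 1 →
      ∃ e, S.IsChoice i e ∧ ∀ j, i ≤ j → j < S.K → e j ∉ T) := by
  induction hi using Nat.decreasingInduction generalizing T with
  | self =>
    have h1 := S.card_E (i := S.K) le_rfl
    have h2 := Finset.card_le_card hTE
    refine ⟨by omega, fun _ => ⟨id, ⟨fun j h1 h2 => by omega, fun j k h1 h2 => by omega⟩,
      fun j h1 h2 => by omega⟩⟩
  | of_succ i hi ih =>
    have hL := S.L_notMem_E (i := i); have hR := S.R_notMem_E (i := i)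
    have hB := S.B_mem_E hi; have hLR := S.LR i hi
    have hK : S.K - i + 1 = (S.K - (i + 1) + 1) + 1 := by omega
    have hsub : ∀ j, i + 1 ≤ j → j < S.K → ∀ {e : ℕ → ℕ}, S.IsChoice (i + 1) e →
        e j ∈ S.E (i + 1) := fun j h1 h2 e he => tri_subset_E h1 h2 (he.mem j h1 h2)
    -- exactly one of the two edges at the eliminated vertex is in `T`
    have one : ∀ x y, (x = S.L i ∧ y = S.R i ∨ x = S.R i ∧ y = S.L i) → x ∉ T → y ∈ T →
        T.card ≤ S.K - i + 1 ∧ (T.card = S.K - i + 1 →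
        ∃ e, S.IsChoice i e ∧ ∀ j, i ≤ j → j < S.K → e j ∉ T) := by
      intro x y hxy hx hy
      have hE : T.erase y ⊆ S.E (i + 1) := by
        intro h hh
        have h1 := hTE (Finset.mem_of_mem_erase hh)
        rw [mem_E_succ hi] at h1
        have h2 := Finset.ne_of_mem_erase hh
        have h3 := Finset.mem_of_mem_erase hh
        grind
      obtain ⟨h1, h2⟩ := ih hE (hT.mono (Finset.erase_subset _ _))
      rw [Finset.card_erase_of_mem hy] at h1 h2
      have hpos : 0 < T.card := Finset.card_pos.2 ⟨y, hy⟩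
      refine ⟨by omega, fun hc => ?_⟩
      obtain ⟨e, he, heT⟩ := h2 (by omega)
      refine ⟨_, he.cons (x := x) (by rw [mem_tri]; grind) ?_, ?_⟩
      · intro j h3 h4 h5
        have := hsub j h3 h4 he
        grind
      · intro j h3 h4
        by_cases hj : j = i
        · simpa [hj] using hx
        · have h5 := hsub j (by omega) h4 he
          have h6 := heT j (by omega) h4
          simp only [hj, if_false]
          intro h7
          refine h6 (Finset.mem_erase.2 ⟨?_, h7⟩)
          rintro h8
          grind
    by_cases hLT : S.L i ∈ T <;> by_cases hRT : S.R i ∈ T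
    · have hBT : S.B i ∉ T := by
        intro hBT
        obtain ⟨β, h1, h2, h3⟩ := hT _ hBT
        have h4 := h3 _ hLT (S.LB i hi)
        have h5 := h3 _ hRT (S.RB i hi)
        rw [h1 i hi, h4, h5] at h2
        simp at h2
      -- the two edges at the eliminated vertex are replaced by the base of the triangle
      set T0 := insert (S.B i) ((T.erase (S.L i)).erase (S.R i)) with hT0
      have hcard : T0.card = T.card - 1 := by
        have h1 : 0 < T.card := Finset.card_pos.2 ⟨_, hLT⟩
        have h2 : S.R i ∈ T.erase (S.L i) := Finset.mem_erase.2 ⟨hLR.symm, hRT⟩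
        have h3 := Finset.card_pos.2 ⟨_, h2⟩
        rw [hT0, Finset.card_insert_of_notMem, Finset.card_erase_of_mem h2,
          Finset.card_erase_of_mem hLT]
        · rw [Finset.card_erase_of_mem hLT] at h3; omega
        · simp [hBT]
      have hE : T0 ⊆ S.E (i + 1) := by
        intro h hh
        rw [hT0, Finset.mem_insert, Finset.mem_erase, Finset.mem_erase] at hh
        rcases hh with rfl | ⟨h1, h2, h3⟩
        · exact hB
        · have h4 := hTE h3
          rw [mem_E_succ hi] at h4
          tauto
      have hA : S.IsAcyclic T0 := by
        intro t ht
        rw [hT0, Finset.mem_insert, Finset.mem_erase, Finset.mem_erase] at ht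
        rcases ht with rfl | ⟨h1, h2, h3⟩
        · obtain ⟨β, h4, h5, h6⟩ := hT _ hLT
          refine ⟨β, h4, ?_, ?_⟩
          · rw [h4 i hi, h5, h6 _ hRT hLR.symm]; rfl
          · intro t' ht' hne
            rw [hT0, Finset.mem_insert, Finset.mem_erase, Finset.mem_erase] at ht'
            rcases ht' with rfl | ⟨h7, h8, h9⟩
            · exact absurd rfl hne
            · exact h6 _ h9 h8
        · obtain ⟨β, h4, h5, h6⟩ := hT _ h3
          refine ⟨β, h4, h5, ?_⟩
          intro t' ht' hne
          rw [hT0, Finset.mem_insert, Finset.mem_erase, Finset.mem_erase] at ht'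
          rcases ht' with rfl | ⟨h7, h8, h9⟩
          · rw [h4 i hi, h6 _ hLT (Ne.symm h2), h6 _ hRT (Ne.symm h1)]; rfl
          · exact h6 _ h9 hne
      obtain ⟨h1, h2⟩ := ih hE hA
      have hpos : 0 < T.card := Finset.card_pos.2 ⟨_, hLT⟩
      refine ⟨by omega, fun hc => ?_⟩
      obtain ⟨e, he, heT⟩ := h2 (by omega)
      refine ⟨_, he.cons (x := S.B i) (by rw [mem_tri]; simp) ?_, ?_⟩
      · intro j h3 h4 h5
        exact heT j h3 h4 (by rw [h5, hT0]; exact Finset.mem_insert_self _ _)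
      · intro j h3 h4
        by_cases hj : j = i
        · simpa [hj] using hBT
        · have h5 := hsub j (by omega) h4 he
          have h6 := heT j (by omega) h4
          simp only [hj, if_false]
          intro h7
          refine h6 ?_
          rw [hT0, Finset.mem_insert, Finset.mem_erase, Finset.mem_erase]
          refine Or.inr ⟨?_, ?_, h7⟩ <;> intro h8 <;> grind
    · exact one _ _ (Or.inr ⟨rfl, rfl⟩) hRT hLT
    · exact one _ _ (Or.inl ⟨rfl, rfl⟩) hLT hRT
    · have hE : T ⊆ S.E (i + 1) := by
        intro h hh
        have h1 := hTE hh
        rw [mem_E_succ hi] at h1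
        grind
      obtain ⟨h1, h2⟩ := ih hE hT
      exact ⟨by omega, fun hc => by omega⟩

/-! ### Distances in a spanning tree -/

/-- A spanning tree, given by its edges and the fundamental cut of each of them. -/
structure Tree (S : Scheme) where
  T : Finset ℕ
  cut : ℕ → ℕ → Bool
  sub : T ⊆ Finset.range S.N
  card : T.card = S.K + 1
  isCut : ∀ t ∈ T, S.IsCut (cut t)
  self : ∀ t ∈ T, cut t t = true
  other : ∀ t ∈ T, ∀ t' ∈ T, t' ≠ t → cut t t' = false
  pos : ∀ h < S.N, ∃ t ∈ T, cut t h = true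

/-- The tree edges on the path in the tree between the ends of `h`: those whose fundamental cut
contains `h`. -/
def Tree.path (τ : S.Tree) (h : ℕ) : Finset ℕ := τ.T.filter fun t => τ.cut t h = true

lemma Tree.mem_path {τ : S.Tree} {h t : ℕ} : t ∈ τ.path h ↔ t ∈ τ.T ∧ τ.cut t h = true := by
  simp [Tree.path]

lemma Tree.path_of_mem (τ : S.Tree) {h : ℕ} (hh : h ∈ τ.T) : τ.path h = {h} := by
  ext t
  rw [Tree.mem_path, Finset.mem_singleton]
  constructor
  · rintro ⟨h1, h2⟩
    by_contra hne
    rw [τ.other t h1 h hh (Ne.symm hne)] at h2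
    simp at h2
  · rintro rfl
    exact ⟨hh, τ.self _ hh⟩

lemma Tree.isAcyclic (τ : S.Tree) : S.IsAcyclic τ.T := fun t ht =>
  ⟨τ.cut t, τ.isCut t ht, τ.self t ht, fun t' h h' => τ.other t ht t' h h'⟩

lemma Tree.exists_choice (τ : S.Tree) : ∃ e, S.IsChoice 0 e ∧ ∀ j < S.K, e j ∉ τ.T := by
  have h := S.exists_choice (Nat.zero_le _) (by simpa [S.E_zero] using τ.sub) τ.isAcyclic
  obtain ⟨e, h1, h2⟩ := h.2 (by simpa using τ.card)
  exact ⟨e, h1, fun j hj => h2 j (Nat.zero_le _) hj⟩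

/-- The edges that are not chosen are as many as those of a spanning tree. -/
lemma card_T {e : ℕ → ℕ} (he : S.IsChoice 0 e) : (S.T 0 e).card = S.K + 1 := by
  have h1 : S.T 0 e = S.E 0 \ (Finset.range S.K).image e := by
    ext h
    simp only [mem_T, Finset.mem_sdiff, Finset.mem_image, Finset.mem_range, not_exists, not_and]
    constructor
    · rintro ⟨h2, h3⟩; exact ⟨h2, fun j hj => h3 j (Nat.zero_le _) hj⟩
    · rintro ⟨h2, h3⟩; exact ⟨h2, fun j _ hj => h3 j hj⟩
  rw [h1, Finset.card_sdiff_of_subset, Finset.card_image_of_injOn, Finset.card_range,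
    S.card_E (Nat.zero_le _)]
  · omega
  · intro j hj k hk h
    exact he.inj j k (Nat.zero_le _) (by simpa using hj) (Nat.zero_le _) (by simpa using hk) h
  · intro h hh
    obtain ⟨j, hj, rfl⟩ := Finset.mem_image.1 hh
    rw [Finset.mem_range] at hj
    exact tri_subset_E (Nat.zero_le _) hj (he.mem j (Nat.zero_le _) hj)

lemma Tree.T_eq (τ : S.Tree) {e : ℕ → ℕ} (he : S.IsChoice 0 e) (hd : ∀ j < S.K, e j ∉ τ.T) :
    τ.T = S.T 0 e := by
  apply Finset.eq_of_subset_of_card_le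
  · intro h hh
    rw [mem_T, S.E_zero]
    exact ⟨τ.sub hh, fun j _ hj h1 => hd j hj (h1 ▸ hh)⟩
  · rw [card_T he, τ.card]

/-- The path of the chosen edge of a triangle is composed of those of its other two edges. -/
lemma Tree.path_choice (τ : S.Tree) {e : ℕ → ℕ} (he : S.IsChoice 0 e) (hd : ∀ j < S.K, e j ∉ τ.T)
    {i x y : ℕ} (hi : i < S.K) (hxy : S.tri i = {e i, x, y}) (h1 : x ≠ e i) (h2 : y ≠ e i)
    (h3 : x ≠ y) :
    Disjoint (τ.path x) (τ.path y) ∧ τ.path (e i) = τ.path x ∪ τ.path y := by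
  have key : ∀ t ∈ τ.T, (τ.cut t (e i) = xor (τ.cut t x) (τ.cut t y)) ∧
      ¬ (τ.cut t x = true ∧ τ.cut t y = true) := by
    intro t ht
    have hc := τ.isCut t ht i hi
    have hL : S.L i ∈ S.tri i := mem_tri.2 (Or.inl rfl)
    have hR : S.R i ∈ S.tri i := mem_tri.2 (Or.inr (Or.inl rfl))
    have hB : S.B i ∈ S.tri i := mem_tri.2 (Or.inr (Or.inr rfl))
    have hch := S.cut_choice (τ.isCut t ht) (Nat.zero_le _) he (by
      rw [← τ.T_eq he hd]
      intro h hh h' hh' hb hb'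
      by_contra hne
      have : h ≠ t ∨ h' ≠ t := by
        by_contra hcon
        push Not at hcon
        exact hne (hcon.1.trans hcon.2.symm)
      rcases this with h4 | h4
      · rw [τ.other t ht h hh h4] at hb; simp at hb
      · rw [τ.other t ht h' hh' h4] at hb'; simp at hb') i (Nat.zero_le _) hi
    have hx : x ∈ S.tri i := by rw [hxy]; simp
    have hy : y ∈ S.tri i := by rw [hxy]; simp
    have he' := he.mem i (Nat.zero_le _) hi
    -- the cut meets the triangle in an even number of edges
    have par : τ.cut t (e i) = xor (τ.cut t x) (τ.cut t y) := by
      have h4 := S.LR i hi; have h5 := S.LB i hi; have h6 := S.RB i hi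
      rw [mem_tri] at hx hy he'
      clear hch
      revert hc
      rcases he' with h | h | h <;> rcases hx with h' | h' | h' <;>
        rcases hy with h'' | h'' | h'' <;>
        first
        | (exfalso; omega)
        | (rw [h, h', h'']
           cases τ.cut t (S.L i) <;> cases τ.cut t (S.R i) <;> cases τ.cut t (S.B i) <;> simp)
    refine ⟨par, fun ⟨ha, hb⟩ => ?_⟩
    have := hch x hx ha
    rw [par, ha, hb] at this
    simp at this
  constructor
  · rw [Finset.disjoint_left]
    intro t ht ht'
    rw [Tree.mem_path] at ht ht'
    exact (key t ht.1).2 ⟨ht.2, ht'.2⟩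
  · ext t
    rw [Finset.mem_union, Tree.mem_path, Tree.mem_path, Tree.mem_path]
    constructor
    · rintro ⟨ht, h⟩
      rw [(key t ht).1] at h
      revert h
      cases τ.cut t x <;> cases τ.cut t y <;> simp [ht]
    · rintro (⟨ht, h⟩ | ⟨ht, h⟩)
      · refine ⟨ht, ?_⟩
        have h4 := (key t ht).2
        rw [(key t ht).1, h]
        revert h4
        rw [h]
        cases τ.cut t y <;> simp
      · refine ⟨ht, ?_⟩
        have h4 := (key t ht).2
        rw [(key t ht).1, h]
        revert h4
        rw [h]
        cases τ.cut t x <;> simp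

end Scheme

namespace Scheme
variable {S : Scheme}

/-! ### The lower bound, by linear programming duality -/

lemma exists_others {i h : ℕ} (hi : i < S.K) (hh : h ∈ S.tri i) :
    ∃ x y, S.tri i = {h, x, y} ∧ x ≠ h ∧ y ≠ h ∧ x ≠ y := by
  have h1 := S.LR i hi; have h2 := S.LB i hi; have h3 := S.RB i hi
  rw [mem_tri] at hh
  rcases hh with rfl | rfl | rfl
  · exact ⟨S.R i, S.B i, rfl, h1.symm, h2.symm, h3⟩
  · exact ⟨S.L i, S.B i, by ext; simp [tri]; tauto, h1, h3.symm, h2⟩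
  · exact ⟨S.L i, S.R i, by ext; simp [tri]; tauto, h2, h3, h1⟩

/-- The number of edges on the path in the tree between the ends of `h`. -/
def Tree.dist (τ : S.Tree) (h : ℕ) : ℕ := (τ.path h).card

lemma Tree.dist_of_mem (τ : S.Tree) {h : ℕ} (hh : h ∈ τ.T) : τ.dist h = 1 := by
  simp [Tree.dist, τ.path_of_mem hh]

lemma Tree.dist_pos (τ : S.Tree) {h : ℕ} (hh : h < S.N) : 1 ≤ τ.dist h := by
  obtain ⟨t, h1, h2⟩ := τ.pos h hh
  exact Finset.card_pos.2 ⟨t, Tree.mem_path.2 ⟨h1, h2⟩⟩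

/-- The path of the chosen edge consists of the paths of the other two edges of the triangle. -/
lemma Tree.sum_dist_tri (τ : S.Tree) {e : ℕ → ℕ} (he : S.IsChoice 0 e)
    (hd : ∀ j < S.K, e j ∉ τ.T) {i : ℕ} (hi : i < S.K) :
    ∑ h ∈ S.tri i, τ.dist h = 2 * τ.dist (e i) := by
  obtain ⟨x, y, h1, h2, h3, h4⟩ := exists_others hi (he.mem i (Nat.zero_le _) hi)
  obtain ⟨h5, h6⟩ := τ.path_choice he hd hi h1 h2 h3 h4
  have h7 : τ.dist (e i) = τ.dist x + τ.dist y := by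
    rw [Tree.dist, h6, Finset.card_union_of_disjoint h5]; rfl
  rw [h1, Finset.sum_insert, Finset.sum_insert, Finset.sum_singleton, h7]
  · ring
  · simpa using h4
  · simpa using ⟨h2.symm, h3.symm⟩

/-- The slack of the dual constraint for the edge `h`. -/
def slack (S : Scheme) (c a e : ℕ → ℕ) (h : ℕ) : ℤ :=
  c h + ∑ i ∈ Finset.range S.K, (if h ∈ S.tri i then (a i : ℤ) else 0)
    - 2 * ∑ i ∈ Finset.range S.K, (if e i = h then (a i : ℤ) else 0)

/-- Exchange of the summations over the edges and over the triangles. -/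
lemma sum_slack_mul (c a e f : ℕ → ℕ) (he : ∀ i < S.K, e i ∈ S.tri i) :
    ∑ h ∈ Finset.range S.N, S.slack c a e h * f h = ∑ h ∈ Finset.range S.N, (c h * f h : ℤ)
      + ∑ i ∈ Finset.range S.K, (a i : ℤ) * (∑ h ∈ S.tri i, (f h : ℤ) - 2 * f (e i)) := by
  have h1 : ∑ h ∈ Finset.range S.N,
      (∑ i ∈ Finset.range S.K, (if h ∈ S.tri i then (a i : ℤ) else 0)) * f h
      = ∑ i ∈ Finset.range S.K, (a i : ℤ) * ∑ h ∈ S.tri i, (f h : ℤ) := by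
    simp_rw [Finset.sum_mul]
    rw [Finset.sum_comm]
    refine Finset.sum_congr rfl fun i hi => ?_
    rw [Finset.mem_range] at hi
    rw [Finset.mul_sum, ← Finset.sum_subset (s₁ := S.tri i) (s₂ := Finset.range S.N)]
    · exact Finset.sum_congr rfl fun h hh => by simp [hh]
    · intro h hh; exact Finset.mem_range.2 (S.tri_lt hi hh)
    · intro h _ hh; simp [hh]
  have h2 : ∑ h ∈ Finset.range S.N,
      (∑ i ∈ Finset.range S.K, (if e i = h then (a i : ℤ) else 0)) * f h
      = ∑ i ∈ Finset.range S.K, (a i : ℤ) * f (e i) := by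
    simp_rw [Finset.sum_mul]
    rw [Finset.sum_comm]
    refine Finset.sum_congr rfl fun i hi => ?_
    rw [Finset.mem_range] at hi
    rw [Finset.sum_eq_single (e i)]
    · simp
    · intro h _ hh; simp [Ne.symm hh]
    · intro h; exact absurd (Finset.mem_range.2 (S.tri_lt hi (he i hi))) h
  have h3 : ∀ h ∈ Finset.range S.N, S.slack c a e h * f h = (c h * f h : ℤ)
      + (∑ i ∈ Finset.range S.K, (if h ∈ S.tri i then (a i : ℤ) else 0)) * f h
      - 2 * ((∑ i ∈ Finset.range S.K, (if e i = h then (a i : ℤ) else 0)) * f h) := by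
    intro h _; rw [slack]; ring
  rw [Finset.sum_congr rfl h3, Finset.sum_sub_distrib, Finset.sum_add_distrib, ← Finset.mul_sum,
    h1, h2, Finset.mul_sum, add_sub_assoc, ← Finset.sum_sub_distrib]
  congr 1
  exact Finset.sum_congr rfl fun i _ => by ring

/-- The sum of `a` over the triangles with the edge `h`, other than the `i`-th one. -/
def around (S : Scheme) (a : ℕ → ℕ) (i h : ℕ) : ℕ :=
  ∑ q ∈ (Finset.range S.K).filter (fun q => h ∈ S.tri q ∧ q ≠ i), a q

/-- The slack of a chosen edge: the weight of its own triangle is counted once and subtracted twice.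
-/
lemma slack_choice {c a e : ℕ → ℕ} (he : S.IsChoice 0 e) {i : ℕ} (hi : i < S.K) :
    S.slack c a e (e i) = (c (e i) + S.around a i (e i) : ℕ) - (a i : ℤ) := by
  have h0 := he.mem i (Nat.zero_le _) hi
  have h1 : ∑ j ∈ Finset.range S.K, (if e j = e i then (a j : ℤ) else 0) = a i := by
    rw [Finset.sum_eq_single i]
    · simp
    · intro j hj hne
      rw [if_neg]
      intro h
      exact hne (he.inj j i (Nat.zero_le _) (by simpa using hj) (Nat.zero_le _) hi h)
    · intro h; exact absurd (Finset.mem_range.2 hi) h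
  have h2 : ∑ j ∈ Finset.range S.K, (if e i ∈ S.tri j then (a j : ℤ) else 0)
      = a i + (S.around a i (e i) : ℕ) := by
    rw [← Finset.add_sum_erase _ _ (Finset.mem_range.2 hi), if_pos h0, around, Nat.cast_sum,
      Finset.sum_filter]
    congr 1
    rw [← Finset.sum_subset (Finset.erase_subset i (Finset.range S.K))]
    · refine Finset.sum_congr rfl fun j hj => ?_
      simp [Finset.ne_of_mem_erase hj]
    · intro j h3 h4
      have : j = i := by
        by_contra hne
        exact h4 (Finset.mem_erase.2 ⟨hne, h3⟩)
      simp [this]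
  rw [slack, h1, h2]
  push_cast
  ring

/-- The duality identity: the last sum is the defect in the bound by the weights `a`. -/
lemma Tree.sum_eq (τ : S.Tree) (c a : ℕ → ℕ) {e : ℕ → ℕ} (he : S.IsChoice 0 e)
    (hd : ∀ j < S.K, e j ∉ τ.T) :
    (∑ h ∈ Finset.range S.N, c h * τ.dist h : ℤ) =
      ∑ h ∈ Finset.range S.N, (c h : ℤ) + ∑ i ∈ Finset.range S.K, (a i : ℤ)
      + ∑ h ∈ Finset.range S.N, S.slack c a e h * ((τ.dist h : ℤ) - 1) := by
  have hmem : ∀ i < S.K, e i ∈ S.tri i := fun i hi => he.mem i (Nat.zero_le _) hi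
  have h1 := sum_slack_mul c a e τ.dist hmem
  have h2 := sum_slack_mul c a e (fun _ => 1) hmem
  have h3 : ∑ i ∈ Finset.range S.K, (a i : ℤ) * (∑ h ∈ S.tri i, (τ.dist h : ℤ) - 2 * τ.dist (e i))
      = 0 := by
    refine Finset.sum_eq_zero fun i hi => ?_
    rw [Finset.mem_range] at hi
    have := τ.sum_dist_tri he hd hi
    zify at this
    rw [this]; ring
  have h4 : ∑ i ∈ Finset.range S.K, (a i : ℤ) * (∑ h ∈ S.tri i, ((1 : ℕ) : ℤ) - 2 * (1 : ℕ))
      = ∑ i ∈ Finset.range S.K, (a i : ℤ) := by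
    refine Finset.sum_congr rfl fun i hi => ?_
    rw [Finset.mem_range] at hi
    rw [S.sum_tri _ hi]; push_cast; ring
  rw [h3] at h1
  rw [h4] at h2
  simp only [Nat.cast_one, mul_one] at h2
  simp_rw [mul_sub, mul_one]
  rw [Finset.sum_sub_distrib, h1, h2]
  ring

/-- A solution `a` of the dual program bounds the total length of the tree paths from below. -/
lemma Tree.le_sum (τ : S.Tree) (c a : ℕ → ℕ)
    (ha : ∀ i < S.K, ∀ h ∈ S.tri i, a i ≤ c h + S.around a i h) :
    ∑ h ∈ Finset.range S.N, c h + ∑ i ∈ Finset.range S.K, a i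
      ≤ ∑ h ∈ Finset.range S.N, c h * τ.dist h := by
  obtain ⟨e, he, hd⟩ := τ.exists_choice
  have h1 := τ.sum_eq c a he hd
  have h2 : 0 ≤ ∑ h ∈ Finset.range S.N, S.slack c a e h * ((τ.dist h : ℤ) - 1) := by
    refine Finset.sum_nonneg fun h hh => ?_
    rw [Finset.mem_range] at hh
    by_cases hT : h ∈ τ.T
    · simp [τ.dist_of_mem hT]
    · rw [τ.T_eq he hd, mem_T, S.E_zero] at hT
      push Not at hT
      obtain ⟨i, _, hi, rfl⟩ := hT (Finset.mem_range.2 hh)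
      have h3 := τ.dist_pos hh
      have h4 := ha i hi _ (he.mem i (Nat.zero_le _) hi)
      rw [slack_choice he hi]
      apply mul_nonneg <;> omega
  zify
  omega

/-- The bound is attained if the dual constraints of the chosen edges are tight. -/
lemma Tree.sum_eq_of_tight (τ : S.Tree) (c a : ℕ → ℕ) {e : ℕ → ℕ} (he : S.IsChoice 0 e)
    (hd : ∀ j < S.K, e j ∉ τ.T) (ha : ∀ i < S.K, a i = c (e i) + S.around a i (e i)) :
    ∑ h ∈ Finset.range S.N, c h * τ.dist h
      = ∑ h ∈ Finset.range S.N, c h + ∑ i ∈ Finset.range S.K, a i := by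
  have h1 := τ.sum_eq c a he hd
  have h2 : ∑ h ∈ Finset.range S.N, S.slack c a e h * ((τ.dist h : ℤ) - 1) = 0 := by
    refine Finset.sum_eq_zero fun h hh => ?_
    rw [Finset.mem_range] at hh
    by_cases hT : h ∈ τ.T
    · simp [τ.dist_of_mem hT]
    · rw [τ.T_eq he hd, mem_T, S.E_zero] at hT
      push Not at hT
      obtain ⟨i, _, hi, rfl⟩ := hT (Finset.mem_range.2 hh)
      rw [slack_choice he hi, ← ha i hi]
      simp
  zify
  omega

/-! ### The dynamic program -/

/-- The tables of the dynamic program. `CS h` is the least number of edges (counted with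
multiplicity `c`) of a cut through `h` in the part of the graph eliminated before `h`, `DL i` the
same for the `i`-th triangle, without its base. `U h` is the least number of edges of a cut through
`h` in the rest of the graph, without `h`. Finally `e i` is an edge of the `i`-th triangle in a
least cut. -/
structure Tables (S : Scheme) (c : ℕ → ℕ) where
  CS : ℕ → ℕ
  DL : ℕ → ℕ
  U : ℕ → ℕ
  e : ℕ → ℕ
  CS_eq : ∀ h < S.N, CS h = c h + ∑ j ∈ (Finset.range S.K).filter (fun j => S.B j = h), DL j
  DL_eq : ∀ i < S.K, DL i = min (CS (S.L i)) (CS (S.R i))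
  U_L : ∀ i < S.K, U (S.L i) = min (CS (S.R i)) (U (S.B i) + CS (S.B i) - DL i)
  U_R : ∀ i < S.K, U (S.R i) = min (CS (S.L i)) (U (S.B i) + CS (S.B i) - DL i)
  U_root : ∀ h, (∀ i < S.K, h ≠ S.L i ∧ h ≠ S.R i) → U h = 0
  e_base : ∀ i < S.K, (∀ j, i < j → j < S.K → e j ≠ S.B i) →
    U (S.B i) + CS (S.B i) - DL i ≤ DL i → e i = S.B i
  e_left : ∀ i < S.K, ¬ ((∀ j, i < j → j < S.K → e j ≠ S.B i) ∧
    U (S.B i) + CS (S.B i) - DL i ≤ DL i) → CS (S.L i) ≤ CS (S.R i) → e i = S.L i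
  e_right : ∀ i < S.K, ¬ ((∀ j, i < j → j < S.K → e j ≠ S.B i) ∧
    U (S.B i) + CS (S.B i) - DL i ≤ DL i) → ¬ CS (S.L i) ≤ CS (S.R i) → e i = S.R i

namespace Tables
variable {c : ℕ → ℕ} (D : S.Tables c)

/-- The least size of a cut through the edge `h` in the branch of the `i`-th triangle at `h`. -/
def A (i h : ℕ) : ℕ := if h = S.B i then D.DL i else D.U h

/-- The least size of a cut through the edge `h` in all but the branch of the `i`-th triangle. -/
def C (i h : ℕ) : ℕ :=
  c h + ∑ q ∈ (Finset.range S.K).filter (fun q => h ∈ S.tri q ∧ q ≠ i), D.A q h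

/-- The least size of a cut through an edge of the `i`-th triangle outside of the triangle. -/
def a (i : ℕ) : ℕ := min (D.U (S.B i) + D.CS (S.B i) - D.DL i) (D.DL i)

/-- A least cut through the edge `h` in the whole graph, in terms of the branches at `h`. -/
lemma total {h : ℕ} (hh : h < S.N) :
    D.U h + D.CS h = c h + ∑ q ∈ (Finset.range S.K).filter (fun q => h ∈ S.tri q), D.A q h := by
  have hs : ∑ q ∈ (Finset.range S.K).filter (fun q => S.B q = h), D.DL q
      = ∑ q ∈ (Finset.range S.K).filter (fun q => S.B q = h), D.A q h :=
    Finset.sum_congr rfl fun q hq => by simp [A, (Finset.mem_filter.1 hq).2]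
  rw [D.CS_eq h hh, hs]
  by_cases hown : ∃ i < S.K, h = S.L i ∨ h = S.R i
  · obtain ⟨i, hi, ho⟩ := hown
    have hset : (Finset.range S.K).filter (fun q => h ∈ S.tri q)
        = insert i ((Finset.range S.K).filter (fun q => S.B q = h)) := by
      ext q
      simp only [Finset.mem_filter, Finset.mem_range, Finset.mem_insert, mem_tri]
      have h1 := S.L_fresh q i; have h2 := S.R_fresh q i
      have h3 := S.L_fresh i q; have h4 := S.R_fresh i q
      constructor
      · rintro ⟨hq, h5⟩
        rcases lt_trichotomy q i with h6 | h6 | h6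
        · have := h1 h6 hi; have := h2 h6 hi
          refine Or.inr ⟨hq, by grind⟩
        · exact Or.inl h6
        · have := h3 h6 hq; have := h4 h6 hq
          grind
      · rintro (rfl | ⟨h5, h6⟩)
        · exact ⟨hi, by tauto⟩
        · exact ⟨h5, Or.inr (Or.inr h6.symm)⟩
    have hne : S.B i ≠ h := by
      have := S.LB i hi; have := S.RB i hi
      grind
    rw [hset, Finset.sum_insert (by simp [hne])]
    have : D.A i h = D.U h := by simp [A, hne.symm]
    rw [this]; ring
  · push Not at hown
    rw [D.U_root h hown]
    have hset : (Finset.range S.K).filter (fun q => h ∈ S.tri q)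
        = (Finset.range S.K).filter (fun q => S.B q = h) := by
      refine Finset.filter_congr fun q hq => ?_
      have := hown q (Finset.mem_range.1 hq)
      rw [mem_tri]
      grind
    rw [hset]; ring

lemma C_add {i h : ℕ} (hi : i < S.K) (hh : h ∈ S.tri i) : D.U h + D.CS h = D.C i h + D.A i h := by
  rw [D.total (S.tri_lt hi hh), C]
  rw [← Finset.add_sum_erase _ _ (Finset.mem_filter.2 ⟨Finset.mem_range.2 hi, hh⟩)]
  have : ((Finset.range S.K).filter (fun q => h ∈ S.tri q)).erase i
      = (Finset.range S.K).filter (fun q => h ∈ S.tri q ∧ q ≠ i) := by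
    ext q; simp [Finset.mem_erase]; tauto
  rw [this]; ring

lemma A_le_C {i j h : ℕ} (hj : j < S.K) (hh : h ∈ S.tri j) (hij : j ≠ i) :
    D.A j h ≤ D.C i h := by
  have hm : j ∈ (Finset.range S.K).filter (fun q => h ∈ S.tri q ∧ q ≠ i) :=
    Finset.mem_filter.2 ⟨Finset.mem_range.2 hj, hh, hij⟩
  have := Finset.single_le_sum (f := fun q => D.A q h) (fun _ _ => Nat.zero_le _) hm
  rw [C]
  omega

lemma C_values {i : ℕ} (hi : i < S.K) : D.C i (S.L i) = D.CS (S.L i) ∧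
    D.C i (S.R i) = D.CS (S.R i) ∧
    D.C i (S.B i) = D.U (S.B i) + D.CS (S.B i) - D.DL i := by
  have h1 := D.C_add hi (mem_tri.2 (Or.inl rfl))
  have h2 := D.C_add hi (mem_tri.2 (Or.inr (Or.inl rfl)))
  have h3 := D.C_add hi (mem_tri.2 (Or.inr (Or.inr rfl)))
  have h4 := S.LB i hi; have h5 := S.RB i hi
  simp only [A, h4, h5, if_true, if_false] at h1 h2 h3
  omega

/-- A cut through one edge of a triangle also contains exactly one of the other two edges, and goes
on beyond that edge. -/
lemma A_values {i : ℕ} (hi : i < S.K) : D.A i (S.L i) = min (D.C i (S.R i)) (D.C i (S.B i)) ∧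
    D.A i (S.R i) = min (D.C i (S.L i)) (D.C i (S.B i)) ∧
    D.A i (S.B i) = min (D.C i (S.L i)) (D.C i (S.R i)) := by
  have h4 := S.LB i hi; have h5 := S.RB i hi
  obtain ⟨h1, h2, h3⟩ := D.C_values hi
  simp only [A, h4, h5, if_true, if_false, h1, h2, h3]
  exact ⟨D.U_L i hi, D.U_R i hi, D.DL_eq i hi⟩

lemma a_eq {i : ℕ} (hi : i < S.K) :
    D.a i = min (D.C i (S.L i)) (min (D.C i (S.R i)) (D.C i (S.B i))) := by
  obtain ⟨h1, h2, h3⟩ := D.C_values hi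
  rw [a, h1, h2, h3, D.DL_eq i hi]
  omega

/-- The least cut lies beyond `h`, or beyond one of the other two edges, that is in the branch of
the triangle at `h`. -/
lemma a_eq_min {i h : ℕ} (hi : i < S.K) (hh : h ∈ S.tri i) :
    D.a i = min (D.A i h) (D.C i h) := by
  obtain ⟨h1, h2, h3⟩ := D.A_values hi
  rw [D.a_eq hi]
  rcases mem_tri.1 hh with rfl | rfl | rfl <;> simp only [h1, h2, h3] <;> omega

lemma A_le_of_ne {i h x : ℕ} (hi : i < S.K) (hh : h ∈ S.tri i) (hx : x ∈ S.tri i) (hne : x ≠ h) :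
    D.A i h ≤ D.C i x := by
  obtain ⟨h1, h2, h3⟩ := D.A_values hi
  rcases mem_tri.1 hh with rfl | rfl | rfl <;> rcases mem_tri.1 hx with rfl | rfl | rfl <;>
    simp only [h1, h2, h3] <;> omega

/-- A base is chosen only if it is not yet chosen for a later triangle. -/
lemma e_cases {i : ℕ} (hi : i < S.K) :
    (D.e i = S.B i ∧ (∀ j, i < j → j < S.K → D.e j ≠ S.B i)) ∨ D.e i = S.L i ∨ D.e i = S.R i := by
  by_cases h1 : (∀ j, i < j → j < S.K → D.e j ≠ S.B i) ∧
      D.U (S.B i) + D.CS (S.B i) - D.DL i ≤ D.DL i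
  · exact Or.inl ⟨D.e_base i hi h1.1 h1.2, h1.1⟩
  · by_cases h2 : D.CS (S.L i) ≤ D.CS (S.R i)
    · exact Or.inr (Or.inl (D.e_left i hi h1 h2))
    · exact Or.inr (Or.inr (D.e_right i hi h1 h2))

lemma e_mem {i : ℕ} (hi : i < S.K) : D.e i ∈ S.tri i := by
  rw [mem_tri]
  have := D.e_cases hi
  tauto

lemma isChoice : S.IsChoice 0 D.e := by
  refine ⟨fun j _ hj => D.e_mem hj, ?_⟩
  have key : ∀ j k, j < k → k < S.K → D.e j ≠ D.e k := by
    intro j k hjk hk h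
    have h1 := D.e_mem hk
    rw [← h, mem_tri] at h1
    have h2 := S.L_fresh j k hjk hk; have h3 := S.R_fresh j k hjk hk
    rcases D.e_cases (show j < S.K by omega) with ⟨h4, h5⟩ | h4 | h4
    · exact h5 k hjk hk (h ▸ h4)
    · rw [h4] at h1; tauto
    · rw [h4] at h1; tauto
  intro j k _ hj _ hk h
  rcases lt_trichotomy j k with h1 | h1 | h1
  · exact absurd h (key j k h1 hk)
  · exact h1
  · exact absurd h.symm (key k j h1 hj)

/-- The chosen edge of a triangle lies in a least cut. -/
lemma C_e {i : ℕ} (hi : i < S.K) : D.C i (D.e i) = D.a i := by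
  induction hk : S.K - i using Nat.strong_induction_on generalizing i with
  | _ k ih =>
    obtain ⟨h1, h2, h3⟩ := D.C_values hi
    have h4 := D.DL_eq i hi
    by_cases h5 : (∀ j, i < j → j < S.K → D.e j ≠ S.B i) ∧
        D.U (S.B i) + D.CS (S.B i) - D.DL i ≤ D.DL i
    · rw [D.e_base i hi h5.1 h5.2, h3, a]
      omega
    · have h6 : D.DL i ≤ D.U (S.B i) + D.CS (S.B i) - D.DL i := by
        by_cases h7 : ∀ j, i < j → j < S.K → D.e j ≠ S.B i
        · have : ¬ (D.U (S.B i) + D.CS (S.B i) - D.DL i ≤ D.DL i) := fun h => h5 ⟨h7, h⟩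
          omega
        · -- the base is already the chosen edge of another triangle
          push Not at h7
          obtain ⟨j, hij, hj, hej⟩ := h7
          have h8 := ih (S.K - j) (by omega) hj rfl
          have h9 := D.e_mem hj
          rw [hej] at h8 h9
          have hB : S.B i ∈ S.tri i := mem_tri.2 (Or.inr (Or.inr rfl))
          have h10 := D.A_le_C hi hB (show i ≠ j by omega)
          have h11 := D.A_le_C hj h9 (show j ≠ i by omega)
          have h12 := D.a_eq_min hj h9
          have h13 : D.A i (S.B i) = D.DL i := by simp [A]
          omega
      by_cases h7 : D.CS (S.L i) ≤ D.CS (S.R i)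
      · rw [D.e_left i hi h5 h7, h1, a]; omega
      · rw [D.e_right i hi h5 h7, h2, a]; omega

/-- The dual constraints. If the weight of another triangle at `h` is not the size of its branch at
`h`, it is that of a cut through `h` outside of this branch. Such a cut includes the branch of the
`i`-th triangle at `h`, so this weight is large enough alone. -/
lemma a_le {i h : ℕ} (hi : i < S.K) (hh : h ∈ S.tri i) : D.a i ≤ c h + S.around D.a i h := by
  by_cases hall : ∀ q < S.K, h ∈ S.tri q → q ≠ i → D.a q = D.A q h
  · have : c h + S.around D.a i h = D.C i h := by
      rw [around, C]
      congr 1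
      refine Finset.sum_congr rfl fun q hq => ?_
      simp only [Finset.mem_filter, Finset.mem_range] at hq
      exact hall q hq.1 hq.2.1 hq.2.2
    rw [this, D.a_eq_min hi hh]
    exact min_le_right _ _
  · push Not at hall
    obtain ⟨q, hq, hqh, hqi, hne⟩ := hall
    have h1 := D.a_eq_min hq hqh
    have h2 := D.A_le_C hi hh hqi.symm
    have h3 := D.a_eq_min hi hh
    have hm : q ∈ (Finset.range S.K).filter (fun q => h ∈ S.tri q ∧ q ≠ i) :=
      Finset.mem_filter.2 ⟨Finset.mem_range.2 hq, hqh, hqi⟩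
    have h4 := Finset.single_le_sum (f := D.a) (fun _ _ => Nat.zero_le _) hm
    rw [around]
    omega

/-- The dual constraints of the chosen edges are tight. -/
lemma a_e {i : ℕ} (hi : i < S.K) : D.a i = c (D.e i) + S.around D.a i (D.e i) := by
  rw [← D.C_e hi, C, around]
  congr 1
  refine Finset.sum_congr rfl fun q hq => ?_
  simp only [Finset.mem_filter, Finset.mem_range] at hq
  obtain ⟨hq, hqh, hqi⟩ := hq
  have h1 := D.a_eq_min hq hqh
  have h2 := D.A_le_C hi (D.e_mem hi) hqi.symm
  have h3 := D.a_eq_min hi (D.e_mem hi)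
  have h4 := D.C_e hi
  have h5 := D.A_le_C hq hqh hqi
  omega

/-- An edge without multiplicity that lies in two triangles is chosen. -/
lemma exists_e {h p q : ℕ} (hc : c h = 0) (hpq : p < q) (hq : q < S.K)
    (hset : (Finset.range S.K).filter (fun i => h ∈ S.tri i) = {p, q}) :
    ∃ i < S.K, D.e i = h := by
  by_contra hcon
  push Not at hcon
  have hp : p < S.K := by omega
  have hph : h ∈ S.tri p := by
    have : p ∈ (Finset.range S.K).filter (fun i => h ∈ S.tri i) := by rw [hset]; simp
    exact (Finset.mem_filter.1 this).2
  have hqh : h ∈ S.tri q := by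
    have : q ∈ (Finset.range S.K).filter (fun i => h ∈ S.tri i) := by rw [hset]; simp
    exact (Finset.mem_filter.1 this).2
  have hBp : h = S.B p := by
    have h1 := S.L_fresh p q hpq hq; have h2 := S.R_fresh p q hpq hq
    rw [mem_tri] at hph hqh
    grind
  have hCp : D.C p h = D.A q h := by
    have h1 : (Finset.range S.K).filter (fun i => h ∈ S.tri i ∧ i ≠ p) = {q} := by
      rw [← Finset.filter_filter, hset]
      ext x; simp; grind
    rw [C, h1, hc]; simp
  have hCq : D.C q h = D.A p h := by
    have h1 : (Finset.range S.K).filter (fun i => h ∈ S.tri i ∧ i ≠ q) = {p} := by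
      rw [← Finset.filter_filter, hset]
      ext x; simp; grind
    rw [C, h1, hc]; simp
  have h1 : ¬ D.U (S.B p) + D.CS (S.B p) - D.DL p ≤ D.DL p := by
    intro h2
    exact hcon p hp (hBp ▸ D.e_base p hp (fun j _ hj => hBp ▸ hcon j hj) h2)
  have h2 := (D.C_values hp).2.2
  have h3 : D.A p h = D.DL p := by simp [A, hBp]
  rw [← hBp] at h2 h1
  have h4 := D.a_eq_min hq hqh
  have h5 := D.C_e hq
  have h6 := D.A_le_of_ne hq hqh (D.e_mem hq) (hcon q hq)
  omega

end Tables
end Scheme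

/-! ### Eliminating vertices of degree two from a polygonal 2-tree -/

section Reducible
variable {V : Type*}

/-- The intermediate graphs of the elimination, with adjacency `E`, and `X` for the virtual edges,
each of which stands for an eliminated path and so lies on one polygon only. Such a graph is made
from a triangle by adding triangles on edges that are not virtual, and by subdividing virtual
edges; any of the new edges may be virtual. -/
inductive Reducible : (V → V → Prop) → (V → V → Prop) → Prop
  | triangle {E X : V → V → Prop} (x y z : V) (hxy : x ≠ y) (hxz : x ≠ z) (hyz : y ≠ z)
      (hE : ∀ a b, E a b ↔ a ≠ b ∧ (a = x ∨ a = y ∨ a = z) ∧ (b = x ∨ b = y ∨ b = z))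
      (hX : ∀ a b, X a b → E a b) (hs : ∀ a b, X a b → X b a) : Reducible E X
  | ear {E X E' X' : V → V → Prop} (v u w : V) (h : Reducible E X) (huw : E u w) (hn : ¬ X u w)
      (hv : ∀ y, ¬ E v y)
      (hE : ∀ a b, E' a b ↔ E a b ∨ (a = v ∧ (b = u ∨ b = w)) ∨ (b = v ∧ (a = u ∨ a = w)))
      (hX : ∀ a b, X' a b → E' a b) (hs : ∀ a b, X' a b → X' b a)
      (hXX : ∀ a b, a ≠ v → b ≠ v → (X' a b ↔ X a b)) : Reducible E' X'
  | subdiv {E X E' X' : V → V → Prop} (v u w : V) (h : Reducible E X) (huw : X u w)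
      (hv : ∀ y, ¬ E v y)
      (hE : ∀ a b, E' a b ↔ (E a b ∧ ¬ (a = u ∧ b = w) ∧ ¬ (a = w ∧ b = u)) ∨
        (a = v ∧ (b = u ∨ b = w)) ∨ (b = v ∧ (a = u ∨ a = w)))
      (hX : ∀ a b, X' a b → E' a b) (hs : ∀ a b, X' a b → X' b a)
      (hXX : ∀ a b, a ≠ v → b ≠ v →
        (X' a b ↔ X a b ∧ ¬ (a = u ∧ b = w) ∧ ¬ (a = w ∧ b = u))) : Reducible E' X'

/-- The adjacency after the elimination of `v`, with neighbours `u` and `w`. -/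
def elimE (E : V → V → Prop) (v u w : V) (a b : V) : Prop :=
  (E a b ∧ a ≠ v ∧ b ≠ v) ∨ (a = u ∧ b = w) ∨ (a = w ∧ b = u)

/-- The virtual edges after the elimination of `v`, with neighbours `u` and `w`. -/
def elimX (E X : V → V → Prop) (v u w : V) (a b : V) : Prop :=
  (X a b ∧ a ≠ v ∧ b ≠ v) ∨ (¬ E u w ∧ ((a = u ∧ b = w) ∨ (a = w ∧ b = u)))

lemma elimE_comm (E : V → V → Prop) (v u w : V) : elimE E v u w = elimE E v w u := by
  ext a b; simp only [elimE]; tauto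

lemma elimX_comm {E : V → V → Prop} (hs : ∀ a b, E a b → E b a) (X : V → V → Prop) (v u w : V) :
    elimX E X v u w = elimX E X v w u := by
  have h : E u w ↔ E w u := ⟨hs _ _, hs _ _⟩
  ext a b; simp only [elimX, h]; tauto

namespace Reducible
variable {E X : V → V → Prop}

/-- Adjacency is symmetric and irreflexive, and the virtual edges form a symmetric subrelation. -/
lemma props (h : Reducible E X) : (∀ a b, E a b → E b a) ∧ (∀ a, ¬ E a a) ∧
    (∀ a b, X a b → E a b) ∧ (∀ a b, X a b → X b a) := by
  induction h with
  | triangle x y z hxy hxz hyz hE hX hs => grind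
  | ear v u w h huw hn hv hE hX hs hXX ih => grind
  | subdiv v u w h huw hv hE hX hs hXX ih => grind

lemma symm (h : Reducible E X) {a b : V} (hab : E a b) : E b a := h.props.1 a b hab

lemma irrefl (h : Reducible E X) (a : V) : ¬ E a a := h.props.2.1 a

/-- A vertex with a neighbour `b` has another neighbour. -/
lemma two_nbrs (h : Reducible E X) {a b : V} (hab : E a b) : ∃ z, z ≠ b ∧ E a z := by
  induction h generalizing a b with
  | triangle x y z hxy hxz hyz hE hX hs =>
    have h1 := hE a x; have h2 := hE a y; have h3 := hE a z; have h4 := hE a b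
    by_cases x = b <;> by_cases y = b <;> by_cases a = x <;> by_cases a = y <;> grind
  | @ear E X E' X' v u w h huw hn hv hE hX hs hXX ih =>
    have hsy := h.props.1; have hirr := h.props.2.1
    by_cases hav : a = v
    · by_cases hbu : b = u
      · exact ⟨w, by grind, by grind⟩
      · exact ⟨u, by grind, by grind⟩
    · by_cases hbv : b = v
      · have : a = u ∨ a = w := by grind
        rcases this with rfl | rfl
        · exact ⟨w, by grind, by grind⟩
        · exact ⟨u, by grind, by grind⟩
      · obtain ⟨z, hz, haz⟩ := ih (show E a b by grind)
        exact ⟨z, hz, by grind⟩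
  | @subdiv E X E' X' v u w h huw hv hE hX hs hXX ih =>
    have hp := h.props
    have hsy := h.props.1; have hirr := h.props.2.1
    have hE' := hp.2.2.1 _ _ huw
    by_cases hav : a = v
    · by_cases hbu : b = u
      · exact ⟨w, by grind, by grind⟩
      · exact ⟨u, by grind, by grind⟩
    · by_cases hbv : b = v
      · have : a = u ∨ a = w := by grind
        rcases this with rfl | rfl
        · obtain ⟨z, hz, haz⟩ := ih hE'
          exact ⟨z, by grind, by grind⟩
        · obtain ⟨z, hz, haz⟩ := ih (hsy _ _ hE')
          exact ⟨z, by grind, by grind⟩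
      · obtain ⟨z, hz, haz⟩ := ih (show E a b by grind)
        by_cases hc : (a = u ∧ z = w) ∨ (a = w ∧ z = u)
        · exact ⟨v, by grind, by grind⟩
        · exact ⟨z, hz, by grind⟩

lemma exists_degree_two (h : Reducible E X) :
    ∃ v u w, u ≠ w ∧ ∀ y, E v y ↔ y = u ∨ y = w := by
  cases h with
  | triangle x y z hxy hxz hyz hE hX hs => exact ⟨x, y, z, hyz, by grind⟩
  | ear v u w h huw hn hv hE hX hs hXX =>
    have hp := h.props
    exact ⟨v, u, w, by grind, by grind⟩
  | subdiv v u w h huw hv hE hX hs hXX =>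
    have hp := h.props
    exact ⟨v, u, w, by grind, by grind⟩

/-- Some three vertices are not isolated. -/
lemma exists_three (h : Reducible E X) :
    ∃ x y z, x ≠ y ∧ x ≠ z ∧ y ≠ z ∧ (∃ a, E x a) ∧ (∃ a, E y a) ∧ (∃ a, E z a) := by
  obtain ⟨v, u, w, huw, hv⟩ := h.exists_degree_two
  have h1 : E v u := (hv u).2 (Or.inl rfl)
  have h2 : E v w := (hv w).2 (Or.inr rfl)
  have h3 := h.irrefl v
  exact ⟨v, u, w, by grind, by grind, huw, ⟨u, h1⟩, ⟨v, h.symm h1⟩, ⟨v, h.symm h2⟩⟩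

/-- The elimination of `v`, with neighbours `u` and `w`, is possible: the graph is a triangle, or
the base is not a virtual edge and the remaining graph is of the same kind. -/
def ElimSpec (E X : V → V → Prop) (v u w : V) : Prop :=
  (E u w ∧ ∀ a b, E a b ↔ a ≠ b ∧ (a = v ∨ a = u ∨ a = w) ∧ (b = v ∨ b = u ∨ b = w)) ∨
    ((E u w → ¬ X u w) ∧ Reducible (elimE E v u w) (elimX E X v u w))

lemma ElimSpec.comm (hs : ∀ a b, E a b → E b a) (hx : ∀ a b, X a b → X b a) {v u w : V}
    (h : ElimSpec E X v u w) : ElimSpec E X v w u := by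
  rw [ElimSpec, elimE_comm, elimX_comm hs]
  rcases h with ⟨h1, h2⟩ | ⟨h1, h2⟩
  · exact Or.inl ⟨hs _ _ h1, by grind⟩
  · exact Or.inr ⟨fun h3 h4 => h1 (hs _ _ h3) (hx _ _ h4), h2⟩

/-- The elimination of an end `u` of a virtual edge `uw` that is subdivided by `v`: eliminate `u`
first, and add `v` afterwards. -/
lemma elim_subdiv_aux {E' X' : V → V → Prop} {v u w z : V} (h : Reducible E X) (huw : X u w)
    (hv : ∀ y, ¬ E v y)
    (hE : ∀ a b, E' a b ↔ (E a b ∧ ¬ (a = u ∧ b = w) ∧ ¬ (a = w ∧ b = u)) ∨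
      (a = v ∧ (b = u ∨ b = w)) ∨ (b = v ∧ (a = u ∨ a = w)))
    (hX : ∀ a b, X' a b → E' a b) (hs : ∀ a b, X' a b → X' b a)
    (hXX : ∀ a b, a ≠ v → b ≠ v →
      (X' a b ↔ X a b ∧ ¬ (a = u ∧ b = w) ∧ ¬ (a = w ∧ b = u)))
    (hz : w ≠ z) (hu : ∀ y, E u y ↔ y = w ∨ y = z)
    (ih : ElimSpec E X u w z) : ElimSpec E' X' u v z := by
  have hp := h.props
  obtain ⟨p1, p2, p3, p4⟩ := hp
  have huz := (hu z).2 (Or.inr rfl)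
  have hnv : v ≠ u ∧ v ≠ w ∧ v ≠ z :=
    ⟨fun h => hv z (h ▸ huz), fun h => hv u (h ▸ p1 _ _ (p3 _ _ huw)),
      fun h => hv u (h ▸ p1 _ _ huz)⟩
  have hnz : z ≠ u := fun h => p2 u (h ▸ huz)
  have hwz : E' v z ↔ False := by grind
  right
  refine ⟨by grind, ?_⟩
  rcases ih with ⟨h1, h2⟩ | ⟨h1, h2⟩
  · refine Reducible.triangle v w z (by grind) (by grind) hz ?_ ?_ ?_
    · intro a b
      simp only [elimE]
      grind
    · intro a b; simp only [elimE, elimX]; grind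
    · intro a b; simp only [elimX]; grind
  · by_cases hc : E w z
    · refine Reducible.ear v w z h2 ?_ ?_ ?_ ?_ ?_ ?_ ?_
      · simp only [elimE]; grind
      · simp only [elimX]; grind
      · intro y; simp only [elimE]; grind
      · intro a b; simp only [elimE]; grind
      · intro a b; simp only [elimE, elimX]; grind
      · intro a b; simp only [elimX]; grind
      · intro a b ha hb; simp only [elimX]; grind
    · refine Reducible.subdiv v w z h2 ?_ ?_ ?_ ?_ ?_ ?_
      · simp only [elimX]; grind
      · intro y; simp only [elimE]; grind
      · intro a b; simp only [elimE]; grind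
      · intro a b; simp only [elimE, elimX]; grind
      · intro a b; simp only [elimX]; grind
      · intro a b ha hb; simp only [elimX]; grind

/-- A vertex of degree two can always be eliminated, and unless the graph is a triangle, the edge
between its neighbours is not yet virtual. -/
theorem elim (h : Reducible E X) {v u w : V} (huw : u ≠ w) (hv : ∀ y, E v y ↔ y = u ∨ y = w) :
    ElimSpec E X v u w := by
  induction h generalizing v u w with
  | triangle x y z hxy hxz hyz hE hX hs =>
    left
    have h1 := hv u; have h2 := hv w
    have h3 : ∀ c, c = x ∨ c = y ∨ c = z ↔ c = v ∨ c = u ∨ c = w := by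
      intro c
      have := hv x; have := hv y; have := hv z
      grind
    refine ⟨by grind, ?_⟩
    intro a b
    rw [hE, h3, h3]
  | @ear E X E' X' v' u' w' h huw' hn hv' hE hX hs hXX ih =>
    obtain ⟨p1, p2, p3, p4⟩ := h.props
    by_cases hvv : v = v'
    · subst hvv
      right
      have hset : u = u' ∧ w = w' ∨ u = w' ∧ w = u' := by
        have := hv u; have := hv w; have := hv u'; have := hv w'; grind
      have hXv : ∀ a b, X a b → a ≠ v ∧ b ≠ v := fun a b hab =>
        ⟨fun h => hv' b (h ▸ p3 _ _ hab), fun h => hv' a (h ▸ p1 _ _ (p3 _ _ hab))⟩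
      have hnv : u' ≠ v ∧ w' ≠ v := by
        constructor <;> rintro rfl <;> grind
      refine ⟨by grind, ?_⟩
      have e1 : elimE E' v u w = E := by
        ext a b; simp only [elimE]; grind
      have e2 : elimX E' X' v u w = X := by
        have : E' u w := by grind
        ext a b; have := hXv a b; have := hXX a b; simp only [elimX]; grind
      rw [e1, e2]; exact h
    · have hvu : v ≠ u' ∧ v ≠ w' := by
        constructor
        · rintro rfl
          obtain ⟨z, hz, hz'⟩ := h.two_nbrs huw'
          have := hv v'; have := hv w'; have := hv z
          grind
        · rintro rfl
          obtain ⟨z, hz, hz'⟩ := h.two_nbrs (p1 _ _ huw')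
          have := hv v'; have := hv u'; have := hv z
          grind
      have hvE : ∀ y, E v y ↔ y = u ∨ y = w := by grind
      have hne : u ≠ v' ∧ w ≠ v' := by
        have := hvE u; have := hvE w; grind
      right
      have hEu : E' u w ↔ E u w := by grind
      have hXu : X' u w ↔ X u w := by grind
      rcases ih huw hvE with ⟨h1, h2⟩ | ⟨h1, h2⟩
      · have hset : u = u' ∧ w = w' ∨ u = w' ∧ w = u' := by
          have := h2 u' w'; grind
        refine ⟨by grind, Reducible.triangle v' u w (by grind) (by grind) huw ?_ ?_ ?_⟩
        · intro a b; simp only [elimE]; grind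
        · intro a b; simp only [elimE, elimX]; grind
        · intro a b; simp only [elimX]; grind
      · refine ⟨by grind, Reducible.ear v' u' w' h2 ?_ ?_ ?_ ?_ ?_ ?_ ?_⟩
        · simp only [elimE]; grind
        · simp only [elimX]; grind
        · intro y; simp only [elimE]; grind
        · intro a b; simp only [elimE]; grind
        · intro a b; simp only [elimE, elimX]; grind
        · intro a b; simp only [elimX]; grind
        · intro a b ha hb; simp only [elimX]; grind
  | @subdiv E X E' X' v' u' w' h huw' hv' hE hX hs hXX ih =>
    obtain ⟨p1, p2, p3, p4⟩ := h.props
    have hEuw' := p3 _ _ huw'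
    have hsE' : ∀ a b, E' a b → E' b a := by
      intro a b hab
      have := hE a b; have := hE b a; grind
    by_cases hvv : v = v'
    · subst hvv
      right
      have hset : u = u' ∧ w = w' ∨ u = w' ∧ w = u' := by
        have := hv u; have := hv w; have := hv u'; have := hv w'; grind
      have hXv : ∀ a b, X a b → a ≠ v ∧ b ≠ v := fun a b hab =>
        ⟨fun h => hv' b (h ▸ p3 _ _ hab), fun h => hv' a (h ▸ p1 _ _ (p3 _ _ hab))⟩
      have hnv : u' ≠ v ∧ w' ≠ v := by
        constructor <;> rintro rfl <;> grind
      have hno : ¬ E' u w := by grind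
      refine ⟨by grind, ?_⟩
      have e1 : elimE E' v u w = E := by
        ext a b; simp only [elimE]; grind
      have e2 : elimX E' X' v u w = X := by
        ext a b; have := hXv a b; have := hXX a b; simp only [elimX]; grind
      rw [e1, e2]; exact h
    · -- the other neighbour of an end of the subdivided edge
      have side : ∀ x y, X x y → (x = u' ∧ y = w' ∨ x = w' ∧ y = u') → v = x →
          ElimSpec E' X' v u w := by
        intro x y hxy hset hvx
        subst hvx
        have hE2 : ∀ a b, E' a b ↔ (E a b ∧ ¬ (a = v ∧ b = y) ∧ ¬ (a = y ∧ b = v)) ∨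
            (a = v' ∧ (b = v ∨ b = y)) ∨ (b = v' ∧ (a = v ∨ a = y)) := by
          intro a b; rw [hE]; grind
        have hXX2 : ∀ a b, a ≠ v' → b ≠ v' →
            (X' a b ↔ X a b ∧ ¬ (a = v ∧ b = y) ∧ ¬ (a = y ∧ b = v)) := by
          intro a b ha hb; rw [hXX a b ha hb]; grind
        have hvE : v' = u ∨ v' = w := by rw [← hv]; grind
        have main : ∀ z, v' ≠ z → (∀ c, E' v c ↔ c = v' ∨ c = z) → ElimSpec E' X' v v' z := by
          intro z hz hz'
          have h1 : ∀ c, E v c ↔ c = y ∨ c = z := by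
            intro c
            have := hz' c; have := hE2 v c; have := p3 _ _ hxy
            grind
          have h2 : y ≠ z := by
            have := hz' y; grind
          exact elim_subdiv_aux h hxy hv' hE2 hX hs hXX2 h2 h1 (ih h2 h1)
        rcases hvE with rfl | rfl
        · exact main w huw hv
        · exact (main u huw.symm (by grind)).comm hsE' hs
      by_cases hvu : v = u'
      · exact side u' w' huw' (Or.inl ⟨rfl, rfl⟩) hvu
      by_cases hvw : v = w'
      · exact side w' u' (p4 _ _ huw') (Or.inr ⟨rfl, rfl⟩) hvw
      have hvE : ∀ y, E v y ↔ y = u ∨ y = w := by grind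
      have hne : u ≠ v' ∧ w ≠ v' := by
        have := hvE u; have := hvE w; grind
      right
      rcases ih huw hvE with ⟨h1, h2⟩ | ⟨h1, h2⟩
      · have hset : u = u' ∧ w = w' ∨ u = w' ∧ w = u' := by
          have := h2 u' w'; grind
        have hno : ¬ E' u w := by grind
        refine ⟨by grind, Reducible.triangle v' u w (by grind) (by grind) huw ?_ ?_ ?_⟩
        · intro a b; simp only [elimE]; grind
        · intro a b; simp only [elimE, elimX]; grind
        · intro a b; simp only [elimX]; grind
      · have hset : ¬ (u = u' ∧ w = w') ∧ ¬ (u = w' ∧ w = u') := by grind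
        have hEu : E' u w ↔ E u w := by grind
        have hXu : X' u w ↔ X u w := by grind
        refine ⟨by grind, Reducible.subdiv v' u' w' h2 ?_ ?_ ?_ ?_ ?_ ?_⟩
        · simp only [elimX]; grind
        · intro y; simp only [elimE]; grind
        · intro a b; simp only [elimE]; grind
        · intro a b; simp only [elimE, elimX]; grind
        · intro a b; simp only [elimX]; grind
        · intro a b ha hb; simp only [elimX]; grind

end Reducible
end Reducible

section Polygonal
variable {V : Type*}

namespace Reducible
variable {E X : V → V → Prop}

/-- Virtual edges may be replaced by real ones. -/
lemma shrink (h : Reducible E X) {Y : V → V → Prop} (hY : ∀ a b, Y a b → X a b)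
    (hs : ∀ a b, Y a b → Y b a) : Reducible E Y := by
  induction h generalizing Y with
  | triangle x y z hxy hxz hyz hE hX _ =>
    exact .triangle x y z hxy hxz hyz hE (fun a b hab => hX a b (hY a b hab)) hs
  | @ear E X E' X' v u w h huw hn hv hE hX hs' hXX ih =>
    refine .ear v u w (ih (Y := fun a b => Y a b ∧ a ≠ v ∧ b ≠ v) ?_ ?_) huw ?_ hv hE ?_ hs ?_
    · rintro a b ⟨h1, h2, h3⟩
      exact (hXX a b h2 h3).1 (hY a b h1)
    · rintro a b ⟨h1, h2, h3⟩
      exact ⟨hs a b h1, h3, h2⟩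
    · rintro ⟨h1, h2, h3⟩
      exact hn ((hXX u w h2 h3).1 (hY u w h1))
    · exact fun a b hab => hX a b (hY a b hab)
    · intro a b h1 h2
      simp [h1, h2]
  | @subdiv E X E' X' v u w h huw hv hE hX hs' hXX ih =>
    have hp := h.props
    have hnv : u ≠ v ∧ w ≠ v := by
      constructor
      · rintro rfl; exact hv w (hp.2.2.1 _ _ huw)
      · rintro rfl; exact hv u (hp.1 _ _ (hp.2.2.1 _ _ huw))
    refine .subdiv v u w
      (ih (Y := fun a b => (Y a b ∧ a ≠ v ∧ b ≠ v) ∨ (a = u ∧ b = w) ∨ (a = w ∧ b = u)) ?_ ?_)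
      (by simp) hv hE (fun a b hab => hX a b (hY a b hab)) hs ?_
    · rintro a b (⟨h1, h2, h3⟩ | ⟨rfl, rfl⟩ | ⟨rfl, rfl⟩)
      · exact ((hXX a b h2 h3).1 (hY a b h1)).1
      · exact huw
      · exact hp.2.2.2 _ _ huw
    · grind
    · intro a b h1 h2
      have := hXX a b h1 h2
      have := hY a b
      grind

/-- A virtual edge may be replaced by a path through new vertices. -/
lemma subdivide {G : SimpleGraph V} {z v : V} (p : G.Walk z v) (hp : p.IsPath)
    (hl : 1 ≤ p.length) (h : Reducible E X) (hzv : X z v)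
    (hfresh : ∀ y ∈ p.support, y ≠ z → y ≠ v → ∀ a, ¬ E y a) :
    Reducible (fun a b => (E a b ∧ ¬ (a = z ∧ b = v) ∧ ¬ (a = v ∧ b = z)) ∨ s(a, b) ∈ p.edges)
      (fun a b => X a b ∧ ¬ (a = z ∧ b = v) ∧ ¬ (a = v ∧ b = z)) := by
  induction p generalizing E X with
  | nil => simp at hl
  | @cons z y v hadj p ih =>
    obtain ⟨p1, p2, p3, p4⟩ := h.props
    rw [SimpleGraph.Walk.cons_isPath_iff] at hp
    by_cases hyv : y = v
    · subst hyv
      have hnil : p = SimpleGraph.Walk.nil := by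
        exact SimpleGraph.Walk.eq_nil_iff_nil.2 (SimpleGraph.Walk.isPath_iff_nil.1 hp.1)
      subst hnil
      have hE : (fun a b => (E a b ∧ ¬ (a = z ∧ b = y) ∧ ¬ (a = y ∧ b = z)) ∨
          s(a, b) ∈ (SimpleGraph.Walk.cons hadj SimpleGraph.Walk.nil).edges) = E := by
        ext a b
        have := p3 _ _ hzv
        simp only [SimpleGraph.Walk.edges_cons, SimpleGraph.Walk.edges_nil, List.mem_singleton,
          Sym2.eq_iff]
        grind
      rw [hE]
      exact h.shrink (fun a b hab => hab.1) (by grind)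
    · have hyz : y ≠ z := hadj.ne.symm
      have hy : ∀ a, ¬ E y a := hfresh y (by simp) hyz hyv
      have hl' : 1 ≤ p.length := by
        rcases Nat.eq_zero_or_pos p.length with h0 | h0
        · exact absurd (SimpleGraph.Walk.eq_of_length_eq_zero h0) hyv
        · exact h0
      have hEzv := p3 _ _ hzv
      have hzs : z ≠ v := by rintro rfl; exact p2 _ hEzv
      have hsub : Reducible
          (fun a b => (E a b ∧ ¬ (a = z ∧ b = v) ∧ ¬ (a = v ∧ b = z)) ∨
            (a = y ∧ (b = z ∨ b = v)) ∨ (b = y ∧ (a = z ∨ a = v)))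
          (fun a b => (X a b ∧ ¬ (a = z ∧ b = v) ∧ ¬ (a = v ∧ b = z)) ∨
            (a = y ∧ b = v) ∨ (a = v ∧ b = y)) := by
        refine .subdiv y z v h hzv hy (fun a b => Iff.rfl) ?_ ?_ ?_
        · grind
        · grind
        · grind
      have := ih hp.1 hl' hsub (Or.inr (Or.inl ⟨rfl, rfl⟩)) (by
        intro x hx hxy hxv a
        have hxz : x ≠ z := by rintro rfl; exact hp.2 hx
        have := hfresh x (by simp [hx]) hxz hxv a
        grind)
      have hyE : ∀ a b, E a b → a ≠ y ∧ b ≠ y :=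
        fun a b hab => ⟨fun h => hy b (h ▸ hab), fun h => hy a (h ▸ p1 _ _ hab)⟩
      convert this using 1
      · ext a b
        have := hyE a b
        rw [SimpleGraph.Walk.edges_cons, List.mem_cons, Sym2.eq_iff]
        grind
      · ext a b
        have := hyE a b
        have := p3 a b
        grind

end Reducible

/-- Polygonal 2-trees can be reduced by eliminations of vertices of degree two. -/
theorem IsPolygonalSubgraph.reducible {G : SimpleGraph V} {H : G.Subgraph}
    (h : IsPolygonalSubgraph G H) : Reducible H.Adj (fun _ _ => False) := by
  induction h with
  | @cycle v w hw =>
    cases w with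
    | nil => simp at hw
    | @cons _ y _ hvy q =>
      rw [SimpleGraph.Walk.cons_isCycle_iff] at hw
      obtain ⟨hq, hvyq⟩ := hw
      cases q with
      | nil => exact absurd hvy (G.irrefl)
      | @cons _ z _ hyz q =>
        rw [SimpleGraph.Walk.cons_isPath_iff] at hq
        have hzv : z ≠ v := by
          rintro rfl
          exact hvyq (by simp [Sym2.eq_swap])
        have hvy' := hvy.ne
        have hyz' := hyz.ne
        have hl : 1 ≤ q.length := by
          rcases Nat.eq_zero_or_pos q.length with h0 | h0
          · exact absurd (SimpleGraph.Walk.eq_of_length_eq_zero h0) hzv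
          · exact h0
        have htri : Reducible
            (fun a b => a ≠ b ∧ (a = v ∨ a = y ∨ a = z) ∧ (b = v ∨ b = y ∨ b = z))
            (fun a b => (a = z ∧ b = v) ∨ (a = v ∧ b = z)) := by
          refine .triangle v y z hvy' hzv.symm hyz' (fun a b => Iff.rfl) ?_ ?_ <;> grind
        have := Reducible.subdivide q hq.1 hl htri (by simp) (by
          intro x hx hxz hxv a
          have hxy : x ≠ y := by rintro rfl; exact hq.2 hx
          grind)
        convert this using 1
        · ext a b
          rw [SimpleGraph.Walk.adj_toSubgraph_iff_mem_edges]
          simp only [SimpleGraph.Walk.edges_cons, List.mem_cons, Sym2.eq_iff]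
          grind
        · ext a b; grind
  | @addPath H hH u v huv p hp hlen hE hV ih =>
    cases p with
    | nil => simp at hlen
    | @cons _ z _ huz q =>
      rw [SimpleGraph.Walk.cons_isPath_iff] at hp
      have hl : 1 ≤ q.length := by simpa using hlen
      obtain ⟨p1, p2, p3, p4⟩ := ih.props
      have huv' : u ≠ v := by rintro rfl; exact p2 _ huv
      have hfresh : ∀ y ∈ (SimpleGraph.Walk.cons huz q).support, y ≠ u → y ≠ v →
          ∀ a, ¬ H.Adj y a := by
        intro y hy hyu hyv a hya
        have h1 : y ∈ H.verts ∩ (SimpleGraph.Walk.cons huz q).toSubgraph.verts :=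
          ⟨H.edge_vert hya, (SimpleGraph.Walk.mem_verts_toSubgraph _).2 hy⟩
        rw [hV] at h1
        grind
      have huz' := huz.ne
      have hzv : z ≠ v := by
        rintro rfl
        have : q = SimpleGraph.Walk.nil := by
          exact SimpleGraph.Walk.eq_nil_iff_nil.2 (SimpleGraph.Walk.isPath_iff_nil.1 hp.1)
        subst this
        simp at hl
      have hz : ∀ a, ¬ H.Adj z a := hfresh z (by simp) huz'.symm hzv
      have hear : Reducible
          (fun a b => H.Adj a b ∨ (a = z ∧ (b = u ∨ b = v)) ∨ (b = z ∧ (a = u ∨ a = v)))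
          (fun a b => (a = z ∧ b = v) ∨ (a = v ∧ b = z)) := by
        refine .ear z u v ih huv (by simp) hz (fun a b => Iff.rfl) ?_ ?_ ?_ <;> grind
      have hzE : ∀ a b, H.Adj a b → a ≠ z ∧ b ≠ z :=
        fun a b hab => ⟨fun h => hz b (h ▸ hab), fun h => hz a (h ▸ p1 _ _ hab)⟩
      have := Reducible.subdivide q hp.1 hl hear (by simp) (by
        intro x hx hxz hxv a
        have hxu : x ≠ u := by rintro rfl; exact hp.2 hx
        have := hfresh x (by simp [hx]) hxu hxv a
        grind)
      convert this using 1
      · ext a b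
        have := hzE a b
        rw [SimpleGraph.Subgraph.sup_adj, SimpleGraph.Walk.adj_toSubgraph_iff_mem_edges]
        simp only [SimpleGraph.Walk.edges_cons, List.mem_cons, Sym2.eq_iff]
        grind
      · ext a b; grind

/-- Renaming of the vertices. -/
lemma Reducible.map {V' : Type*} {f : V → V'} (hf : Function.Injective f) {E X : V → V → Prop}
    (h : Reducible E X) : Reducible (Relation.Map E f f) (Relation.Map X f f) := by
  have hap : ∀ (E : V → V → Prop) a b, Relation.Map E f f (f a) (f b) ↔ E a b := by
    intro E a b
    constructor
    · rintro ⟨a', b', h, h1, h2⟩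
      rwa [← hf h1, ← hf h2]
    · exact fun h => ⟨a, b, h, rfl, rfl⟩
  have hno : ∀ (E : V → V → Prop) x y, Relation.Map E f f x y →
      ∃ a b, x = f a ∧ y = f b := by
    rintro E x y ⟨a, b, h, rfl, rfl⟩; exact ⟨a, b, rfl, rfl⟩
  have hsy : ∀ (E : V → V → Prop), (∀ a b, E a b → E b a) →
      ∀ x y, Relation.Map E f f x y → Relation.Map E f f y x := by
    rintro E hE x y ⟨a, b, h, rfl, rfl⟩; exact ⟨b, a, hE _ _ h, rfl, rfl⟩
  have hmo : ∀ (E E' : V → V → Prop), (∀ a b, E a b → E' a b) →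
      ∀ x y, Relation.Map E f f x y → Relation.Map E' f f x y := by
    rintro E E' hE x y ⟨a, b, h, rfl, rfl⟩; exact ⟨a, b, hE _ _ h, rfl, rfl⟩
  have hinj : ∀ a b, f a = f b ↔ a = b := fun a b => hf.eq_iff
  have hout : ∀ (E : V → V → Prop) (v : V), (∀ y, ¬ E v y) →
      ∀ y, ¬ Relation.Map E f f (f v) y := by
    rintro E v hv y ⟨a, b, h, h1, rfl⟩
    exact hv b (hf h1 ▸ h)
  induction h with
  | triangle x y z hxy hxz hyz hE hX hs =>
    refine .triangle (f x) (f y) (f z) (by simpa [hinj]) (by simpa [hinj]) (by simpa [hinj]) ?_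
      (hmo _ _ hX) (hsy _ hs)
    intro a b
    by_cases hab : ∃ a' b', a = f a' ∧ b = f b'
    · obtain ⟨a', b', rfl, rfl⟩ := hab
      simp only [hap, hinj, Ne]
      exact hE a' b'
    · refine iff_of_false (fun h => hab (hno _ _ _ h)) ?_
      rintro ⟨-, rfl | rfl | rfl, rfl | rfl | rfl⟩ <;> exact hab ⟨_, _, rfl, rfl⟩
  | @ear E X E' X' v u w h huw hn hv hE hX hs hXX ih =>
    refine .ear (f v) (f u) (f w) ih ((hap _ _ _).2 huw) (by simpa [hap]) (hout _ _ hv) ?_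
      (hmo _ _ hX) (hsy _ hs) ?_
    · intro a b
      by_cases hab : ∃ a' b', a = f a' ∧ b = f b'
      · obtain ⟨a', b', rfl, rfl⟩ := hab
        simp only [hap, hinj]
        exact hE a' b'
      · refine iff_of_false (fun h => hab (hno _ _ _ h)) ?_
        rintro (h | ⟨rfl, rfl | rfl⟩ | ⟨rfl, rfl | rfl⟩)
        · exact hab (hno _ _ _ h)
        all_goals exact hab ⟨_, _, rfl, rfl⟩
    · intro a b
      by_cases hab : ∃ a' b', a = f a' ∧ b = f b'
      · obtain ⟨a', b', rfl, rfl⟩ := hab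
        simp only [hap, hinj, Ne]
        exact hXX a' b'
      · intro _ _
        exact iff_of_false (fun h => hab (hno _ _ _ h)) (fun h => hab (hno _ _ _ h))
  | @subdiv E X E' X' v u w h huw hv hE hX hs hXX ih =>
    refine .subdiv (f v) (f u) (f w) ih ((hap _ _ _).2 huw) (hout _ _ hv) ?_
      (hmo _ _ hX) (hsy _ hs) ?_
    · intro a b
      by_cases hab : ∃ a' b', a = f a' ∧ b = f b'
      · obtain ⟨a', b', rfl, rfl⟩ := hab
        simp only [hap, hinj]
        exact hE a' b'
      · refine iff_of_false (fun h => hab (hno _ _ _ h)) ?_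
        rintro (⟨h, -⟩ | ⟨rfl, rfl | rfl⟩ | ⟨rfl, rfl | rfl⟩)
        · exact hab (hno _ _ _ h)
        all_goals exact hab ⟨_, _, rfl, rfl⟩
    · intro a b
      by_cases hab : ∃ a' b', a = f a' ∧ b = f b'
      · obtain ⟨a', b', rfl, rfl⟩ := hab
        simp only [hap, hinj, Ne]
        exact hXX a' b'
      · intro _ _
        exact iff_of_false (fun h => hab (hno _ _ _ h)) (fun h => hab (hno _ _ _ h.1))

end Polygonal

/-! ### The invariant of the elimination -/

/-- The edge `h` is not among those removed in the first `i` eliminations. -/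
def Live (L R : ℕ → ℕ) (i h : ℕ) : Prop := ∀ j < i, h ≠ L j ∧ h ≠ R j

/-- The state after `i` eliminations in a graph with vertices below `n` and `m` real edges: `E` and
`X` are the adjacency and the virtual edges of the remaining graph, `AD a b` is one more than the
number of the edge between `a` and `b`, the edges below `cnt` have names, and the ends of the edge
`h` are `eu h` and `ev h`. -/
structure ElimInv (n m i : ℕ) (E X : ℕ → ℕ → Prop) (AD : ℕ → ℕ → ℕ) (cnt : ℕ) (eu ev : ℕ → ℕ)
    (L R B : ℕ → ℕ) : Prop where
  red : i + 2 < n → Reducible E X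
  symm : ∀ a b, E a b → E b a
  irrefl : ∀ a, ¬ E a a
  lt : ∀ a b, E a b → a < n
  card : ∃ A : Finset ℕ, (∀ a, a ∈ A ↔ ∃ b, E a b) ∧ A.card + i = n
  adj : ∀ a b, E a b → ∃ h, AD a b = h + 1 ∧ h < cnt ∧ s(eu h, ev h) = s(a, b) ∧
    (X a b ↔ m ≤ h) ∧ Live L R i h
  nadj : ∀ a b, (∃ c, E a c) → (∃ c, E b c) → ¬ E a b → AD a b = 0
  ends : ∀ h < cnt, Live L R i h →
    E (eu h) (ev h) ∧ AD (eu h) (ev h) = h + 1 ∧ AD (ev h) (eu h) = h + 1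
  tri_lt : ∀ j < i, L j < cnt ∧ R j < cnt ∧ B j < cnt
  tri_ne : ∀ j < i, L j ≠ R j ∧ L j ≠ B j ∧ R j ≠ B j
  fresh : ∀ j k, j < k → k < i → (L j ≠ L k ∧ L j ≠ R k ∧ L j ≠ B k) ∧
    (R j ≠ L k ∧ R j ≠ R k ∧ R j ≠ B k)
  geom : ∀ j < i, ∃ v u w, s(eu (L j), ev (L j)) = s(v, u) ∧ s(eu (R j), ev (R j)) = s(v, w) ∧
    s(eu (B j), ev (B j)) = s(u, w)
  virt : ∀ h, m ≤ h → h < cnt →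
    (Live L R i h ∧ i + 2 < n →
      ((Finset.range i).filter fun j => h = L j ∨ h = R j ∨ h = B j).card = 1) ∧
    (¬ (Live L R i h ∧ i + 2 < n) →
      ((Finset.range i).filter fun j => h = L j ∨ h = R j ∨ h = B j).card = 2)
  le_cnt : m ≤ cnt
  ends_ne : ∀ h < cnt, eu h < n ∧ ev h < n ∧ eu h ≠ ev h

namespace ElimInv
variable {n m i : ℕ} {E X : ℕ → ℕ → Prop} {AD : ℕ → ℕ → ℕ} {cnt : ℕ} {eu ev L R B : ℕ → ℕ}

/-- The edge between two adjacent vertices is found in the table. -/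
lemma AD_of_ends (I : ElimInv n m i E X AD cnt eu ev L R B) {h a b : ℕ} (hh : h < cnt)
    (hl : Live L R i h) (hab : s(eu h, ev h) = s(a, b)) : AD a b = h + 1 := by
  obtain ⟨-, h1, h2⟩ := I.ends h hh hl
  rcases Sym2.eq_iff.1 hab with ⟨rfl, rfl⟩ | ⟨rfl, rfl⟩
  · exact h1
  · exact h2

set_option maxHeartbeats 1000000 in
/-- One elimination preserves the invariant. -/
theorem step (I : ElimInv n m i E X AD cnt eu ev L R B) (hi : i + 2 < n) {v u w : ℕ}
    (huw : u ≠ w) (hv : ∀ y, E v y ↔ y = u ∨ y = w) {l r b cnt' : ℕ} {AD' : ℕ → ℕ → ℕ}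
    {eu' ev' L' R' B' : ℕ → ℕ}
    (hl : AD v u = l + 1) (hr : AD v w = r + 1)
    (hb : (AD u w = b + 1 ∧ cnt' = cnt ∧ eu' = eu ∧ ev' = ev) ∨
      (AD u w = 0 ∧ b = cnt ∧ cnt' = cnt + 1 ∧ eu' = Function.update eu cnt u ∧
        ev' = Function.update ev cnt w))
    (hAD : ∀ a c, a < n → c < n →
      AD' a c = if (a = u ∧ c = w) ∨ (a = w ∧ c = u) then b + 1 else AD a c)
    (hL : L' = Function.update L i l) (hR : R' = Function.update R i r)
    (hB : B' = Function.update B i b) :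
    ElimInv n m (i + 1) (elimE E v u w) (elimX E X v u w) AD' cnt' eu' ev' L' R' B' := by
  have hred := I.red hi
  obtain ⟨-, -, pX, pXs⟩ := hred.props
  have hsp := hred.elim huw hv
  have hvu : E v u := (hv u).2 (Or.inl rfl)
  have hvw : E v w := (hv w).2 (Or.inr rfl)
  have hltr : ∀ a c, E a c → c < n := fun a c h => I.lt _ _ (I.symm _ _ h)
  have hun := hltr _ _ hvu
  have hwn := hltr _ _ hvw
  have nvu : v ≠ u := by rintro rfl; exact I.irrefl _ hvu
  have nvw : v ≠ w := by rintro rfl; exact I.irrefl _ hvw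
  have hEuw : AD u w = 0 ↔ ¬ E u w := by
    constructor
    · intro h1 h2
      obtain ⟨h, h3, -⟩ := I.adj _ _ h2
      omega
    · exact I.nadj u w ⟨v, I.symm _ _ hvu⟩ ⟨v, I.symm _ _ hvw⟩
  -- the edges of the triangle
  obtain ⟨l', hl1, hlc, hle, hlX, hll⟩ := I.adj _ _ hvu
  obtain rfl : l = l' := by omega
  obtain ⟨r', hr1, hrc, hre, hrX, hrl⟩ := I.adj _ _ hvw
  obtain rfl : r = r' := by omega
  have hlr : l ≠ r := by
    rintro rfl
    rw [hle, Sym2.eq_iff] at hre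
    grind
  have hbs : (E u w ∧ AD u w = b + 1 ∧ cnt' = cnt ∧ eu' = eu ∧ ev' = ev ∧ b < cnt ∧
      s(eu b, ev b) = s(u, w) ∧ (X u w ↔ m ≤ b) ∧ Live L R i b) ∨
      (¬ E u w ∧ b = cnt ∧ cnt' = cnt + 1 ∧ eu' = Function.update eu cnt u ∧
        ev' = Function.update ev cnt w) := by
    rcases hb with ⟨h1, h2, h3, h4⟩ | ⟨h1, h2, h3, h4, h5⟩
    · have hE : E u w := by
        by_contra hcon
        have := hEuw.2 hcon
        omega
      obtain ⟨b', hb1, hbc, hbe, hbX, hbl⟩ := I.adj _ _ hE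
      obtain rfl : b = b' := by omega
      exact Or.inl ⟨hE, h1, h2, h3, h4, hbc, hbe, hbX, hbl⟩
    · exact Or.inr ⟨hEuw.1 h1, h2, h3, h4, h5⟩
  have hcc : cnt ≤ cnt' := by
    rcases hbs with h | h
    · exact h.2.2.1.ge
    · rw [h.2.2.1]; omega
  have hbc' : b < cnt' := by
    rcases hbs with h | h
    · rw [h.2.2.1]; exact h.2.2.2.2.2.1
    · omega
  have heq : ∀ h < cnt, eu' h = eu h ∧ ev' h = ev h := by
    intro h hh
    rcases hbs with ⟨-, -, -, rfl, rfl, -⟩ | ⟨-, -, -, rfl, rfl⟩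
    · exact ⟨rfl, rfl⟩
    · simp [Function.update_of_ne (show h ≠ cnt by omega)]
  have hbe' : s(eu' b, ev' b) = s(u, w) := by
    rcases hbs with ⟨-, -, -, rfl, rfl, -, h, -⟩ | ⟨-, rfl, -, rfl, rfl⟩
    · exact h
    · simp
  have hlb : l ≠ b := by
    rcases hbs with h | h
    · rintro rfl
      have := h.2.2.2.2.2.2.1
      rw [hle, Sym2.eq_iff] at this
      grind
    · omega
  have hrb : r ≠ b := by
    rcases hbs with h | h
    · rintro rfl
      have := h.2.2.2.2.2.2.1
      rw [hre, Sym2.eq_iff] at this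
      grind
    · omega
  have hbold : ∀ j < i, L j ≠ b ∧ R j ≠ b := by
    intro j hj
    rcases hbs with h | h
    · have := h.2.2.2.2.2.2.2.2 j hj
      exact ⟨this.1.symm, this.2.symm⟩
    · have := I.tri_lt j hj
      omega
  have hLj : ∀ j < i, L' j = L j ∧ R' j = R j ∧ B' j = B j := by
    intro j hj
    have : j ≠ i := by omega
    simp [hL, hR, hB, this]
  have hLi : L' i = l ∧ R' i = r ∧ B' i = b := by simp [hL, hR, hB]
  have hlive : ∀ h, Live L' R' (i + 1) h ↔ Live L R i h ∧ h ≠ l ∧ h ≠ r := by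
    intro h
    constructor
    · intro h1
      refine ⟨fun j hj => ?_, ?_⟩
      · have := h1 j (by omega)
        rwa [(hLj j hj).1, (hLj j hj).2.1] at this
      · have := h1 i (by omega)
        rwa [hLi.1, hLi.2.1] at this
    · rintro ⟨h1, h2⟩ j hj
      rcases Nat.lt_succ_iff_lt_or_eq.1 hj with hj | rfl
      · rw [(hLj j hj).1, (hLj j hj).2.1]; exact h1 j hj
      · rw [hLi.1, hLi.2.1]; exact h2
  have hnol : ∀ h, ∀ a c, s(eu h, ev h) = s(a, c) → a ≠ v → c ≠ v → h ≠ l ∧ h ≠ r := by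
    intro h a c h1 h2 h3
    constructor
    · rintro rfl; rw [hle, Sym2.eq_iff] at h1; grind
    · rintro rfl; rw [hre, Sym2.eq_iff] at h1; grind
  have hnewlive : ¬ E u w → Live L R i cnt := by
    intro _ j hj
    have := I.tri_lt j hj
    omega
  have halive : ∀ a, (∃ c, elimE E v u w a c) ↔ (∃ c, E a c) ∧ a ≠ v := by
    intro a
    constructor
    · rintro ⟨c, ⟨h1, h2, h3⟩ | ⟨rfl, rfl⟩ | ⟨rfl, rfl⟩⟩
      · exact ⟨⟨c, h1⟩, h2⟩
      · exact ⟨⟨v, I.symm _ _ hvu⟩, nvu.symm⟩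
      · exact ⟨⟨v, I.symm _ _ hvw⟩, nvw.symm⟩
    · rintro ⟨⟨c, hc⟩, h1⟩
      by_cases h2 : c = v
      · have h3 := (hv a).1 (I.symm _ _ (h2 ▸ hc))
        rcases h3 with rfl | rfl
        · exact ⟨w, Or.inr (Or.inl ⟨rfl, rfl⟩)⟩
        · exact ⟨u, Or.inr (Or.inr ⟨rfl, rfl⟩)⟩
      · exact ⟨c, Or.inl ⟨hc, h1, h2⟩⟩
  obtain ⟨A, hA, hAc⟩ := I.card
  have hA' : ∀ a, a ∈ A.erase v ↔ ∃ c, elimE E v u w a c := by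
    intro a
    rw [Finset.mem_erase, halive, hA, and_comm]
  have hcard : (A.erase v).card + (i + 1) = n := by
    have h2 : v ∈ A := (hA v).2 ⟨u, hvu⟩
    have h3 := Finset.card_pos.2 ⟨v, h2⟩
    rw [Finset.card_erase_of_mem h2]
    omega
  have hEc : ∀ a c, E a c → (a = u ∧ c = w) ∨ (a = w ∧ c = u) → E u w := by
    rintro a c h1 (⟨rfl, rfl⟩ | ⟨rfl, rfl⟩)
    · exact h1
    · exact I.symm _ _ h1
  -- the triangle occurs at the end only
  have hend : (E u w ∧ ∀ a b, E a b ↔ a ≠ b ∧ (a = v ∨ a = u ∨ a = w) ∧ (b = v ∨ b = u ∨ b = w)) →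
      i + 3 = n := by
    rintro ⟨-, h2⟩
    have h3 : A = {v, u, w} := by
      ext a
      simp only [hA, Finset.mem_insert, Finset.mem_singleton]
      constructor
      · rintro ⟨c, hc⟩
        exact ((h2 a c).1 hc).2.1
      · rintro (rfl | rfl | rfl)
        · exact ⟨u, hvu⟩
        · exact ⟨v, I.symm _ _ hvu⟩
        · exact ⟨v, I.symm _ _ hvw⟩
    have h4 := hAc
    rw [h3, Finset.card_insert_of_notMem (by simp [nvu, nvw]),
      Finset.card_insert_of_notMem (by simpa using huw), Finset.card_singleton] at h4
    omega
  have hcont : Reducible (elimE E v u w) (elimX E X v u w) → i + 1 + 2 < n := by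
    intro h1
    obtain ⟨x, y, z, h2, h3, h4, h5, h6, h7⟩ := h1.exists_three
    have h8 : ({x, y, z} : Finset ℕ) ⊆ A.erase v := by
      intro a ha
      rw [hA']
      simp only [Finset.mem_insert, Finset.mem_singleton] at ha
      rcases ha with rfl | rfl | rfl <;> assumption
    have h9 := Finset.card_le_card h8
    rw [Finset.card_insert_of_notMem (by simp [h2, h3]),
      Finset.card_insert_of_notMem (by simpa using h4), Finset.card_singleton] at h9
    omega
  have hcount : ∀ h, ((Finset.range (i + 1)).filter fun j => h = L' j ∨ h = R' j ∨ h = B' j).card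
      = ((Finset.range i).filter fun j => h = L j ∨ h = R j ∨ h = B j).card
        + if h = l ∨ h = r ∨ h = b then 1 else 0 := by
    intro h
    have h1 : (Finset.range i).filter (fun j => h = L' j ∨ h = R' j ∨ h = B' j)
        = (Finset.range i).filter (fun j => h = L j ∨ h = R j ∨ h = B j) := by
      refine Finset.filter_congr fun j hj => ?_
      obtain ⟨e1, e2, e3⟩ := hLj j (Finset.mem_range.1 hj)
      rw [e1, e2, e3]
    rw [Finset.range_add_one, Finset.filter_insert, h1, hLi.1, hLi.2.1, hLi.2.2]
    split_ifs with h2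
    · rw [Finset.card_insert_of_notMem (by simp)]
    · rfl
  refine
    { red := ?_, symm := ?_, irrefl := ?_, lt := ?_, card := ⟨_, hA', hcard⟩, adj := ?_, nadj := ?_,
      ends := ?_, tri_lt := ?_, tri_ne := ?_, fresh := ?_, geom := ?_, virt := ?_,
      le_cnt := I.le_cnt.trans hcc
      ends_ne := fun h hh => by
        rcases hbs with ⟨-, -, e1, rfl, rfl, -⟩ | ⟨-, -, e1, rfl, rfl⟩
        · exact I.ends_ne h (e1 ▸ hh)
        · by_cases hc : h = cnt
          · subst hc
            simpa using ⟨hun, hwn, huw⟩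
          · simpa [Function.update_of_ne hc] using I.ends_ne h (by omega) }
  · intro h1
    rcases hsp with h2 | h2
    · have := hend h2; omega
    · exact h2.2
  · rintro a c (⟨h1, h2, h3⟩ | h1 | h1)
    · exact Or.inl ⟨I.symm _ _ h1, h3, h2⟩
    · exact Or.inr (Or.inr ⟨h1.2, h1.1⟩)
    · exact Or.inr (Or.inl ⟨h1.2, h1.1⟩)
  · rintro a (⟨h1, h2, h3⟩ | h1 | h1)
    · exact I.irrefl _ h1
    · exact huw (h1.1.symm.trans h1.2)
    · exact huw (h1.2.symm.trans h1.1)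
  · rintro a c (⟨h1, h2, h3⟩ | ⟨rfl, rfl⟩ | ⟨rfl, rfl⟩)
    · exact I.lt _ _ h1
    · exact hun
    · exact hwn
  · -- adjacent pairs
    have old : ∀ a c, E a c → a ≠ v → c ≠ v → ∃ h, AD' a c = h + 1 ∧ h < cnt' ∧
        s(eu' h, ev' h) = s(a, c) ∧ (elimX E X v u w a c ↔ m ≤ h) ∧ Live L' R' (i + 1) h := by
      intro a c h1 h2 h3
      obtain ⟨h, g1, g2, g3, g4, g5⟩ := I.adj _ _ h1
      refine ⟨h, ?_, by omega, ?_, ?_, ?_⟩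
      · rw [hAD a c (I.lt _ _ h1) (hltr _ _ h1)]
        split_ifs with h4
        · have hE := hEc a c h1 h4
          rcases hbs with h5 | h5
          · have h6 := I.AD_of_ends (a := a) (b := c) h5.2.2.2.2.2.1 h5.2.2.2.2.2.2.2.2 (by
              rw [h5.2.2.2.2.2.2.1, Sym2.eq_iff]
              rcases h4 with ⟨rfl, rfl⟩ | ⟨rfl, rfl⟩
              · exact Or.inl ⟨rfl, rfl⟩
              · exact Or.inr ⟨rfl, rfl⟩)
            omega
          · exact absurd hE h5.1
        · exact g1
      · rw [(heq h g2).1, (heq h g2).2]; exact g3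
      · rw [← g4]
        constructor
        · rintro (h5 | ⟨h5, h6⟩)
          · exact h5.1
          · exact absurd (hEc a c h1 h6) h5
        · exact fun h5 => Or.inl ⟨h5, h2, h3⟩
      · exact (hlive h).2 ⟨g5, hnol h a c g3 h2 h3⟩
    have new : ∀ a c, (a = u ∧ c = w) ∨ (a = w ∧ c = u) → ∃ h, AD' a c = h + 1 ∧ h < cnt' ∧
        s(eu' h, ev' h) = s(a, c) ∧ (elimX E X v u w a c ↔ m ≤ h) ∧ Live L' R' (i + 1) h := by
      intro a c hac
      by_cases hE : E u w
      · rcases hac with ⟨rfl, rfl⟩ | ⟨rfl, rfl⟩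
        · exact old _ _ hE nvu.symm nvw.symm
        · exact old _ _ (I.symm _ _ hE) nvw.symm nvu.symm
      · rcases hbs with h5 | h5
        · exact absurd h5.1 hE
        · refine ⟨b, ?_, hbc', ?_, ?_, ?_⟩
          · rw [hAD a c, if_pos hac] <;> rcases hac with ⟨rfl, rfl⟩ | ⟨rfl, rfl⟩ <;> assumption
          · rw [hbe', Sym2.eq_iff]
            rcases hac with ⟨rfl, rfl⟩ | ⟨rfl, rfl⟩
            · exact Or.inl ⟨rfl, rfl⟩
            · exact Or.inr ⟨rfl, rfl⟩
          · have := I.le_cnt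
            exact iff_of_true (Or.inr ⟨hE, hac⟩) (by omega)
          · rw [hlive, h5.2.1]
            exact ⟨hnewlive hE, by omega, by omega⟩
    rintro a c (⟨h1, h2, h3⟩ | h1 | h1)
    · exact old a c h1 h2 h3
    · exact new a c (Or.inl h1)
    · exact new a c (Or.inr h1)
  · intro a c ha hc hac
    rw [halive] at ha hc
    have h1 : ¬ E a c := fun h => hac (Or.inl ⟨h, ha.2, hc.2⟩)
    have h2 : ¬ ((a = u ∧ c = w) ∨ (a = w ∧ c = u)) := fun h => hac (Or.inr h)
    obtain ⟨⟨a', ha'⟩, -⟩ := ha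
    obtain ⟨⟨c', hc'⟩, -⟩ := hc
    rw [hAD a c (I.lt _ _ ha') (I.lt _ _ hc'), if_neg h2]
    exact I.nadj a c ⟨_, ha'⟩ ⟨_, hc'⟩ h1
  · intro h hh hlv
    rw [hlive] at hlv
    by_cases hhc : h < cnt
    · obtain ⟨g1, g2, g3⟩ := I.ends h hhc hlv.1
      rw [(heq h hhc).1, (heq h hhc).2]
      have g4 : eu h ≠ v := by
        intro g
        have g5 := (hv (ev h)).1 (g ▸ g1)
        rw [g] at g2
        rcases g5 with g5 | g5 <;> rw [g5] at g2 <;> omega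
      have g5 : ev h ≠ v := by
        intro g
        have g5 := (hv (eu h)).1 (I.symm _ _ (g ▸ g1))
        rw [g] at g3
        rcases g5 with g5 | g5 <;> rw [g5] at g3 <;> omega
      have hn1 := I.lt _ _ g1
      have hn2 := hltr _ _ g1
      refine ⟨Or.inl ⟨g1, g4, g5⟩, ?_⟩
      rw [hAD _ _ hn1 hn2, hAD _ _ hn2 hn1]
      have : (eu h = u ∧ ev h = w ∨ eu h = w ∧ ev h = u) → b = h := by
        intro g6
        have hE := hEc _ _ g1 g6
        rcases hbs with h5 | h5
        · rcases g6 with ⟨e1, e2⟩ | ⟨e1, e2⟩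
          · rw [e1, e2] at g2; omega
          · rw [e1, e2] at g3; omega
        · exact absurd hE h5.1
      constructor
      · split_ifs with g6
        · rw [this g6]
        · exact g2
      · split_ifs with g6
        · rw [this (g6.elim (fun g => Or.inr ⟨g.2, g.1⟩) fun g => Or.inl ⟨g.2, g.1⟩)]
        · exact g3
    · rcases hbs with h5 | ⟨h5, rfl, h7, rfl, rfl⟩
      · omega
      · obtain rfl : h = b := by omega
        simp only [Function.update_self]
        refine ⟨Or.inr (Or.inl ⟨rfl, rfl⟩), ?_⟩
        rw [hAD _ _ hun hwn, hAD _ _ hwn hun]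
        simp
  · intro j hj
    rcases Nat.lt_succ_iff_lt_or_eq.1 hj with hj | rfl
    · obtain ⟨e1, e2, e3⟩ := hLj j hj
      have := I.tri_lt j hj
      rw [e1, e2, e3]; omega
    · rw [hLi.1, hLi.2.1, hLi.2.2]; omega
  · intro j hj
    rcases Nat.lt_succ_iff_lt_or_eq.1 hj with hj | rfl
    · obtain ⟨e1, e2, e3⟩ := hLj j hj
      rw [e1, e2, e3]; exact I.tri_ne j hj
    · rw [hLi.1, hLi.2.1, hLi.2.2]; exact ⟨hlr, hlb, hrb⟩
  · intro j k hjk hk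
    rcases Nat.lt_succ_iff_lt_or_eq.1 hk with hk | rfl
    · obtain ⟨e1, e2, e3⟩ := hLj k hk
      obtain ⟨f1, f2, f3⟩ := hLj j (by omega)
      rw [e1, e2, e3, f1, f2]; exact I.fresh j k hjk hk
    · obtain ⟨f1, f2, f3⟩ := hLj j hjk
      rw [hLi.1, hLi.2.1, hLi.2.2, f1, f2]
      have h1 := hll j hjk; have h2 := hrl j hjk; have h3 := hbold j hjk
      exact ⟨⟨h1.1.symm, h2.1.symm, h3.1⟩, h1.2.symm, h2.2.symm, h3.2⟩
  · intro j hj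
    rcases Nat.lt_succ_iff_lt_or_eq.1 hj with hj | rfl
    · obtain ⟨e1, e2, e3⟩ := hLj j hj
      have h1 := I.tri_lt j hj
      rw [e1, e2, e3, (heq _ h1.1).1, (heq _ h1.1).2, (heq _ h1.2.1).1, (heq _ h1.2.1).2,
        (heq _ h1.2.2).1, (heq _ h1.2.2).2]
      exact I.geom j hj
    · rw [hLi.1, hLi.2.1, hLi.2.2]
      refine ⟨v, u, w, ?_, ?_, hbe'⟩
      · rw [(heq _ hlc).1, (heq _ hlc).2]; exact hle
      · rw [(heq _ hrc).1, (heq _ hrc).2]; exact hre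
  · intro h hm hh
    rw [hlive, hcount]
    by_cases hhc : h < cnt
    · obtain ⟨v1, v2⟩ := I.virt h hm hhc
      by_cases hlv : Live L R i h
      · have v3 := v1 ⟨hlv, hi⟩
        rw [v3]
        by_cases h1 : h = l ∨ h = r
        · rw [if_pos (by omega)]
          exact ⟨fun h5 => by have := h5.1.2; omega, fun _ => rfl⟩
        · push Not at h1
          rcases hsp with h2 | h2
          · have h3 := hend h2
            have h4 : h = b := by
              obtain ⟨g1, g2, g3⟩ := I.ends h hhc hlv
              have g4 := (h2.2 _ _).1 g1
              have g5 := I.ends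
              rcases hbs with h5 | h5
              · have k1 := I.AD_of_ends (a := u) (b := v) hlc hll (by rw [hle, Sym2.eq_swap])
                have k2 := I.AD_of_ends (a := w) (b := v) hrc hrl (by rw [hre, Sym2.eq_swap])
                have k3 := I.AD_of_ends (a := w) (b := u) h5.2.2.2.2.2.1 h5.2.2.2.2.2.2.2.2
                  (by rw [h5.2.2.2.2.2.2.1, Sym2.eq_swap])
                have k4 := h5.2.1
                obtain ⟨g6, g7, g8⟩ := g4
                rcases g7 with g7 | g7 | g7 <;> rcases g8 with g8 | g8 | g8 <;>
                  rw [g7, g8] at g2 <;> omega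
              · exact absurd h2.1 h5.1
            rw [if_pos (by omega)]
            exact ⟨fun h5 => by omega, fun _ => rfl⟩
          · have h3 := hcont h2.2
            have h4 : h ≠ b := by
              rintro rfl
              rcases hbs with h5 | h5
              · exact h2.1 h5.1 (h5.2.2.2.2.2.2.2.1.2 hm)
              · omega
            rw [if_neg (by omega)]
            exact ⟨fun _ => rfl, fun h5 => absurd ⟨⟨hlv, h1⟩, h3⟩ h5⟩
      · have v3 := v2 (fun h => hlv h.1)
        rw [v3, if_neg]
        · exact ⟨fun h => absurd h.1.1 hlv, fun _ => rfl⟩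
        · rintro (rfl | rfl | rfl)
          · exact hlv hll
          · exact hlv hrl
          · rcases hbs with h5 | h5
            · exact hlv h5.2.2.2.2.2.2.2.2
            · omega
    · rcases hbs with h5 | h5
      · omega
      · have hhb : h = b := by omega
        have h0 : ((Finset.range i).filter fun j => h = L j ∨ h = R j ∨ h = B j).card = 0 := by
          rw [Finset.card_eq_zero, Finset.filter_eq_empty_iff]
          intro j hj
          have := I.tri_lt j (Finset.mem_range.1 hj)
          omega
        have h3 : i + 1 + 2 < n := by
          rcases hsp with h2 | h2
          · exact absurd h2.1 h5.1
          · exact hcont h2.2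
        rw [h0, if_pos (by omega)]
        refine ⟨fun _ => rfl, fun h6 => absurd ⟨⟨?_, ?_⟩, h3⟩ h6⟩
        · rw [hhb, h5.2.1]; exact hnewlive h5.1
        · omega

end ElimInv

/-! ### Fundamental cycles of a spanning tree -/

section Fundamental
variable {V : Type*}

/-- Whether the ends of the edge `e` are coloured differently. -/
def cross (χ : V → Bool) (e : Sym2 V) : Bool :=
  Sym2.lift ⟨fun a b => xor (χ a) (χ b), fun _ _ => Bool.xor_comm _ _⟩ e

@[simp] lemma cross_mk (χ : V → Bool) (a b : V) : cross χ s(a, b) = xor (χ a) (χ b) := rfl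

/-- A walk changes the colour an odd number of times if and only if its ends have different colours.
-/
lemma xor_eq_odd_cross {G : SimpleGraph V} (χ : V → Bool) {a b : V} (p : G.Walk a b) :
    xor (χ a) (χ b) = true ↔ Odd (p.edges.countP fun e => cross χ e) := by
  induction p with
  | nil => simp
  | @cons a c b h p ih =>
    rw [SimpleGraph.Walk.edges_cons, List.countP_cons, cross_mk]
    cases h1 : χ a <;> cases h2 : χ c <;> cases h3 : χ b <;>
      simp_all [Nat.odd_add_one]

/-- The edges of a tree, with a colouring for each of them that separates its ends, but not those
of the other edges. -/
structure TreeCuts (T : SimpleGraph V) where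
  ET : Finset (Sym2 V)
  mem_ET : ∀ e, e ∈ ET ↔ e ∈ T.edgeSet
  χ : Sym2 V → V → Bool
  cross_iff : ∀ t ∈ ET, ∀ s ∈ ET, cross (χ t) s = true ↔ s = t

/-- Colour the vertices by the component of the tree without the given edge. -/
lemma exists_treeCuts [Finite V] {T : SimpleGraph V} (hT : T.IsTree) : Nonempty (TreeCuts T) := by
  classical
  have : Fintype V := Fintype.ofFinite V
  have key : ∀ t : Sym2 V, ∃ χ : V → Bool, t ∈ T.edgeSet →
      ∀ s ∈ T.edgeSet, cross χ s = true ↔ s = t := by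
    intro t
    induction t using Sym2.ind with
    | _ a b =>
    refine ⟨fun x => decide ((T.deleteEdges {s(a, b)}).Reachable a x), fun ht s hs => ?_⟩
    have hbr := SimpleGraph.isAcyclic_iff_forall_isBridge.1 hT.isAcyclic ht
    rw [SimpleGraph.isBridge_iff] at hbr
    induction s using Sym2.ind with
    | _ c d =>
    by_cases h : s(c, d) = s(a, b)
    · refine iff_of_true ?_ h
      rcases Sym2.eq_iff.1 h with ⟨rfl, rfl⟩ | ⟨rfl, rfl⟩ <;> simp [hbr]
    · refine iff_of_false ?_ h
      have hadj : (T.deleteEdges {s(a, b)}).Adj c d := by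
        rw [SimpleGraph.deleteEdges_adj]
        exact ⟨hs, by simpa using h⟩
      have : (T.deleteEdges {s(a, b)}).Reachable a c ↔ (T.deleteEdges {s(a, b)}).Reachable a d :=
        ⟨fun h => h.trans hadj.reachable, fun h => h.trans hadj.reachable.symm⟩
      simp [this]
  choose χ hχ using key
  exact ⟨⟨T.edgeFinset, fun e => by simp, χ,
    fun t ht s hs => hχ t (by simpa using ht) s (by simpa using hs)⟩⟩

namespace TreeCuts
variable {T : SimpleGraph V} (D : TreeCuts T)

/-- An edge of the tree is on the path between `a` and `b` if and only if its fundamental cut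
separates them. -/
lemma mem_path_iff {a b : V} {p : T.Walk a b} (hp : p.IsPath) {t : Sym2 V} :
    t ∈ p.edges ↔ t ∈ D.ET ∧ cross (D.χ t) s(a, b) = true := by
  classical
  have hsub : ∀ s ∈ p.edges, s ∈ D.ET := fun s hs =>
    (D.mem_ET s).2 (p.edges_subset_edgeSet hs)
  have key : t ∈ D.ET → (cross (D.χ t) s(a, b) = true ↔ t ∈ p.edges) := by
    intro ht
    rw [cross_mk, xor_eq_odd_cross _ p]
    have h1 : p.edges.countP (fun e => cross (D.χ t) e) = p.edges.count t := by
      rw [List.count]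
      refine List.countP_congr fun s hs => ?_
      rw [D.cross_iff t ht s (hsub s hs)]
      simp
    rw [h1]
    by_cases h2 : t ∈ p.edges
    · rw [List.count_eq_one_of_mem hp.isTrail.edges_nodup h2]
      simp [h2]
    · rw [List.count_eq_zero_of_not_mem h2]
      simp [h2]
  constructor
  · exact fun h => ⟨hsub t h, (key (hsub t h)).2 h⟩
  · exact fun h => (key h.1).1 h.2

variable [DecidableEq V]

/-- The fundamental cycle of the edge `e`. -/
def fc (e : Sym2 V) : Finset (Sym2 V) := insert e (D.ET.filter fun t => cross (D.χ t) e)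

lemma fc_eq {a b : V} {p : T.Walk a b} (hp : p.IsPath) :
    D.fc s(a, b) = insert s(a, b) p.edges.toFinset := by
  rw [fc]
  congr 1
  ext t
  rw [Finset.mem_filter, List.mem_toFinset, D.mem_path_iff hp]

/-- A non-tree edge is on its own fundamental cycle only. -/
lemma mem_fc_of_notMem {e e' : Sym2 V} (h : e ∉ D.ET) : e ∈ D.fc e' ↔ e = e' := by
  simp [fc, h]

lemma isFundamentalCycle_iff {G : SimpleGraph V} (hT : T.Connected) {C : Finset (Sym2 V)} :
    IsFundamentalCycle G T C ↔ ∃ e ∈ G.edgeSet, e ∉ D.ET ∧ C = D.fc e := by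
  constructor
  · rintro ⟨u, v, p, h1, h2, h3, rfl⟩
    exact ⟨s(u, v), h1, by rwa [D.mem_ET], (D.fc_eq h3).symm⟩
  · rintro ⟨e, h1, h2, rfl⟩
    induction e using Sym2.ind with
    | _ u v =>
    obtain ⟨p, hp⟩ := (hT.preconnected u v).exists_isPath
    exact ⟨u, v, p, h1, by rwa [D.mem_ET] at h2, hp, D.fc_eq hp⟩

lemma isCycleOf_fc {G : SimpleGraph V} (hTG : T ≤ G) (hT : T.Connected) {e : Sym2 V}
    (he : e ∈ G.edgeSet) (heT : e ∉ D.ET) : IsCycleOf G (D.fc e) := by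
  induction e using Sym2.ind with
  | _ u v =>
  obtain ⟨p, hp⟩ := (hT.preconnected v u).exists_isPath
  have huv : G.Adj u v := he
  refine ⟨u, SimpleGraph.Walk.cons huv (p.mapLe hTG), ?_, ?_⟩
  · rw [SimpleGraph.Walk.cons_isCycle_iff]
    refine ⟨hp.mapLe hTG, ?_⟩
    rw [SimpleGraph.Walk.edges_mapLe_eq_edges]
    intro h
    exact heT ((D.mem_ET _).2 (p.edges_subset_edgeSet h))
  · rw [SimpleGraph.Walk.edges_cons, SimpleGraph.Walk.edges_mapLe_eq_edges, List.toFinset_cons,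
      Sym2.eq_swap, ← D.fc_eq hp]

lemma _root_.PolyTree.IsCycleOf.isEulerianOf {G : SimpleGraph V} {C : Finset (Sym2 V)}
    (h : IsCycleOf G C) : IsEulerianOf G C := by
  obtain ⟨v, w, hw, rfl⟩ := h
  refine ⟨fun e he => w.edges_subset_edgeSet (by simpa using he), fun x => ?_⟩
  have h1 := (hw.isTrail.even_countP_edges_iff x).2 (by simp)
  have h2 : (w.edges.toFinset.filter fun e => x ∈ e).card
      = w.edges.countP fun e => x ∈ e := by
    rw [List.countP_eq_length_filter, ← List.toFinset_card_of_nodup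
      (hw.isTrail.edges_nodup.filter _), List.toFinset_filter]
    simp
  rw [h2]; exact h1

/-- A cycle crosses a cut an even number of times. -/
lemma _root_.PolyTree.IsCycleOf.even_cross {G : SimpleGraph V} {C : Finset (Sym2 V)}
    (h : IsCycleOf G C) (χ : V → Bool) : Even (C.filter fun e => cross χ e).card := by
  obtain ⟨v, w, hw, rfl⟩ := h
  have h1 := xor_eq_odd_cross χ w
  have h2 : (w.edges.toFinset.filter fun e => cross χ e).card
      = w.edges.countP fun e => cross χ e := by
    rw [List.countP_eq_length_filter, ← List.toFinset_card_of_nodup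
      (hw.isTrail.edges_nodup.filter _), List.toFinset_filter]
  rw [h2, ← Nat.not_odd_iff_even, ← h1]
  simp

lemma fc_injOn : Set.InjOn D.fc {e | e ∉ D.ET} := by
  intro e he e' _ h
  have : e ∈ D.fc e := Finset.mem_insert_self _ _
  rw [h, D.mem_fc_of_notMem he] at this
  exact this

/-- The fundamental cycles of a spanning tree form a cycle basis. -/
theorem isCycleBasis (D : TreeCuts T) {G : SimpleGraph V} (hT : IsSpanningTree G T)
    {B : Finset (Finset (Sym2 V))} (hB : ∀ C, C ∈ B ↔ IsFundamentalCycle G T C) :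
    IsCycleBasis G B := by
  have hB' : ∀ C, C ∈ B ↔ ∃ e ∈ G.edgeSet, e ∉ D.ET ∧ C = D.fc e := fun C =>
    (hB C).trans (D.isFundamentalCycle_iff hT.2.connected)
  have hcyc : ∀ C ∈ B, IsCycleOf G C := by
    intro C hC
    obtain ⟨e, h1, h2, rfl⟩ := (hB' C).1 hC
    exact D.isCycleOf_fc hT.1 hT.2.connected h1 h2
  refine ⟨⟨fun C hC => (hcyc C hC).isEulerianOf, fun C hC => ?_⟩, fun B' hB1 hB2 C hC => ?_⟩
  · have hCG : ∀ e ∈ C, e ∈ G.edgeSet := fun e he => hC.isEulerianOf.1 (by simpa using he)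
    refine ⟨(C.filter fun e => e ∉ D.ET).image D.fc, ?_, fun e => ?_⟩
    · intro F hF
      obtain ⟨e, he, rfl⟩ := Finset.mem_image.1 hF
      rw [Finset.mem_filter] at he
      exact (hB' _).2 ⟨e, hCG e he.1, he.2, rfl⟩
    · rw [Finset.filter_image, Finset.card_image_of_injOn
        (D.fc_injOn.mono (by intro x; simp +contextual)), Finset.filter_filter]
      by_cases he : e ∈ D.ET
      · have h1 := hC.even_cross (D.χ e)
        -- the cut of the tree edge `e` contains the non-tree edges with `e` on their cycles
        have h2 : C.filter (fun x => cross (D.χ e) x) =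
            (C.filter fun x => x ∉ D.ET ∧ e ∈ D.fc x) ∪ (C.filter fun x => x = e) := by
          ext x
          simp only [Finset.mem_filter, Finset.mem_union, fc, Finset.mem_insert]
          by_cases hx : x ∈ D.ET
          · rw [D.cross_iff e he x hx]
            simp [hx]
          · have : e ≠ x := by rintro rfl; exact hx he
            simp [hx, this, this.symm, he]
        have h3 : Disjoint (C.filter fun x => x ∉ D.ET ∧ e ∈ D.fc x)
            (C.filter fun x => x = e) := by
          rw [Finset.disjoint_left]
          intro x hx hx'
          simp only [Finset.mem_filter] at hx hx'
          exact hx.2.1 (hx'.2 ▸ he)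
        rw [h2, Finset.card_union_of_disjoint h3, Finset.filter_eq'] at h1
        by_cases heC : e ∈ C
        · simp only [heC, if_true, Finset.card_singleton, Nat.even_add_one,
            Nat.not_even_iff_odd] at h1
          simp only [heC, true_iff]
          exact h1
        · simp only [heC, if_false, Finset.card_empty, add_zero] at h1
          simp only [heC, false_iff, Nat.not_odd_iff_even]
          exact h1
      · have h2 : (C.filter fun x => x ∉ D.ET ∧ e ∈ D.fc x) = C.filter fun x => x = e := by
          refine Finset.filter_congr fun x _ => ?_
          rw [D.mem_fc_of_notMem he]
          constructor
          · exact fun h => h.2.symm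
          · rintro rfl; exact ⟨he, rfl⟩
        rw [h2, Finset.filter_eq']
        by_cases heC : e ∈ C <;> simp [heC]
  · obtain ⟨e, h1, h2, rfl⟩ := (hB' C).1 hC
    obtain ⟨S, hS, hS'⟩ := hB1.2 _ (hcyc _ hC)
    have h3 := (hS' e).1 (Finset.mem_insert_self _ _)
    obtain ⟨F, hF⟩ := Finset.card_pos.1 h3.pos
    rw [Finset.mem_filter] at hF
    obtain ⟨e', -, -, rfl⟩ := (hB' F).1 (hB2 (hS hF.1))
    rw [D.mem_fc_of_notMem h2] at hF
    rw [hF.2]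
    exact hS hF.1

/-- The number of edges of the fundamental cycle of a non-tree edge. -/
lemma card_fc {e : Sym2 V} (he : e ∉ D.ET) :
    (D.fc e).card = (D.ET.filter fun t => cross (D.χ t) e).card + 1 := by
  rw [fc, Finset.card_insert_of_notMem]
  simp [he]

lemma size_eq {G : SimpleGraph V} (hT : T.Connected) {B : Finset (Finset (Sym2 V))}
    (hB : ∀ C, C ∈ B ↔ IsFundamentalCycle G T C) {NT : Finset (Sym2 V)}
    (hNT : ∀ e, e ∈ NT ↔ e ∈ G.edgeSet ∧ e ∉ D.ET) :
    B = NT.image D.fc ∧ size B = ∑ e ∈ NT, (D.fc e).card := by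
  have h : B = NT.image D.fc := by
    ext C
    rw [hB, D.isFundamentalCycle_iff hT, Finset.mem_image]
    constructor
    · rintro ⟨e, h1, h2, rfl⟩; exact ⟨e, (hNT e).2 ⟨h1, h2⟩, rfl⟩
    · rintro ⟨e, h1, rfl⟩
      exact ⟨e, ((hNT e).1 h1).1, ((hNT e).1 h1).2, rfl⟩
  refine ⟨h, ?_⟩
  rw [size, h, Finset.sum_image]
  exact D.fc_injOn.mono fun e he => ((hNT e).1 he).2

end TreeCuts
end Fundamental

section

/-! ### Minimum fundamental cycle bases -/

open Scheme

/-- A scheme realized on the graph `G`: the ends of the edge `h` are `en h`, the edges below `m`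
are the edges of `G`, and each of the other ones, the virtual edges, lies on two triangles. -/
structure Layout {V : Type*} [Fintype V] (G : SimpleGraph V) extends Scheme where
  m : ℕ
  en : ℕ → Sym2 V
  m_le : m ≤ N
  card_V : Fintype.card V = K + 2
  not_diag : ∀ h < N, ¬ (en h).IsDiag
  geom : ∀ i < K, ∃ v u w, en (L i) = s(v, u) ∧ en (R i) = s(v, w) ∧ en (B i) = s(u, w)
  real : ∀ e, e ∈ G.edgeSet ↔ ∃ h < m, en h = e
  inj : ∀ h < m, ∀ h' < m, en h = en h' → h = h'
  virt : ∀ h, m ≤ h → h < N →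
    ((Finset.range K).filter fun i => h ∈ toScheme.tri i).card = 2
  conn : G.Connected

namespace Layout

variable {V : Type*} [Fintype V] [DecidableEq V] {G : SimpleGraph V} (Λ : Layout G)

/-- The cost of an edge: virtual edges are free. -/
def cost (h : ℕ) : ℕ := if h < Λ.m then 1 else 0

omit [DecidableEq V] in
/-- A colouring of the vertices defines a cut of the scheme. -/
lemma isCut_cross (χ : V → Bool) : Λ.IsCut fun h => cross χ (Λ.en h) := by
  intro i hi
  obtain ⟨v, u, w, h1, h2, h3⟩ := Λ.geom i hi
  simp only [h1, h2, h3, cross_mk]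
  cases χ v <;> cases χ u <;> cases χ w <;> rfl

section
variable {T : SimpleGraph V} (D : TreeCuts T) (hT : IsSpanningTree G T)
include hT

lemma image_treeEdges :
    ((Finset.range Λ.m).filter fun h => Λ.en h ∈ D.ET).image Λ.en = D.ET := by
  ext e
  simp only [Finset.mem_image, Finset.mem_filter, Finset.mem_range]
  constructor
  · rintro ⟨h, ⟨-, h1⟩, rfl⟩; exact h1
  · intro he
    have h1 : e ∈ G.edgeSet :=
      SimpleGraph.edgeSet_subset_edgeSet.2 hT.1 ((D.mem_ET e).1 he)
    obtain ⟨h, h2, rfl⟩ := (Λ.real e).1 h1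
    exact ⟨h, ⟨h2, he⟩, rfl⟩

/-- A spanning tree of the graph as a tree of the scheme. -/
def tree : Λ.Tree where
  T := (Finset.range Λ.m).filter fun h => Λ.en h ∈ D.ET
  cut t h := cross (D.χ (Λ.en t)) (Λ.en h)
  sub := by
    intro h hh
    have := Λ.m_le
    simp only [Finset.mem_filter, Finset.mem_range] at hh ⊢
    omega
  card := by
    have h1 : D.ET.card + 1 = Fintype.card V := by
      have h2 := (SimpleGraph.isTree_iff_connected_and_card.1 hT.2).2
      have h3 : T.edgeSet = (D.ET : Set (Sym2 V)) := by
        ext e; rw [Finset.mem_coe, D.mem_ET]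
      rw [h3, Nat.card_eq_fintype_card, Nat.card_eq_fintype_card] at h2
      simpa using h2
    rw [← Λ.image_treeEdges D hT, Finset.card_image_of_injOn, Λ.card_V] at h1
    · omega
    · intro a ha b hb hab
      simp only [Finset.coe_filter, Set.mem_ofPred_eq, Finset.mem_range] at ha hb
      exact Λ.inj a ha.1 b hb.1 hab
  isCut t _ := Λ.isCut_cross _
  self t ht := by
    rw [Finset.mem_filter] at ht
    exact (D.cross_iff _ ht.2 _ ht.2).2 rfl
  other t ht t' ht' hne := by
    rw [Finset.mem_filter, Finset.mem_range] at ht ht'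
    rw [Bool.eq_false_iff]
    intro h
    exact hne (Λ.inj _ ht'.1 _ ht.1 ((D.cross_iff _ ht.2 _ ht'.2).1 h))
  pos h hh := by
    have h1 := Λ.not_diag h hh
    generalize he : Λ.en h = e at h1
    induction e using Sym2.ind with
    | _ a b =>
    rw [Sym2.mk_isDiag_iff] at h1
    obtain ⟨p, hp⟩ := (hT.2.connected.preconnected a b).exists_isPath
    have h2 : ∃ t, t ∈ p.edges := by
      cases p with
      | nil => exact absurd rfl h1
      | cons h p => exact ⟨_, by rw [SimpleGraph.Walk.edges_cons]; exact List.mem_cons_self⟩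
    obtain ⟨t, ht⟩ := h2
    rw [D.mem_path_iff hp] at ht
    have h3 := ht.1
    rw [← Λ.image_treeEdges D hT, Finset.mem_image] at h3
    obtain ⟨t', h4, rfl⟩ := h3
    exact ⟨t', h4, ht.2⟩

lemma image_path (h : ℕ) :
    ((Λ.tree D hT).path h).image Λ.en = D.ET.filter fun t => cross (D.χ t) (Λ.en h) := by
  ext e
  simp only [Finset.mem_image, Tree.mem_path, Finset.mem_filter]
  constructor
  · rintro ⟨t, ⟨h1, h2⟩, rfl⟩
    exact ⟨(Finset.mem_filter.1 h1).2, h2⟩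
  · rintro ⟨h1, h2⟩
    rw [← Λ.image_treeEdges D hT, Finset.mem_image] at h1
    obtain ⟨t, h3, rfl⟩ := h1
    exact ⟨t, ⟨h3, h2⟩, rfl⟩

/-- The fundamental cycle of the edge `h` consists of `h` and its path. -/
lemma fc_en (h : ℕ) : D.fc (Λ.en h) = (insert h ((Λ.tree D hT).path h)).image Λ.en := by
  rw [Finset.image_insert, Λ.image_path D hT, TreeCuts.fc]

lemma tree_T_lt {h : ℕ} (hh : h ∈ (Λ.tree D hT).T) : h < Λ.m := by
  simpa using (Finset.mem_filter.1 hh).1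

lemma mem_tree_T {h : ℕ} (hh : h < Λ.m) : h ∈ (Λ.tree D hT).T ↔ Λ.en h ∈ D.ET := by
  simp [tree, hh]

lemma card_fc_en {h : ℕ} (hh : h < Λ.m) (hn : h ∉ (Λ.tree D hT).T) :
    (D.fc (Λ.en h)).card = (Λ.tree D hT).dist h + 1 := by
  rw [Λ.mem_tree_T D hT hh] at hn
  rw [D.card_fc hn, ← Λ.image_path D hT, Finset.card_image_of_injOn]
  · rfl
  · intro a ha b hb hab
    rw [Finset.mem_coe, Tree.mem_path] at ha hb
    exact Λ.inj _ (Λ.tree_T_lt D hT ha.1) _ (Λ.tree_T_lt D hT hb.1) hab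

/-- The fundamental cycle basis of a spanning tree, in terms of the scheme. -/
lemma basis_eq {B : Finset (Finset (Sym2 V))} (hB : ∀ C, C ∈ B ↔ IsFundamentalCycle G T C) :
    B = (Finset.range Λ.m \ (Λ.tree D hT).T).image (fun h => D.fc (Λ.en h)) ∧
    size B = ∑ h ∈ Finset.range Λ.m \ (Λ.tree D hT).T, ((Λ.tree D hT).dist h + 1) := by
  have h1 := D.size_eq hT.2.connected hB
    (NT := (Finset.range Λ.m \ (Λ.tree D hT).T).image Λ.en) (by
      intro e
      simp only [Finset.mem_image, Finset.mem_sdiff, Finset.mem_range]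
      rw [Λ.real]
      constructor
      · rintro ⟨h, ⟨h1, h2⟩, rfl⟩
        exact ⟨⟨h, h1, rfl⟩, by rwa [← Λ.mem_tree_T D hT h1]⟩
      · rintro ⟨⟨h, h1, rfl⟩, h2⟩
        exact ⟨h, ⟨h1, by rwa [Λ.mem_tree_T D hT h1]⟩, rfl⟩)
  refine ⟨by rw [h1.1, Finset.image_image]; rfl, ?_⟩
  rw [h1.2, Finset.sum_image]
  · refine Finset.sum_congr rfl fun h hh => ?_
    rw [Finset.mem_sdiff, Finset.mem_range] at hh
    exact Λ.card_fc_en D hT hh.1 hh.2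
  · intro a ha b hb hab
    simp only [Finset.coe_sdiff, Set.mem_sdiff, Finset.mem_coe, Finset.mem_range] at ha hb
    exact Λ.inj _ ha.1 _ hb.1 hab

/-- The size of a fundamental cycle basis in terms of the distances of the ends of all edges. -/
lemma size_add {B : Finset (Finset (Sym2 V))} (hB : ∀ C, C ∈ B ↔ IsFundamentalCycle G T C) :
    size B + 2 * (Λ.K + 1) =
      ∑ h ∈ Finset.range Λ.N, Λ.cost h * (Λ.tree D hT).dist h + Λ.m := by
  have h1 := Λ.m_le
  have hsub : (Λ.tree D hT).T ⊆ Finset.range Λ.m := fun h hh => by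
    simpa using Λ.tree_T_lt D hT hh
  have h2 : ∑ h ∈ Finset.range Λ.N, Λ.cost h * (Λ.tree D hT).dist h
      = ∑ h ∈ Finset.range Λ.m, (Λ.tree D hT).dist h := by
    rw [← Finset.sum_subset (Finset.range_mono h1)]
    · refine Finset.sum_congr rfl fun h hh => ?_
      rw [Finset.mem_range] at hh
      simp [cost, hh]
    · intro h _ hh
      rw [Finset.mem_range] at hh
      simp [cost, hh]
  have h3 : ∑ h ∈ (Λ.tree D hT).T, (Λ.tree D hT).dist h = Λ.K + 1 := by
    rw [Finset.sum_congr rfl (fun h hh => (Λ.tree D hT).dist_of_mem hh)]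
    simpa using (Λ.tree D hT).card
  have h4 := Finset.sum_sdiff hsub (f := (Λ.tree D hT).dist)
  have h5 : (Finset.range Λ.m \ (Λ.tree D hT).T).card + (Λ.K + 1) = Λ.m := by
    rw [Finset.card_sdiff_of_subset hsub, Finset.card_range, ← (Λ.tree D hT).card]
    have := Finset.card_le_card hsub
    rw [Finset.card_range] at this
    omega
  rw [(Λ.basis_eq D hT hB).2, Finset.sum_add_distrib, h2]
  simp only [Finset.sum_const, smul_eq_mul, mul_one]
  omega

end

section
variable {Λ} (D : Λ.Tables Λ.cost)

omit [DecidableEq V] in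
/-- Virtual edges are chosen. -/
lemma lt_of_mem_T {h : ℕ} (hh : h ∈ Λ.T 0 D.e) : h < Λ.m := by
  rw [mem_T, Scheme.E_zero, Finset.mem_range] at hh
  by_contra hm
  obtain ⟨p, q, hpq, hs⟩ := Finset.card_eq_two.1 (Λ.virt h (by omega) hh.1)
  have hlt : ∀ i ∈ ({p, q} : Finset ℕ), i < Λ.K := by
    intro i hi
    rw [← hs, Finset.mem_filter, Finset.mem_range] at hi
    exact hi.1
  have hc : Λ.cost h = 0 := by simp [cost, hm]
  have : ∃ i < Λ.K, D.e i = h := by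
    rcases lt_or_gt_of_ne hpq with h1 | h1
    · exact D.exists_e hc h1 (hlt _ (by simp)) hs
    · exact D.exists_e hc h1 (hlt _ (by simp)) (by rw [hs, Finset.pair_comm])
  obtain ⟨i, hi, he⟩ := this
  exact hh.2 i (Nat.zero_le _) hi he

/-- The edges that are not chosen form a spanning tree. -/
lemma isSpanningTree :
    IsSpanningTree G (SimpleGraph.fromEdgeSet (Λ.en '' (Λ.T 0 D.e : Set ℕ))) ∧
      ∀ e, e ∈ (SimpleGraph.fromEdgeSet (Λ.en '' (Λ.T 0 D.e : Set ℕ))).edgeSet ↔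
        ∃ h ∈ Λ.T 0 D.e, Λ.en h = e := by
  classical
  set T := SimpleGraph.fromEdgeSet (Λ.en '' (Λ.T 0 D.e : Set ℕ)) with hTdef
  have hm : ∀ h < Λ.m, h < Λ.N := fun h hh => lt_of_lt_of_le hh Λ.m_le
  have hset : ∀ e, e ∈ T.edgeSet ↔ ∃ h ∈ Λ.T 0 D.e, Λ.en h = e := by
    intro e
    rw [hTdef, SimpleGraph.edgeSet_fromEdgeSet]
    constructor
    · rintro ⟨⟨h, h1, h2⟩, -⟩; exact ⟨h, h1, h2⟩
    · rintro ⟨h, h1, rfl⟩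
      exact ⟨⟨h, h1, rfl⟩, Λ.not_diag h (hm h (lt_of_mem_T D h1))⟩
  refine ⟨⟨?_, ?_⟩, hset⟩
  · rw [← SimpleGraph.edgeSet_subset_edgeSet]
    intro e he
    obtain ⟨h, h1, rfl⟩ := (hset e).1 he
    exact (Λ.real _).2 ⟨h, lt_of_mem_T D h1, rfl⟩
  · rw [SimpleGraph.isTree_iff_connected_and_card]
    constructor
    · have : Nonempty V := Λ.conn.nonempty
      refine SimpleGraph.Connected.mk fun a b => ?_
      -- no edge leaves the component of `a`, as the corresponding cut avoids the tree
      have hz := Scheme.cut_zero (Λ.isCut_cross fun x => decide (T.Reachable a x)) (Nat.zero_le _)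
        D.isChoice (by
          intro h hh
          have h2 : Λ.en h ∈ T.edgeSet := (hset _).2 ⟨h, hh, rfl⟩
          generalize Λ.en h = e at h2
          induction e using Sym2.ind with
          | _ c d =>
          have hadj : T.Adj c d := h2
          have : T.Reachable a c ↔ T.Reachable a d :=
            ⟨fun h => h.trans hadj.reachable, fun h => h.trans hadj.reachable.symm⟩
          simp [this])
      have hGadj : ∀ c d, G.Adj c d → (T.Reachable a c ↔ T.Reachable a d) := by
        intro c d hcd
        obtain ⟨h, h1, h2⟩ := (Λ.real s(c, d)).1 hcd
        have h3 := hz h (by rw [Λ.toScheme.E_zero, Finset.mem_range]; exact hm h h1)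
        rw [h2, cross_mk] at h3
        by_cases h4 : T.Reachable a c <;> by_cases h5 : T.Reachable a d <;> simp_all
      obtain ⟨p⟩ := Λ.conn.preconnected a b
      have : ∀ {x y : V}, G.Walk x y → T.Reachable a x → T.Reachable a y := by
        intro x y p
        induction p with
        | nil => exact id
        | cons h p ih => exact fun h1 => ih ((hGadj _ _ h).1 h1)
      exact this p (SimpleGraph.Reachable.refl a)
    · have h1 : T.edgeSet = ((Λ.T 0 D.e).image Λ.en : Finset (Sym2 V)) := by
        ext e; rw [hset]; simp
      rw [h1, Nat.card_eq_fintype_card, Nat.card_eq_fintype_card, Λ.card_V]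
      simp only [Fintype.card_coe, Finset.coe_sort_coe]
      rw [Finset.card_image_of_injOn, Scheme.card_T D.isChoice]
      intro a ha b hb hab
      exact Λ.inj _ (lt_of_mem_T D ha) _ (lt_of_mem_T D hb) hab

/-- The fundamental cycles of the tree of unchosen edges form a minimum fundamental cycle basis. -/
theorem exists_basis : ∃ (τ : Λ.Tree) (B : Finset (Finset (Sym2 V))),
    τ.T = Λ.T 0 D.e ∧ τ.T ⊆ Finset.range Λ.m ∧ IsMinFundamentalCycleBasis G B ∧
    B = (Finset.range Λ.m \ τ.T).image (fun h => (insert h (τ.path h)).image Λ.en) ∧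
    size B = ∑ h ∈ Finset.range Λ.m \ τ.T, (τ.dist h + 1) ∧
    ∀ h ∈ Finset.range Λ.m \ τ.T, ∀ h' ∈ Finset.range Λ.m \ τ.T,
      (insert h (τ.path h)).image Λ.en = (insert h' (τ.path h')).image Λ.en → h = h' := by
  classical
  obtain ⟨hT, hset⟩ := isSpanningTree D
  set T := SimpleGraph.fromEdgeSet (Λ.en '' (Λ.T 0 D.e : Set ℕ))
  obtain ⟨Dc⟩ := exists_treeCuts hT.2
  have hTT : (Λ.tree Dc hT).T = Λ.T 0 D.e := by
    ext h
    constructor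
    · intro h1
      have h2 := Λ.tree_T_lt Dc hT h1
      rw [Λ.mem_tree_T Dc hT h2, Dc.mem_ET, hset] at h1
      obtain ⟨h', h3, h4⟩ := h1
      rwa [← Λ.inj h' (lt_of_mem_T D h3) h h2 h4]
    · intro h1
      rw [Λ.mem_tree_T Dc hT (lt_of_mem_T D h1), Dc.mem_ET, hset]
      exact ⟨h, h1, rfl⟩
  have hd : ∀ j < Λ.K, D.e j ∉ (Λ.tree Dc hT).T := by
    intro j hj h
    rw [hTT, mem_T] at h
    exact h.2 j (Nat.zero_le _) hj rfl
  let B : Finset (Finset (Sym2 V)) :=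
    (Finset.range Λ.m \ (Λ.tree Dc hT).T).image (fun h => Dc.fc (Λ.en h))
  have hB : ∀ C, C ∈ B ↔ IsFundamentalCycle G T C := by
    intro C
    rw [Dc.isFundamentalCycle_iff hT.2.connected]
    simp only [B, Finset.mem_image, Finset.mem_sdiff, Finset.mem_range]
    constructor
    · rintro ⟨h, ⟨h1, h2⟩, rfl⟩
      exact ⟨_, (Λ.real _).2 ⟨h, h1, rfl⟩, by rwa [← Λ.mem_tree_T Dc hT h1], rfl⟩
    · rintro ⟨e, h1, h2, rfl⟩
      obtain ⟨h, h3, rfl⟩ := (Λ.real _).1 h1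
      exact ⟨h, ⟨h3, by rwa [Λ.mem_tree_T Dc hT h3]⟩, rfl⟩
  refine ⟨Λ.tree Dc hT, B, hTT, ?_, ⟨⟨Dc.isCycleBasis hT hB, T, hT, hB⟩, ?_⟩, ?_,
    (Λ.basis_eq Dc hT hB).2, ?_⟩
  · exact fun h hh => by simpa using Λ.tree_T_lt Dc hT hh
  · rintro B' ⟨-, T', hT', hB'⟩
    obtain ⟨D'⟩ := exists_treeCuts hT'.2
    have h1 := Λ.size_add Dc hT hB
    have h2 := Λ.size_add D' hT' hB'
    have h3 := (Λ.tree D' hT').le_sum Λ.cost D.a (fun i hi h hh => D.a_le hi hh)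
    have h4 := (Λ.tree Dc hT).sum_eq_of_tight Λ.cost D.a D.isChoice hd (fun i hi => D.a_e hi)
    omega
  · simp only [B, Λ.fc_en Dc hT]
  · intro h hh h' hh' heq
    rw [← Λ.fc_en Dc hT, ← Λ.fc_en Dc hT] at heq
    rw [Finset.mem_sdiff, Finset.mem_range] at hh hh'
    refine Λ.inj _ hh.1 _ hh'.1 (Dc.fc_injOn ?_ ?_ heq)
    · show Λ.en h ∉ Dc.ET
      rw [← Λ.mem_tree_T Dc hT hh.1]; exact hh.2
    · show Λ.en h' ∉ Dc.ET
      rw [← Λ.mem_tree_T Dc hT hh'.1]; exact hh'.2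

end

end Layout

end

/-! ### The beginning and the end of the elimination -/

lemma IsPolygonalSubgraph.connected {V : Type*} {G : SimpleGraph V} {H : G.Subgraph}
    (h : IsPolygonalSubgraph G H) : H.Connected := by
  induction h with
  | cycle w hw => exact w.toSubgraph_connected
  | @addPath H hH u v huv p hp hlen hE hV ih =>
    refine SimpleGraph.Subgraph.connected_sup ih.preconnected p.toSubgraph_connected.preconnected
      ⟨u, ?_⟩
    rw [SimpleGraph.Subgraph.verts_inf, hV]
    exact Set.mem_insert _ _

lemma IsPolygonalTwoTree.connected {V : Type*} {G : SimpleGraph V} (h : IsPolygonalTwoTree G) :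
    G.Connected :=
  SimpleGraph.Subgraph.topIso.connected_iff.1
    (SimpleGraph.Subgraph.connected_iff'.1 (IsPolygonalSubgraph.connected h))

/-- A polygonal 2-tree with vertices below `n` as a relation on the natural numbers. -/
lemma IsPolygonalTwoTree.reducible_val {n : ℕ} {G : SimpleGraph (Fin n)}
    (h : IsPolygonalTwoTree G) :
    Reducible (Relation.Map G.Adj Fin.val Fin.val) (fun _ _ => False) := by
  have h1 := (IsPolygonalSubgraph.reducible h).map Fin.val_injective
  have h2 : Relation.Map (fun _ _ : Fin n => False) Fin.val Fin.val = fun _ _ => False := by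
    ext a b; simp [Relation.Map]
  rw [h2] at h1
  exact h1

lemma IsPolygonalTwoTree.three_le {n : ℕ} {G : SimpleGraph (Fin n)}
    (h : IsPolygonalTwoTree G) : 3 ≤ n := by
  obtain ⟨x, y, z, h1, h2, h3, ⟨_, _, _, _, h4, _⟩, ⟨_, _, _, _, h5, _⟩, ⟨_, _, _, _, h6, _⟩⟩ :=
    h.reducible_val.exists_three
  omega

lemma IsPolygonalTwoTree.exists_adj {n : ℕ} {G : SimpleGraph (Fin n)}
    (h : IsPolygonalTwoTree G) (a : Fin n) : ∃ b, G.Adj a b := by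
  have h3 := h.three_le
  have : Nontrivial (Fin n) := Fin.nontrivial_iff_two_le.2 (by omega)
  have h1 : a ∈ G.support := by
    rw [h.connected.preconnected.support_eq_univ]; trivial
  exact h1

/-- The invariant holds at the start, without virtual edges, the edges being named by their places
in the input. -/
lemma ElimInv.init {n m : ℕ} {G : SimpleGraph (Fin n)} (hG : IsPolygonalTwoTree G)
    {AD : ℕ → ℕ → ℕ} {eu ev : ℕ → ℕ} (L R B : ℕ → ℕ) (hlt : ∀ h < m, eu h < n ∧ ev h < n)
    (hE : ∀ a b : Fin n, G.Adj a b ↔ ∃ h < m, s(eu h, ev h) = s(a.val, b.val))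
    (h1 : ∀ h < m, AD (eu h) (ev h) = h + 1 ∧ AD (ev h) (eu h) = h + 1)
    (h0 : ∀ a b, a < n → b < n → (∀ h < m, s(eu h, ev h) ≠ s(a, b)) → AD a b = 0) :
    ElimInv n m 0 (Relation.Map G.Adj Fin.val Fin.val) (fun _ _ => False) AD m eu ev L R B := by
  have hE' : ∀ a b, Relation.Map G.Adj Fin.val Fin.val a b ↔ ∃ h < m, s(eu h, ev h) = s(a, b) := by
    intro a b
    constructor
    · rintro ⟨a, b, hab, rfl, rfl⟩; exact (hE a b).1 hab
    · rintro ⟨h, hh, he⟩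
      have hl := hlt h hh
      have : a < n ∧ b < n := by rcases Sym2.eq_iff.1 he with h2 | h2 <;> omega
      exact ⟨⟨a, this.1⟩, ⟨b, this.2⟩, (hE _ _).2 ⟨h, hh, he⟩, rfl, rfl⟩
  have hr := hG.reducible_val
  refine ⟨fun _ => hr, fun a b => hr.symm, hr.irrefl, ?_, ⟨Finset.range n, ?_, by simp⟩, ?_, ?_, ?_,
    by simp, by simp, by simp, by simp, ?_, le_rfl, ?_⟩
  · rintro _ _ ⟨a, b, -, rfl, rfl⟩; exact a.2
  · intro a
    rw [Finset.mem_range]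
    constructor
    · intro ha
      obtain ⟨b, hb⟩ := hG.exists_adj ⟨a, ha⟩
      exact ⟨b, _, _, hb, rfl, rfl⟩
    · rintro ⟨_, a, b, -, rfl, rfl⟩; exact a.2
  · intro a b hab
    obtain ⟨h, hh, he⟩ := (hE' a b).1 hab
    refine ⟨h, ?_, hh, he, ?_, fun j hj => by omega⟩
    · rcases Sym2.eq_iff.1 he with ⟨rfl, rfl⟩ | ⟨rfl, rfl⟩
      · exact (h1 h hh).1
      · exact (h1 h hh).2
    · simpa using hh
  · rintro _ _ ⟨_, a, _, -, rfl, -⟩ ⟨_, b, _, -, rfl, -⟩ hab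
    apply h0 _ _ a.2 b.2
    intro h hh he
    exact hab ((hE' a b).2 ⟨h, hh, he⟩)
  · intro h hh _
    exact ⟨(hE' _ _).2 ⟨h, hh, rfl⟩, h1 h hh⟩
  · intro h h2 h3; omega
  · intro h hh
    refine ⟨(hlt h hh).1, (hlt h hh).2, fun heq => ?_⟩
    have := (hE' (eu h) (ev h)).2 ⟨h, hh, rfl⟩
    rw [heq] at this
    exact hr.irrefl _ this

/-- In the end, one edge remains, so each elimination accounts for two edges. -/
lemma ElimInv.cnt_eq {n m i : ℕ} {E X : ℕ → ℕ → Prop} {AD : ℕ → ℕ → ℕ} {cnt : ℕ}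
    {eu ev L R B : ℕ → ℕ} (I : ElimInv n m i E X AD cnt eu ev L R B) (hi : i + 2 = n) :
    cnt = 2 * i + 1 := by
  classical
  obtain ⟨A, hA, hc⟩ := I.card
  obtain ⟨a, b, hab, rfl⟩ := Finset.card_eq_two.1 (show A.card = 2 by omega)
  have hE : E a b := by
    obtain ⟨c, hac⟩ := (hA a).1 (by simp)
    have : c ∈ ({a, b} : Finset ℕ) := (hA c).2 ⟨a, I.symm _ _ hac⟩
    rw [Finset.mem_insert, Finset.mem_singleton] at this
    rcases this with rfl | rfl
    · exact absurd hac (I.irrefl _)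
    · exact hac
  obtain ⟨h0, h1, h2, h3, -, h4⟩ := I.adj a b hE
  have huniq : ∀ h < cnt, Live L R i h → h = h0 := by
    intro h hh hl
    obtain ⟨h5, h6, h7⟩ := I.ends h hh hl
    have m1 := (hA (eu h)).2 ⟨_, h5⟩
    have m2 := (hA (ev h)).2 ⟨_, I.symm _ _ h5⟩
    rw [Finset.mem_insert, Finset.mem_singleton] at m1 m2
    have hne := (I.ends_ne h hh).2.2
    rcases m1 with m1 | m1 <;> rcases m2 with m2 | m2
    · omega
    · rw [m1, m2] at h6; omega
    · rw [m1, m2] at h7; omega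
    · omega
  have hinj : ∀ f : ℕ → ℕ, (∀ j k, j < k → k < i → f j ≠ f k) →
      ((Finset.range i).image f).card = i := by
    intro f hf
    rw [Finset.card_image_of_injOn, Finset.card_range]
    intro j hj k hk hjk
    rw [Finset.coe_range, Set.mem_Iio] at hj hk
    rcases lt_trichotomy j k with h | h | h
    · exact absurd hjk (hf _ _ h hk)
    · exact h
    · exact absurd hjk.symm (hf _ _ h hj)
  have hset : Finset.range cnt
      = insert h0 ((Finset.range i).image L ∪ (Finset.range i).image R) := by
    ext h
    simp only [Finset.mem_range, Finset.mem_insert, Finset.mem_union, Finset.mem_image]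
    constructor
    · intro hh
      by_cases hl : Live L R i h
      · exact Or.inl (huniq h hh hl)
      · right
        simp only [Live, not_forall] at hl
        obtain ⟨j, hj, hne⟩ := hl
        by_cases h5 : h = L j
        · exact Or.inl ⟨j, hj, h5.symm⟩
        · exact Or.inr ⟨j, hj, by by_contra h6; exact hne ⟨h5, fun h7 => h6 h7.symm⟩⟩
    · rintro (rfl | ⟨j, hj, rfl⟩ | ⟨j, hj, rfl⟩)
      · exact h2
      · exact (I.tri_lt j hj).1
      · exact (I.tri_lt j hj).2.1
  have hd : Disjoint ((Finset.range i).image L) ((Finset.range i).image R) := by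
    rw [Finset.disjoint_left]
    intro h hl hr
    obtain ⟨j, hj, rfl⟩ := Finset.mem_image.1 hl
    obtain ⟨k, hk, hjk⟩ := Finset.mem_image.1 hr
    rw [Finset.mem_range] at hj hk
    rcases lt_trichotomy j k with h | h | h
    · exact (I.fresh j k h hk).1.2.1 hjk.symm
    · subst h; exact (I.tri_ne j hj).1 hjk.symm
    · exact (I.fresh k j h hj).2.1 hjk
  have hcard := congrArg Finset.card hset
  rw [Finset.card_range, Finset.card_insert_of_notMem, Finset.card_union_of_disjoint hd,
    hinj L (fun j k h h' => (I.fresh j k h h').1.1),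
    hinj R (fun j k h h' => (I.fresh j k h h').2.2.1)] at hcard
  · omega
  · rw [Finset.mem_union, Finset.mem_image, Finset.mem_image]
    rintro (⟨j, hj, h5⟩ | ⟨j, hj, h5⟩)
    · exact (h4 j (Finset.mem_range.1 hj)).1 h5.symm
    · exact (h4 j (Finset.mem_range.1 hj)).2 h5.symm

/-- The record of a complete elimination. -/
lemma ElimInv.exists_layout {n m i : ℕ} {E X : ℕ → ℕ → Prop} {AD : ℕ → ℕ → ℕ} {cnt : ℕ}
    {eu ev L R B : ℕ → ℕ} (I : ElimInv n m i E X AD cnt eu ev L R B) (hi : i + 2 = n)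
    {G : SimpleGraph (Fin n)} (hG : G.Connected)
    (hE : ∀ a b : Fin n, G.Adj a b ↔ ∃ h < m, s(eu h, ev h) = s(a.val, b.val))
    (hinj : ∀ h < m, ∀ h' < m, s(eu h, ev h) = s(eu h', ev h') → h = h') :
    ∃ Λ : Layout G, Λ.K = i ∧ Λ.N = cnt ∧ Λ.L = L ∧ Λ.R = R ∧ Λ.B = B ∧ Λ.m = m ∧
      ∀ h < cnt, (Λ.en h).map Fin.val = s(eu h, ev h) := by
  have hcnt := I.cnt_eq hi
  have hinjm : Function.Injective (Sym2.map (Fin.val : Fin n → ℕ)) :=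
    Sym2.map.injective Fin.val_injective
  have hex : ∀ h, ∃ e : Sym2 (Fin n), h < cnt → e.map Fin.val = s(eu h, ev h) := by
    intro h
    by_cases hh : h < cnt
    · obtain ⟨h1, h2, -⟩ := I.ends_ne h hh
      exact ⟨s(⟨_, h1⟩, ⟨_, h2⟩), fun _ => rfl⟩
    · exact ⟨s(⟨0, by omega⟩, ⟨0, by omega⟩), fun h => absurd h hh⟩
  choose en hen using hex
  have hm := I.le_cnt
  refine ⟨{ K := i, N := cnt, L := L, R := R, B := B, m := m, en := en
            L_lt := fun j hj => (I.tri_lt j hj).1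
            R_lt := fun j hj => (I.tri_lt j hj).2.1
            B_lt := fun j hj => (I.tri_lt j hj).2.2
            LR := fun j hj => (I.tri_ne j hj).1
            LB := fun j hj => (I.tri_ne j hj).2.1
            RB := fun j hj => (I.tri_ne j hj).2.2
            L_fresh := fun j k h h' => (I.fresh j k h h').1
            R_fresh := fun j k h h' => (I.fresh j k h h').2
            card := hcnt
            m_le := hm
            card_V := by simpa using hi.symm
            not_diag := ?_, geom := ?_, real := ?_, inj := ?_, virt := ?_, conn := hG },
          rfl, rfl, rfl, rfl, rfl, rfl, hen⟩
  · intro h hh hd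
    have h1 := hen h hh
    have h2 := (I.ends_ne h hh).2.2
    generalize en h = e at hd h1
    induction e using Sym2.ind with
    | _ a b =>
    rw [Sym2.mk_isDiag_iff] at hd
    subst hd
    rw [Sym2.map_mk, Sym2.eq_iff] at h1
    omega
  · intro j hj
    obtain ⟨v, u, w, h1, h2, h3⟩ := I.geom j hj
    obtain ⟨l1, l2, l3⟩ := I.tri_lt j hj
    have e1 := hen _ l1; have e2 := hen _ l2; have e3 := hen _ l3
    have b1 := I.ends_ne _ l1
    have b2 := I.ends_ne _ l2
    have hv : v < n ∧ u < n := by rcases Sym2.eq_iff.1 h1 with h | h <;> omega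
    have hw : w < n := by rcases Sym2.eq_iff.1 h2 with h | h <;> omega
    refine ⟨⟨v, hv.1⟩, ⟨u, hv.2⟩, ⟨w, hw⟩, hinjm ?_, hinjm ?_, hinjm ?_⟩
    · rw [e1, h1]; rfl
    · rw [e2, h2]; rfl
    · rw [e3, h3]; rfl
  · intro e
    induction e using Sym2.ind with
    | _ a b =>
    rw [SimpleGraph.mem_edgeSet, hE]
    constructor
    · rintro ⟨h, h1, h2⟩
      exact ⟨h, h1, hinjm (by rw [hen h (by omega), h2]; rfl)⟩
    · rintro ⟨h, h1, h2⟩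
      refine ⟨h, h1, ?_⟩
      rw [← hen h (by omega), h2]; rfl
  · intro h hh h' hh' he
    apply hinj h hh h' hh'
    rw [← hen h (by omega), ← hen h' (by omega), he]
  · intro h h1 h2
    have := (I.virt h h1 h2).2 (by omega)
    rw [← this]
    congr 1
    exact Finset.filter_congr fun j _ => Scheme.mem_tri

/-! ### The program: reading the graph -/

/-- The registers that are fixed from the start, and the input array. Registers `0`, `1`, `4` hold
the constants zero, one and two, and registers `2` and `3` the numbers `n` and `m` of vertices and
edges. Of the arrays, `0` is the input and `1` the output. Array `4` is the table with the number of
the edge between two vertices (increased by one), arrays `5`, `6`, `7` hold, for every vertex, the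
number of its neighbours, their sum and the sum of their squares, array `8` is a table of square
roots, and array `9` is a stack. Arrays `10`, `11`, `12` hold the triangles, arrays `13`, `14`, `15`
the tables `DL`, `CS`, `U` of the dynamic program, and arrays `16`, `17`, `18` the chosen edges. -/
structure Std (n m : ℕ) (inp : ℕ → ℕ) (s : State) : Prop where
  zero : s.reg 0 = 0
  one : s.reg 1 = 1
  size : s.reg 2 = n
  edges : s.reg 3 = m
  two : s.reg 4 = 2
  input : s.mem 0 = inp

lemma Std.congr {n m : ℕ} {inp : ℕ → ℕ} {s s' : State} (h : Std n m inp s)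
    (hr : ∀ r < 5, s'.reg r = s.reg r) (hm : s'.mem 0 = s.mem 0) : Std n m inp s' := by
  obtain ⟨h0, h1, h2, h3, h4, h5⟩ := h
  exact ⟨by rw [hr 0 (by omega), h0], by rw [hr 1 (by omega), h1], by rw [hr 2 (by omega), h2],
    by rw [hr 3 (by omega), h3], by rw [hr 4 (by omega), h4], by rw [hm, h5]⟩

/-- Load the constants. -/
def progConst : Program := block (.const 1 1) [.const 4 2, .load 2 0 0, .load 3 0 1]

lemma progConst_wp {W n m : ℕ} {inp : ℕ → ℕ} {s : State} (hW : 2 < W) (hn : n < W) (hm : m < W)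
    (h0 : s.reg 0 = 0) (hin : s.mem 0 = inp) (hi0 : inp 0 = n) (hi1 : inp 1 = m) :
    WP W progConst (fun s' t => Std n m inp s' ∧ (∀ r, 5 ≤ r → s'.reg r = s.reg r) ∧
      s'.mem = s.mem ∧ t ≤ 4) s := by
  apply WP.block
  simp only [wpOps, Op.wp, State.set_reg, State.set_mem]
  simp [hin, hi0, hi1, h0, hn, hm, hW, show 1 < W by omega]
  refine ⟨⟨by simp [h0], by simp, by simp, by simp, by simp, by simp [hin]⟩, fun r hr => ?_⟩
  have : r ≠ 3 ∧ r ≠ 2 ∧ r ≠ 4 ∧ r ≠ 1 := by omega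
  simp [this]

/-- The table of square roots. -/
def progSqrt : Program :=
  .seq (.op (.copy 6 0)) (.loop (.lt 6 2) (block (.mul 10 6 6) [.store 8 10 6, .add 6 6 1]))

lemma progSqrt_wp {W n m : ℕ} {inp : ℕ → ℕ} {s : State} (hW : n * n < W) (hn : n < W)
    (hs : Std n m inp s) :
    WP W progSqrt (fun s' t => Std n m inp s' ∧ (∀ k < n, s'.mem 8 (k * k) = k) ∧
      (∀ a, a ≠ 8 → s'.mem a = s.mem a) ∧ t ≤ 4 * n + 2) s := by
  apply WP.seq
  refine ⟨s.set 6 (s.reg 0), 1, .op ?_, ?_⟩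
  · simp [Op.run, State.write, State.set, hs.zero]; omega
  refine WP.loop (fun i s' => Std n m inp s' ∧ s'.reg 6 = i ∧ i ≤ n ∧
    (∀ k < i, s'.mem 8 (k * k) = k) ∧ (∀ a, a ≠ 8 → s'.mem a = s.mem a)) (fun _ => 3) n ?_ ?_ ?_ ?_
  · refine ⟨hs.congr ?_ ?_, ?_, ?_⟩
    · intro r hr; simp [show r ≠ 6 by omega]
    · simp
    · simp [hs.zero]
    · simp
  · rintro i hi s1 ⟨h1, h2, h3, h4, h5⟩
    refine ⟨by simp [Test.holds, h2, h1.size, hi], WP.block _ _ ?_⟩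
    have hii : i * i < W := lt_of_le_of_lt (Nat.mul_le_mul hi.le hi.le) hW
    have hi1 : i + 1 < W := by omega
    simp only [wpOps, Op.wp, State.set_reg, State.set_mem, State.put_reg, State.put_mem]
    simp [h2, h1.one, hii, hi1]
    refine ⟨h1.congr ?_ ?_, hi, ?_, ?_⟩
    · intro r hr
      have : r ≠ 6 ∧ r ≠ 10 := by omega
      simp [this]
    · simp
    · intro k hk
      by_cases hki : k = i
      · simp [hki]
      · have : k * k ≠ i * i := by
          have : k < i := by omega
          exact (Nat.mul_self_lt_mul_self this).ne
        rw [Function.update_of_ne this]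
        exact h4 k (by omega)
    · intro a ha
      simp [ha, h5]
  · rintro s1 ⟨h1, h2, -⟩
    simp [Test.holds, h2, h1.size]
  · rintro s1 t ⟨h1, h2, h3, h4, h5⟩ ht
    refine ⟨h1, h4, h5, ?_⟩
    simp at ht
    omega

/-- The cell of the pair `a`, `b` in a table with `n * n` cells. -/
lemma idx_lt {n a b : ℕ} (ha : a < n) (hb : b < n) : a * n + b < n * n := by
  have : (a + 1) * n ≤ n * n := Nat.mul_le_mul_right n ha
  rw [Nat.add_mul] at this
  omega

lemma idx_inj {n a b c d : ℕ} (hb : b < n) (hd : d < n) :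
    a * n + b = c * n + d ↔ a = c ∧ b = d := by
  constructor
  · intro h
    have h1 : (a * n + b) / n = (c * n + d) / n := by rw [h]
    have h2 : (a * n + b) % n = (c * n + d) % n := by rw [h]
    have hn : 0 < n := by omega
    rw [Nat.mul_comm a, Nat.mul_comm c, Nat.mul_add_div hn, Nat.mul_add_div hn,
      Nat.div_eq_of_lt hb, Nat.div_eq_of_lt hd] at h1
    rw [Nat.mul_comm a, Nat.mul_comm c, Nat.mul_add_mod, Nat.mul_add_mod, Nat.mod_eq_of_lt hb,
      Nat.mod_eq_of_lt hd] at h2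
    omega
  · rintro ⟨rfl, rfl⟩; rfl

lemma update_idx {n a b u v x : ℕ} {f : ℕ → ℕ} (hb : b < n) (hu : u < n) (hv : v < n) :
    Function.update (Function.update f (u * n + v) x) (v * n + u) x (a * n + b) =
      if (a = u ∧ b = v) ∨ (a = v ∧ b = u) then x else f (a * n + b) := by
  simp only [Function.update_apply, idx_inj hb hu, idx_inj hb hv]
  by_cases h1 : a = v ∧ b = u <;> by_cases h2 : a = u ∧ b = v <;> simp [h1, h2]

/-- The bounds that exclude overflow: all words are below `100 * n ^ 3`. The
middle ones follow from the first one and are kept for linear arithmetic. -/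
structure Bounds (n m W : ℕ) : Prop where
  three_le : 3 ≤ n
  edges : m ≤ n * n
  sq : n ≤ n * n
  cube : n * n ≤ n * n * n
  word : 100 * (n * n * n) ≤ W

/-- The number, the sum and the sum of squares of the neighbours of `x`. -/
def Sums (E : ℕ → ℕ → Prop) (S0 S1 S2 : ℕ → ℕ) (x : ℕ) : Prop :=
  ∃ A : Finset ℕ, (∀ y, y ∈ A ↔ E x y) ∧ S0 x = A.card ∧ S1 x = ∑ y ∈ A, y ∧
    S2 x = ∑ y ∈ A, y * y

lemma Sums.le {E : ℕ → ℕ → Prop} {S0 S1 S2 : ℕ → ℕ} {x n : ℕ} (h : Sums E S0 S1 S2 x)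
    (hE : ∀ y, E x y → y < n) : S0 x ≤ n ∧ S1 x ≤ n * n ∧ S2 x ≤ n * n * n := by
  obtain ⟨A, hA, h0, h1, h2⟩ := h
  have hs : A ⊆ Finset.range n := fun y hy => Finset.mem_range.2 (hE y ((hA y).1 hy))
  have hc : A.card ≤ n := by simpa using Finset.card_le_card hs
  have hlt : ∀ y ∈ A, y < n := fun y hy => hE y ((hA y).1 hy)
  refine ⟨by omega, ?_, ?_⟩
  · rw [h1]
    refine (Finset.sum_le_card_nsmul A _ n fun y hy => (hlt y hy).le).trans ?_
    exact Nat.mul_le_mul_right n hc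
  · rw [h2]
    refine (Finset.sum_le_card_nsmul A _ (n * n) fun y hy =>
      Nat.mul_le_mul (hlt y hy).le (hlt y hy).le).trans ?_
    rw [smul_eq_mul, Nat.mul_assoc]
    exact Nat.mul_le_mul_right _ hc

/-- Record the vertex in register `21` as a neighbour of the vertex in register `20`. -/
def progAddNbr : Program :=
  block (.load 30 5 20) [.add 30 30 1, .store 5 20 30, .load 30 6 20, .add 30 30 21,
    .store 6 20 30, .mul 31 21 21, .load 30 7 20, .add 30 30 31, .store 7 20 30]

lemma progAddNbr_wp {W x y : ℕ} {s : State} (h1 : s.reg 1 = 1) (hx : s.reg 20 = x)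
    (hy : s.reg 21 = y) (b0 : s.mem 5 x + 1 < W) (b1 : s.mem 6 x + y < W)
    (b2 : s.mem 7 x + y * y < W) :
    WP W progAddNbr (fun s' t => (∀ r < 30, s'.reg r = s.reg r) ∧
      s'.mem 5 = Function.update (s.mem 5) x (s.mem 5 x + 1) ∧
      s'.mem 6 = Function.update (s.mem 6) x (s.mem 6 x + y) ∧
      s'.mem 7 = Function.update (s.mem 7) x (s.mem 7 x + y * y) ∧
      (∀ a, a ≠ 5 → a ≠ 6 → a ≠ 7 → s'.mem a = s.mem a) ∧ t = 10) s := by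
  apply WP.block
  have c0 : s.mem 5 x < W := by omega
  have c1 : s.mem 6 x < W := by omega
  have c2 : s.mem 7 x < W := by omega
  have c3 : y * y < W := by omega
  simp only [wpOps, Op.wp, State.set_reg, State.set_mem, State.put_reg, State.put_mem]
  simp [h1, hx, hy, b0, b1, b2, c0, c1, c2, c3]
  refine ⟨fun r hr => ?_, fun a h5 h6 h7 => ?_⟩
  · have : r ≠ 30 ∧ r ≠ 31 := by omega
    simp [this]
  · simp [h5, h6, h7]

lemma Sums.add {E E' : ℕ → ℕ → Prop} {S0 S1 S2 S0' S1' S2' : ℕ → ℕ} {x y : ℕ}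
    (h : Sums E S0 S1 S2 x) (hn : ¬ E x y) (hE : ∀ z, E' x z ↔ E x z ∨ z = y)
    (h0 : S0' x = S0 x + 1) (h1 : S1' x = S1 x + y) (h2 : S2' x = S2 x + y * y) :
    Sums E' S0' S1' S2' x := by
  obtain ⟨A, hA, e0, e1, e2⟩ := h
  have hy : y ∉ A := fun h => hn ((hA y).1 h)
  refine ⟨insert y A, fun z => ?_, ?_, ?_, ?_⟩
  · rw [Finset.mem_insert, hA, hE]; tauto
  · rw [Finset.card_insert_of_notMem hy, h0, e0]
  · rw [Finset.sum_insert hy, h1, e1]; omega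
  · rw [Finset.sum_insert hy, h2, e2]; omega

lemma Sums.of_eq {E E' : ℕ → ℕ → Prop} {S0 S1 S2 S0' S1' S2' : ℕ → ℕ} {x : ℕ}
    (h : Sums E S0 S1 S2 x) (hE : ∀ z, E' x z ↔ E x z)
    (h0 : S0' x = S0 x) (h1 : S1' x = S1 x) (h2 : S2' x = S2 x) :
    Sums E' S0' S1' S2' x := by
  obtain ⟨A, hA, e0, e1, e2⟩ := h
  exact ⟨A, fun z => by rw [hA, hE], by rw [h0, e0], by rw [h1, e1], by rw [h2, e2]⟩

/-- The edges of a graph as they are found in the input array. -/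
structure EdgeList (n m : ℕ) (inp eu ev : ℕ → ℕ) : Prop where
  lt : ∀ h < m, eu h < n ∧ ev h < n
  ne : ∀ h < m, eu h ≠ ev h
  inj : ∀ h < m, ∀ h' < m, s(eu h, ev h) = s(eu h', ev h') → h = h'
  left : ∀ h < m, inp (2 + 2 * h) = eu h
  right : ∀ h < m, inp (3 + 2 * h) = ev h

/-- The adjacency given by the first `j` edges. -/
def adjUpTo (eu ev : ℕ → ℕ) (j a b : ℕ) : Prop := ∃ h < j, s(eu h, ev h) = s(a, b)

/-- The state of the tables when `j` edges are read. -/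
structure ReadInv (n j : ℕ) (eu ev : ℕ → ℕ) (s : State) : Prop where
  adj : ∀ h < j, s.mem 4 (eu h * n + ev h) = h + 1 ∧ s.mem 4 (ev h * n + eu h) = h + 1
  nadj : ∀ a b, a < n → b < n → ¬ adjUpTo eu ev j a b → s.mem 4 (a * n + b) = 0
  sums : ∀ x < n, Sums (adjUpTo eu ev j) (s.mem 5) (s.mem 6) (s.mem 7) x
  cost : ∀ h, s.mem 14 h = if h < j then 1 else 0

/-- Enter the `j`-th edge into the adjacency table. -/
def progEnter : Program :=
  block (.add 10 6 6) [.add 10 10 4, .load 20 0 10, .add 10 10 1, .load 21 0 10,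
    .add 11 6 1, .mul 12 20 2, .add 12 12 21, .store 4 12 11, .mul 12 21 2, .add 12 12 20,
    .store 4 12 11]

lemma progEnter_wp {W n m j : ℕ} {inp eu ev : ℕ → ℕ} {s : State} (hB : Bounds n m W)
    (hL : EdgeList n m inp eu ev) (hs : Std n m inp s) (hj : j < m) (h6 : s.reg 6 = j) :
    WP W progEnter (fun s' t => (∀ r < 10, s'.reg r = s.reg r) ∧
      s'.reg 20 = eu j ∧ s'.reg 21 = ev j ∧
      s'.mem 4 = Function.update (Function.update (s.mem 4) (eu j * n + ev j) (j + 1))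
        (ev j * n + eu j) (j + 1) ∧ (∀ a, a ≠ 4 → s'.mem a = s.mem a) ∧ t = 12) s := by
  obtain ⟨b1, b2, b3, b4, b5⟩ := hB
  obtain ⟨hu, hv⟩ := hL.lt j hj
  have i1 := idx_lt hu hv
  have i2 := idx_lt hv hu
  have e1 : j + j + 2 = 2 + 2 * j := by omega
  have e2 : 2 + 2 * j + 1 = 3 + 2 * j := by omega
  have o1 : j + j < W := by omega
  have o2 : 2 + 2 * j < W := by omega
  have o3 : 3 + 2 * j < W := by omega
  have o4 : eu j < W := by omega
  have o5 : ev j < W := by omega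
  have o6 : j + 1 < W := by omega
  have o7 : eu j * n < W := by omega
  have o8 : ev j * n < W := by omega
  have o9 : eu j * n + ev j < W := by omega
  have o10 : ev j * n + eu j < W := by omega
  apply WP.block
  simp only [wpOps, Op.wp, State.set_reg, State.set_mem, State.put_reg, State.put_mem]
  simp [h6, hs.two, hs.one, hs.input, hs.size, e1, e2, hL.left j hj, hL.right j hj, o1, o2, o3,
    o4, o5, o6, o7, o8, o9, o10]
  refine ⟨fun r hr => ?_, fun a ha => by simp [ha]⟩
  have : r ≠ 10 ∧ r ≠ 11 ∧ r ≠ 12 ∧ r ≠ 20 ∧ r ≠ 21 := by omega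
  simp [this]

/-- Exchange registers `20` and `21`. -/
def progSwap : Program := block (.copy 22 20) [.copy 20 21, .copy 21 22]

lemma progSwap_wp {W : ℕ} {s : State} (h0 : s.reg 20 < W) (h1 : s.reg 21 < W) :
    WP W progSwap (fun s' t => (∀ r < 20, s'.reg r = s.reg r) ∧
      (∀ r, 23 ≤ r → s'.reg r = s.reg r) ∧ s'.reg 20 = s.reg 21 ∧
      s'.reg 21 = s.reg 20 ∧ s'.mem = s.mem ∧ t = 3) s := by
  apply WP.block
  simp only [wpOps, Op.wp, State.set_reg, State.set_mem]
  simp [h0, h1]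
  refine ⟨fun r hr => ?_, fun r hr => ?_⟩
  · have : r ≠ 20 ∧ r ≠ 21 ∧ r ≠ 22 := by omega
    simp [this]
  · have : r ≠ 20 ∧ r ≠ 21 ∧ r ≠ 22 := by omega
    simp [this]

/-- Read the edge in register `6`: enter it into the table, and each end as a neighbour of the
other; its cost is one. -/
def progReadEdge : Program :=
  .seq progEnter <| .seq progAddNbr <| .seq progSwap <| .seq progAddNbr <|
    block (.store 14 6 1) [.add 6 6 1]

lemma progReadEdge_wp {W n m j : ℕ} {inp eu ev : ℕ → ℕ} {s : State} (hB : Bounds n m W)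
    (hL : EdgeList n m inp eu ev) (hs : Std n m inp s) (hj : j < m) (h6 : s.reg 6 = j)
    (hI : ReadInv n j eu ev s) :
    WP W progReadEdge (fun s' t => Std n m inp s' ∧ s'.reg 6 = j + 1 ∧ ReadInv n (j + 1) eu ev s' ∧
      (∀ a, a ≠ 4 → a ≠ 5 → a ≠ 6 → a ≠ 7 → a ≠ 14 → s'.mem a = s.mem a) ∧ t ≤ 37) s := by
  have hB' := hB
  obtain ⟨b1, b2, b3, b4, b5⟩ := hB'
  obtain ⟨hu, hv⟩ := hL.lt j hj
  have huv := hL.ne j hj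
  have hlt : ∀ x y, adjUpTo eu ev j x y → y < n := by
    rintro x y ⟨h, hh, he⟩
    have := hL.lt h (by omega)
    rcases Sym2.eq_iff.1 he with h1 | h1 <;> omega
  have hnew : ¬ adjUpTo eu ev j (eu j) (ev j) := by
    rintro ⟨h, hh, he⟩
    have := hL.inj h (by omega) j hj he
    omega
  have hnew' : ¬ adjUpTo eu ev j (ev j) (eu j) := by
    rintro ⟨h, hh, he⟩
    have := hL.inj h (by omega) j hj (he.trans Sym2.eq_swap)
    omega
  have hsucc : ∀ a b, adjUpTo eu ev (j + 1) a b ↔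
      adjUpTo eu ev j a b ∨ (a = eu j ∧ b = ev j) ∨ (a = ev j ∧ b = eu j) := by
    intro a b
    constructor
    · rintro ⟨h, hh, he⟩
      rcases Nat.lt_succ_iff_lt_or_eq.1 hh with h1 | rfl
      · exact Or.inl ⟨h, h1, he⟩
      · rw [Sym2.eq_iff] at he
        rcases he with ⟨rfl, rfl⟩ | ⟨rfl, rfl⟩ <;> simp
    · rintro (⟨h, hh, he⟩ | ⟨rfl, rfl⟩ | ⟨rfl, rfl⟩)
      · exact ⟨h, by omega, he⟩
      · exact ⟨j, by omega, rfl⟩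
      · exact ⟨j, by omega, Sym2.eq_swap⟩
  have hsu := (hI.sums _ hu).le (hlt _)
  have hsv := (hI.sums _ hv).le (hlt _)
  have hsq : eu j * eu j < n * n := Nat.mul_self_lt_mul_self hu
  have hsq' : ev j * ev j < n * n := Nat.mul_self_lt_mul_self hv
  refine WP.seq ((progEnter_wp hB hL hs hj h6).mono ?_)
  rintro s1 t1 ⟨r1, x1, y1, m1, f1, rfl⟩
  have z1 := f1 5 (by simp); have z2 := f1 6 (by simp); have z3 := f1 7 (by simp)
  refine WP.seq ((progAddNbr_wp (x := eu j) (y := ev j) (by rw [r1 1 (by simp), hs.one]) x1 y1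
    (by rw [z1]; omega) (by rw [z2]; omega) (by rw [z3]; omega)).mono ?_)
  rintro s2 t2 ⟨r2, p2, q2, w2, f2, rfl⟩
  rw [z1] at p2; rw [z2] at q2; rw [z3] at w2
  have x2 := r2 20 (by simp); have y2 := r2 21 (by simp)
  rw [x1] at x2; rw [y1] at y2
  refine WP.seq ((progSwap_wp (by omega) (by omega)).mono ?_)
  rintro s3 t3 ⟨r3, -, x3, y3, m3, rfl⟩
  rw [x2] at y3; rw [y2] at x3
  refine WP.seq ((progAddNbr_wp (x := ev j) (y := eu j)
    (by rw [r3 1 (by simp), r2 1 (by simp), r1 1 (by simp), hs.one]) x3 y3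
    (by rw [m3, p2, Function.update_of_ne huv.symm]; omega)
    (by rw [m3, q2, Function.update_of_ne huv.symm]; omega)
    (by rw [m3, w2, Function.update_of_ne huv.symm]; omega)).mono ?_)
  rintro s4 t4 ⟨r4, p4, q4, w4, f4, rfl⟩
  rw [m3, p2, Function.update_of_ne huv.symm] at p4
  rw [m3, q2, Function.update_of_ne huv.symm] at q4
  rw [m3, w2, Function.update_of_ne huv.symm] at w4
  have hr : ∀ r < 10, s4.reg r = s.reg r := fun r hr => by
    rw [r4 r (by omega), r3 r (by omega), r2 r (by omega), r1 r (by omega)]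
  have hm : ∀ a, a ≠ 4 → a ≠ 5 → a ≠ 6 → a ≠ 7 → s4.mem a = s.mem a := fun a h4 h5 h6 h7 => by
    rw [f4 a h5 h6 h7, m3, f2 a h5 h6 h7, f1 a h4]
  have hm4 : s4.mem 4 = s1.mem 4 := by
    rw [f4 4 (by simp) (by simp) (by simp), m3, f2 4 (by simp) (by simp) (by simp)]
  have hj1 : j + 1 < W := by omega
  have key : ∀ a b, a < n → b < n → s1.mem 4 (a * n + b) =
      if (a = eu j ∧ b = ev j) ∨ (a = ev j ∧ b = eu j) then j + 1 else s.mem 4 (a * n + b) := by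
    intro a b ha hb
    rw [m1, update_idx hb hu hv]
  apply WP.block
  simp only [wpOps, Op.wp, State.set_reg, State.set_mem, State.put_reg, State.put_mem]
  simp [hr, hs.one, h6, hj1]
  refine ⟨hs.congr ?_ ?_, ⟨?_, ?_, ?_, ?_⟩, ?_⟩
  · intro r hr'; simp [show r ≠ 6 by omega, hr r (by omega)]
  · simp [hm]
  · intro h hh
    simp only [State.set_mem, State.put_mem, Nat.reduceEqDiff, reduceIte, hm4]
    have hl := hL.lt h (by omega)
    rw [key _ _ hl.1 hl.2, key _ _ hl.2 hl.1]
    rcases Nat.lt_succ_iff_lt_or_eq.1 hh with h1 | rfl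
    · have h2 : ¬ ((eu h = eu j ∧ ev h = ev j) ∨ (eu h = ev j ∧ ev h = eu j)) := by
        intro h2
        have := hL.inj h (by omega) j hj (Sym2.eq_iff.2 h2)
        omega
      rw [if_neg h2, if_neg (by rintro (h3 | h3) <;> exact h2 (by tauto))]
      exact hI.adj h h1
    · simp
  · intro a b ha hb hab
    simp only [State.set_mem, State.put_mem, Nat.reduceEqDiff, reduceIte, hm4]
    rw [hsucc, not_or] at hab
    rw [key a b ha hb, if_neg hab.2]
    exact hI.nadj a b ha hb hab.1
  · intro x hx
    have h1 := hI.sums x hx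
    by_cases hxu : x = eu j
    · subst hxu
      refine h1.add hnew (fun z => ?_) ?_ ?_ ?_
      · rw [hsucc]; simp [huv]
      · simp [p4, Function.update_of_ne huv]
      · simp [q4, Function.update_of_ne huv]
      · simp [w4, Function.update_of_ne huv]
    · by_cases hxv : x = ev j
      · subst hxv
        refine h1.add hnew' (fun z => ?_) ?_ ?_ ?_
        · rw [hsucc]; simp [huv.symm]
        · simp [p4]
        · simp [q4]
        · simp [w4]
      · refine h1.of_eq (fun z => ?_) ?_ ?_ ?_
        · rw [hsucc]; simp [hxu, hxv]
        · simp [p4, hxu, hxv]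
        · simp [q4, hxu, hxv]
        · simp [w4, hxu, hxv]
  · intro h
    have h1 := hI.cost h
    by_cases hh : h = j
    · simp [hh]
    · have : h < j + 1 ↔ h < j := by omega
      simp [hh, this, hm, h1]
  · intro a h4 h5 h6 h7 h14
    simp [h14, hm a h4 h5 h6 h7]

/-- Read all edges. -/
def progRead : Program := .seq (.op (.copy 6 0)) (.loop (.lt 6 3) progReadEdge)

lemma progRead_wp {W n m : ℕ} {inp eu ev : ℕ → ℕ} {s : State} (hB : Bounds n m W)
    (hL : EdgeList n m inp eu ev) (hs : Std n m inp s)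
    (h0 : ∀ a, a = 4 ∨ a = 5 ∨ a = 6 ∨ a = 7 ∨ a = 14 → ∀ k, s.mem a k = 0) :
    WP W progRead (fun s' t => Std n m inp s' ∧ ReadInv n m eu ev s' ∧
      (∀ a, a ≠ 4 → a ≠ 5 → a ≠ 6 → a ≠ 7 → a ≠ 14 → s'.mem a = s.mem a) ∧ t ≤ 38 * m + 2) s := by
  apply WP.seq
  refine ⟨s.set 6 (s.reg 0), 1, .op ?_, ?_⟩
  · have := hB.word; have := hB.three_le; have := hB.sq; have := hB.cube
    simp [Op.run, State.write, State.set, hs.zero]; omega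
  refine WP.loop (fun j s' => Std n m inp s' ∧ s'.reg 6 = j ∧ ReadInv n j eu ev s' ∧
      (∀ a, a ≠ 4 → a ≠ 5 → a ≠ 6 → a ≠ 7 → a ≠ 14 → s'.mem a = s.mem a)) (fun _ => 37) m ?_ ?_
    ?_ ?_
  · refine ⟨hs.congr ?_ ?_, ?_, ⟨?_, ?_, ?_, ?_⟩, ?_⟩
    · intro r hr; simp [show r ≠ 6 by omega]
    · simp
    · simp [hs.zero]
    · intro h hh; omega
    · intro a b _ _ _; simp [h0]
    · intro x _
      exact ⟨∅, fun y => by simp [adjUpTo], by simp [h0], by simp [h0], by simp [h0]⟩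
    · intro h; simp [h0]
    · simp
  · rintro j hj s1 ⟨h1, h2, h3, h4⟩
    refine ⟨by simp [Test.holds, h2, h1.edges, hj], ?_⟩
    refine (progReadEdge_wp hB hL h1 hj h2 h3).mono ?_
    rintro s2 t ⟨g1, g2, g3, g4, g5⟩
    refine ⟨⟨g1, g2, g3, fun a a4 a5 a6 a7 a14 => ?_⟩, g5⟩
    rw [g4 a a4 a5 a6 a7 a14, h4 a a4 a5 a6 a7 a14]
  · rintro s1 ⟨h1, h2, -⟩
    simp [Test.holds, h2, h1.edges]
  · rintro s1 t ⟨h1, h2, h3, h4⟩ ht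
    refine ⟨h1, h3, h4, ?_⟩
    simp at ht
    omega

/-! ### The program: finding a vertex of degree two and its neighbours -/

/-- The first `sp` cells of `stk` list the elements satisfying `P`, each of them once. -/
structure IsStack (stk : ℕ → ℕ) (sp : ℕ) (P : ℕ → Prop) : Prop where
  inj : ∀ k l, k < sp → l < sp → stk k = stk l → k = l
  mem : ∀ x, (∃ k < sp, stk k = x) ↔ P x

lemma IsStack.congr {stk : ℕ → ℕ} {sp : ℕ} {P Q : ℕ → Prop} (h : IsStack stk sp P)
    (hPQ : ∀ x, P x ↔ Q x) : IsStack stk sp Q :=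
  ⟨h.inj, fun x => (h.mem x).trans (hPQ x)⟩

lemma IsStack.push {stk : ℕ → ℕ} {sp : ℕ} {P : ℕ → Prop} (h : IsStack stk sp P) {x : ℕ}
    (hx : ¬ P x) : IsStack (Function.update stk sp x) (sp + 1) (fun y => P y ∨ y = x) := by
  have hne : ∀ k < sp, stk k ≠ x := fun k hk he => hx ((h.mem x).1 ⟨k, hk, he⟩)
  refine ⟨fun k l hk hl hkl => ?_, fun y => ⟨?_, ?_⟩⟩
  · rcases Nat.lt_succ_iff_lt_or_eq.1 hk with hk | rfl <;>
      rcases Nat.lt_succ_iff_lt_or_eq.1 hl with hl | rfl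
    · rw [Function.update_of_ne hk.ne, Function.update_of_ne hl.ne] at hkl
      exact h.inj k l hk hl hkl
    · rw [Function.update_of_ne hk.ne, Function.update_self] at hkl
      exact absurd hkl (hne k hk)
    · rw [Function.update_of_ne hl.ne, Function.update_self] at hkl
      exact absurd hkl.symm (hne l hl)
    · rfl
  · rintro ⟨k, hk, rfl⟩
    rcases Nat.lt_succ_iff_lt_or_eq.1 hk with hk | rfl
    · rw [Function.update_of_ne hk.ne]
      exact Or.inl ((h.mem _).1 ⟨k, hk, rfl⟩)
    · simp
  · rintro (hy | rfl)
    · obtain ⟨k, hk, rfl⟩ := (h.mem _).2 hy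
      exact ⟨k, by omega, Function.update_of_ne hk.ne _ _⟩
    · exact ⟨sp, by omega, by simp⟩

lemma IsStack.pop {stk : ℕ → ℕ} {sp : ℕ} {P : ℕ → Prop} (h : IsStack stk (sp + 1) P) :
    P (stk sp) ∧ IsStack stk sp (fun y => P y ∧ y ≠ stk sp) := by
  refine ⟨(h.mem _).1 ⟨sp, by omega, rfl⟩,
    fun k l hk hl hkl => h.inj k l (by omega) (by omega) hkl, fun y => ⟨?_, ?_⟩⟩
  · rintro ⟨k, hk, rfl⟩
    refine ⟨(h.mem _).1 ⟨k, by omega, rfl⟩, fun he => ?_⟩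
    have := h.inj k sp (by omega) (by omega) he
    omega
  · rintro ⟨hy, hne⟩
    obtain ⟨k, hk, rfl⟩ := (h.mem y).2 hy
    rcases Nat.lt_succ_iff_lt_or_eq.1 hk with hk | rfl
    · exact ⟨k, hk, rfl⟩
    · exact absurd rfl hne

/-- A conditional push. -/
lemma IsStack.push_if {stk stk' : ℕ → ℕ} {sp sp' : ℕ} {P : ℕ → Prop} (h : IsStack stk sp P)
    {c : Prop} {x : ℕ} (h1 : c → stk' = Function.update stk sp x ∧ sp' = sp + 1)
    (h2 : ¬ c → stk' = stk ∧ sp' = sp) (hx : c → ¬ P x) :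
    IsStack stk' sp' (fun y => P y ∨ (c ∧ y = x)) := by
  by_cases hc : c
  · rw [(h1 hc).1, (h1 hc).2]
    exact (h.push (hx hc)).congr fun y => by simp only [hc, true_and]
  · rw [(h2 hc).1, (h2 hc).2]
    exact h.congr fun y => by simp only [hc, false_and, or_false]

/-- Push the vertices of degree two. -/
def progStack : Program :=
  .seq (block (.copy 6 0) [.copy 7 0]) <|
  .loop (.lt 6 2) <| .seq (.op (.load 10 5 6)) <|
    .ite (.eq 10 4) (block (.store 9 7 6) [.add 7 7 1, .add 6 6 1]) (.op (.add 6 6 1))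

lemma progStack_wp {W n m : ℕ} {inp : ℕ → ℕ} {s : State} (hB : Bounds n m W)
    (hs : Std n m inp s) (h5 : ∀ x < n, s.mem 5 x < W) :
    WP W progStack (fun s' t => Std n m inp s' ∧
      IsStack (s'.mem 9) (s'.reg 7) (fun x => x < n ∧ s.mem 5 x = 2) ∧ s'.reg 7 ≤ n ∧
      (∀ a, a ≠ 9 → s'.mem a = s.mem a) ∧ t ≤ 6 * n + 3) s := by
  have hnW : 2 * n < W := by
    have := hB.word; have := hB.three_le; have := hB.sq; have := hB.cube
    omega
  apply WP.seq
  apply WP.block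
  simp only [wpOps, Op.wp, State.set_reg]
  simp [hs.zero, show 0 < W by omega]
  refine WP.loop (fun i s' => Std n m inp s' ∧ s'.reg 6 = i ∧ s'.reg 7 ≤ i ∧ i ≤ n ∧
    IsStack (s'.mem 9) (s'.reg 7) (fun x => x < i ∧ s.mem 5 x = 2) ∧
      (∀ a, a ≠ 9 → s'.mem a = s.mem a)) (fun _ => 5) n ?_ ?_ ?_ ?_
  · refine ⟨hs.congr ?_ ?_, by simp, by simp, by simp, ⟨by simp, by simp⟩, by simp⟩
    · intro r hr
      have : r ≠ 6 ∧ r ≠ 7 := by omega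
      simp [this]
    · simp
  · rintro i hi s1 ⟨h1, h2, h3, h4, hst, hfr⟩
    refine ⟨by simp [Test.holds, h2, h1.size, hi], ?_⟩
    have h5i := h5 i hi
    apply WP.seq
    apply WP.op
    simp only [Op.wp, h2, hfr 5 (by simp), h5i, true_and]
    apply WP.ite
    · intro hc
      have hc' : s.mem 5 i = 2 := by simpa [Test.holds, h1.two] using hc
      apply WP.block
      simp only [wpOps, Op.wp, State.set_reg, State.set_mem, State.put_reg, State.put_mem]
      simp [h2, h1.one, show s1.reg 7 + 1 < W by omega, show i + 1 < W by omega]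
      refine ⟨h1.congr ?_ ?_, h3, hi, ?_, ?_⟩
      · intro r hr
        have : r ≠ 6 ∧ r ≠ 7 ∧ r ≠ 10 := by omega
        simp [this]
      · simp
      · refine (hst.push (x := i) (by omega)).congr fun x => ?_
        constructor
        · rintro (⟨h, h'⟩ | rfl)
          · exact ⟨by omega, h'⟩
          · exact ⟨by omega, hc'⟩
        · rintro ⟨h, h'⟩
          by_cases hx : x = i
          · exact Or.inr hx
          · exact Or.inl ⟨by omega, h'⟩
      · intro a ha
        simp [ha, hfr]
    · intro hc
      have hc' : s.mem 5 i ≠ 2 := by simpa [Test.holds, h1.two] using hc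
      apply WP.op
      simp [Op.wp, h2, h1.one, show i + 1 < W by omega]
      refine ⟨h1.congr ?_ ?_, by omega, hi, ?_, hfr⟩
      · intro r hr
        have : r ≠ 6 ∧ r ≠ 7 ∧ r ≠ 10 := by omega
        simp [this]
      · simp
      · refine hst.congr fun x => ?_
        constructor
        · rintro ⟨h, h'⟩; exact ⟨by omega, h'⟩
        · rintro ⟨h, h'⟩
          refine ⟨?_, h'⟩
          by_contra hx
          obtain rfl : x = i := by omega
          exact hc' h'
  · rintro s1 ⟨h1, h2, -⟩
    simp [Test.holds, h2, h1.size]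
  · rintro s1 t ⟨h1, h2, h3, h4, hst, hfr⟩ ht
    refine ⟨h1, hst, h3, hfr, ?_⟩
    simp at ht
    omega

/-- Pop a vertex from the stack and compute its two neighbours `w < u` from their sum `p` and the
sum `q` of their squares: `2 * q - p * p` is the square of `u - w`. -/
def progNbrs : Program :=
  block (.sub 7 7 1) [.load 10 9 7, .load 11 6 10, .load 12 7 10, .add 12 12 12, .mul 13 11 11,
    .sub 12 12 13, .load 13 8 12, .sub 12 11 13, .div 12 12 4, .sub 11 11 12]

lemma progNbrs_wp {W n m v u w : ℕ} {inp : ℕ → ℕ} {s : State} (hB : Bounds n m W)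
    (hs : Std n m inp s) (htab : ∀ k < n, s.mem 8 (k * k) = k) (h7 : s.reg 7 < W)
    (hv : s.mem 9 (s.reg 7 - 1) = v) (hvn : v < n) (hun : u < n) (hwu : w < u)
    (hS1 : s.mem 6 v = u + w) (hS2 : s.mem 7 v = u * u + w * w) :
    WP W progNbrs (fun s' t => (∀ r < 10, r ≠ 7 → s'.reg r = s.reg r) ∧ s'.reg 7 = s.reg 7 - 1 ∧
      s'.reg 10 = v ∧ s'.reg 11 = u ∧ s'.reg 12 = w ∧ s'.mem = s.mem ∧ t = 11) s := by
  obtain ⟨b1, b2, b3, b4, b5⟩ := hB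
  obtain ⟨d, rfl⟩ := Nat.exists_eq_add_of_lt hwu
  have hd : (w + d + 1) * (w + d + 1) + w * w + ((w + d + 1) * (w + d + 1) + w * w)
      - (w + d + 1 + w) * (w + d + 1 + w) = (d + 1) * (d + 1) := by
    apply Nat.sub_eq_of_eq_add; ring
  have ht := htab (d + 1) (by omega)
  have e1 : w + d + 1 + w - (d + 1) = 2 * w := by omega
  have e2 : w + d + 1 + w - w = w + d + 1 := by omega
  have q1 : (w + d + 1) * (w + d + 1) < n * n := Nat.mul_self_lt_mul_self hun
  have q2 : w * w < n * n := Nat.mul_self_lt_mul_self (by omega)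
  have q3 : (w + d + 1 + w) * (w + d + 1 + w) ≤ (2 * n) * (2 * n) :=
    Nat.mul_self_le_mul_self (by omega)
  have q4 : (2 * n) * (2 * n) = 4 * (n * n) := by ring
  have q5 : (d + 1) * (d + 1) < n * n := Nat.mul_self_lt_mul_self (by omega)
  have o1 : s.reg 7 - 1 < W := by omega
  have o2 : v < W := by omega
  have o3 : w + d + 1 + w < W := by omega
  have o4 : (w + d + 1) * (w + d + 1) + w * w < W := by omega
  have o5 : (w + d + 1) * (w + d + 1) + w * w + ((w + d + 1) * (w + d + 1) + w * w) < W := by omega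
  have o6 : (w + d + 1 + w) * (w + d + 1 + w) < W := by omega
  have o7 : (d + 1) * (d + 1) < W := by omega
  have o8 : d + 1 < W := by omega
  have o9 : 2 * w < W := by omega
  have o10 : w < W := by omega
  have o11 : w + d + 1 < W := by omega
  apply WP.block
  simp only [wpOps, Op.wp, State.set_reg, State.set_mem]
  simp only [reduceIte, Nat.reduceEqDiff, hs.one, hs.two, hv, hS1, hS2, hd, ht, e1, o1, o2, o3,
    o4, o5, o6, o7, o8, o9, true_and]
  have e3 : 2 * w / 2 = w := by omega
  simp only [e3, e2, o10, o11, true_and, and_true, List.length]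
  intro r hr hr7
  have : r ≠ 10 ∧ r ≠ 11 ∧ r ≠ 12 ∧ r ≠ 13 := by omega
  simp [this, hr7]

/-! ### The program: eliminating a vertex -/

/-- Look up the edges from the vertex in register `10` to its neighbours in registers `11` and
`12`, and the edge between these. The table contains zero for a missing edge, so register `16` is
one if the latter is missing, and zero otherwise; register `17` is its complement. -/
def progEdges : Program :=
  block (.mul 15 10 2) [.add 13 15 11, .load 13 4 13, .sub 13 13 1, .add 14 15 12, .load 14 4 14,
    .sub 14 14 1, .mul 18 11 2, .add 18 18 12, .mul 19 12 2, .add 19 19 11, .load 15 4 18,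
    .sub 16 1 15, .sub 17 1 16]

lemma progEdges_wp {W n m v u w l r b : ℕ} {inp : ℕ → ℕ} {s : State} (hB : Bounds n m W)
    (hs : Std n m inp s) (hv : s.reg 10 = v) (hu : s.reg 11 = u) (hw : s.reg 12 = w)
    (hvn : v < n) (hun : u < n) (hwn : w < n) (hl : s.mem 4 (v * n + u) = l + 1)
    (hr : s.mem 4 (v * n + w) = r + 1) (hb : s.mem 4 (u * n + w) = b) (hlW : l + 1 < W)
    (hrW : r + 1 < W) (hbW : b < W) :
    WP W progEdges (fun s' t => (∀ r < 13, s'.reg r = s.reg r) ∧ s'.reg 13 = l ∧ s'.reg 14 = r ∧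
      s'.reg 15 = b ∧ s'.reg 16 = 1 - b ∧ s'.reg 17 = 1 - (1 - b) ∧ s'.reg 18 = u * n + w ∧
      s'.reg 19 = w * n + u ∧ s'.mem = s.mem ∧ t = 14) s := by
  obtain ⟨b1, b2, b3, b4, b5⟩ := hB
  have i1 := idx_lt hvn hun
  have i2 := idx_lt hvn hwn
  have i3 := idx_lt hun hwn
  have i4 := idx_lt hwn hun
  have o1 : v * n < W := by omega
  have o2 : u * n < W := by omega
  have o3 : w * n < W := by omega
  have o4 : v * n + u < W := by omega
  have o5 : v * n + w < W := by omega
  have o6 : u * n + w < W := by omega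
  have o7 : w * n + u < W := by omega
  have o8 : l < W := by omega
  have o9 : r < W := by omega
  have o10 : 1 - b < W := by omega
  have o11 : 1 - (1 - b) < W := by omega
  apply WP.block
  simp only [wpOps, Op.wp, State.set_reg, State.set_mem]
  simp only [reduceIte, Nat.reduceEqDiff, hs.one, hs.size, hv, hu, hw, hl, hr, hb, o1, o2, o3, o4,
    o5, o6, o7, o8, o9, o10, o11, hlW, hrW, hbW, true_and, and_true, Nat.add_sub_cancel,
    List.length]
  intro r hr
  have : r ≠ 13 ∧ r ≠ 14 ∧ r ≠ 15 ∧ r ≠ 16 ∧ r ≠ 17 ∧ r ≠ 18 ∧ r ≠ 19 := by omega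
  simp [this]

/-- Record the triangle, and give the next number, in register `5`, to its base if that edge
is missing. There is no test: the increased number of the base is its table entry, plus the flag in
register `16` times one more than register `5`. -/
def progLink : Program :=
  block (.add 20 5 1) [.mul 20 20 16, .add 15 15 20, .store 4 18 15, .store 4 19 15, .sub 15 15 1,
    .add 5 5 16, .store 10 6 13, .store 11 6 14, .store 12 6 15, .copy 20 11, .copy 21 12]

lemma progLink_wp {W i z b p q cnt u w l r : ℕ} {s : State} (h1 : s.reg 1 = 1) (h6 : s.reg 6 = i)
    (hcnt : s.reg 5 = cnt) (hu : s.reg 11 = u) (hw : s.reg 12 = w) (hl : s.reg 13 = l)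
    (hr : s.reg 14 = r) (hb : s.reg 15 + (cnt + 1) * z = b + 1) (hz : s.reg 16 = z)
    (hp : s.reg 18 = p) (hq : s.reg 19 = q) (hz1 : z ≤ 1) (oc : cnt + 1 < W) (ob : b + 1 < W)
    (ou : u < W) (ow : w < W) :
    WP W progLink (fun s' t => (∀ r < 15, r ≠ 5 → s'.reg r = s.reg r) ∧ s'.reg 5 = cnt + z ∧
      s'.reg 16 = s.reg 16 ∧ s'.reg 17 = s.reg 17 ∧ s'.reg 20 = u ∧ s'.reg 21 = w ∧
      s'.mem 4 = Function.update (Function.update (s.mem 4) p (b + 1)) q (b + 1) ∧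
      s'.mem 10 = Function.update (s.mem 10) i l ∧ s'.mem 11 = Function.update (s.mem 11) i r ∧
      s'.mem 12 = Function.update (s.mem 12) i b ∧
      (∀ a, a ≠ 4 → a ≠ 10 → a ≠ 11 → a ≠ 12 → s'.mem a = s.mem a) ∧ t = 12) s := by
  have o1 : (cnt + 1) * z < W := by omega
  have o2 : cnt + z < W := by omega
  have o3 : b < W := by omega
  apply WP.block
  simp only [wpOps, Op.wp, State.set_reg, State.set_mem, State.put_reg, State.put_mem]
  simp only [reduceIte, Nat.reduceEqDiff, h1, h6, hcnt, hu, hw, hl, hr, hb, hz, hp, hq, oc, ob, ou,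
    ow, o1, o2, o3, true_and, and_true, Nat.add_sub_cancel, List.length]
  refine ⟨fun r hr h5 => ?_, fun a h4 h10 h11 h12 => ?_⟩
  · have : r ≠ 15 ∧ r ≠ 20 ∧ r ≠ 21 := by omega
    simp [this, h5]
  · simp [h4, h10, h11, h12]

/-- At the neighbour in register `20` of the eliminated vertex, replace the latter by the other
neighbour, in register `21`, or just remove it if the two neighbours are adjacent already; push the
neighbour if its degree has dropped to two. -/
def progMove : Program :=
  .seq (block (.load 30 5 20) [.sub 30 30 17, .store 5 20 30, .mul 31 21 16, .load 32 6 20,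
    .add 32 32 31, .sub 32 32 10, .store 6 20 32]) <|
  .seq (block (.mul 31 31 21) [.load 32 7 20, .add 32 32 31, .mul 31 10 10, .sub 32 32 31,
    .store 7 20 32]) <|
  .ite (.eq 30 4)
    (.ite (.eq 17 1) (block (.store 9 7 20) [.add 7 7 1]) (.op (.copy 31 1)))
    (.op (.copy 31 1))

lemma progMove_wp {W x y v z : ℕ} {s : State} (h1 : s.reg 1 = 1) (h4 : s.reg 4 = 2)
    (hv : s.reg 10 = v) (hz : s.reg 16 = z) (hz' : s.reg 17 = 1 - z) (hz1 : z ≤ 1)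
    (hx : s.reg 20 = x) (hy : s.reg 21 = y) (b0 : s.mem 5 x < W) (b1 : s.mem 6 x + y < W)
    (b2 : s.mem 7 x + y * y < W) (bv : v * v < W) (b7 : s.reg 7 + 1 < W) (hW : 1 < W) :
    WP W progMove (fun s' t => (∀ r < 30, r ≠ 7 → s'.reg r = s.reg r) ∧
      s'.mem 5 = Function.update (s.mem 5) x (s.mem 5 x - (1 - z)) ∧
      s'.mem 6 = Function.update (s.mem 6) x (s.mem 6 x + y * z - v) ∧
      s'.mem 7 = Function.update (s.mem 7) x (s.mem 7 x + y * z * y - v * v) ∧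
      ((s.mem 5 x - (1 - z) = 2 ∧ z = 0) →
        s'.mem 9 = Function.update (s.mem 9) (s.reg 7) x ∧ s'.reg 7 = s.reg 7 + 1) ∧
      (¬ (s.mem 5 x - (1 - z) = 2 ∧ z = 0) → s'.mem 9 = s.mem 9 ∧ s'.reg 7 = s.reg 7) ∧
      (∀ a, a ≠ 5 → a ≠ 6 → a ≠ 7 → a ≠ 9 → s'.mem a = s.mem a) ∧ t ≤ 18) s := by
  have y1 : y * z ≤ y := by
    calc y * z ≤ y * 1 := Nat.mul_le_mul_left _ hz1
      _ = y := by ring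
  have y2 : y * z * y ≤ y * y := Nat.mul_le_mul_right _ y1
  have o1 : s.mem 5 x - (1 - z) < W := by omega
  have o2 : y * z < W := by omega
  have o3 : s.mem 6 x < W := by omega
  have o4 : s.mem 6 x + y * z < W := by omega
  have o5 : s.mem 6 x + y * z - v < W := by omega
  have o6 : y * z * y < W := by omega
  have o7 : s.mem 7 x < W := by omega
  have o8 : s.mem 7 x + y * z * y < W := by omega
  have o9 : s.mem 7 x + y * z * y - v * v < W := by omega
  apply WP.seq
  apply WP.block
  simp only [wpOps, Op.wp, State.set_reg, State.set_mem, State.put_reg, State.put_mem]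
  simp only [reduceIte, Nat.reduceEqDiff, hv, hz, hz', hx, hy, b0, o1, o2, o3, o4, o5, true_and,
    List.length]
  apply WP.seq
  apply WP.block
  simp only [wpOps, Op.wp, State.set_reg, State.set_mem, State.put_reg, State.put_mem]
  simp only [reduceIte, Nat.reduceEqDiff, hv, hx, hy, o6, o7, o8, o9, bv, true_and, List.length]
  apply WP.ite
  · intro hc
    have hc' : s.mem 5 x - (1 - z) = 2 := by simpa [Test.holds, h4] using hc
    apply WP.ite
    · intro hd
      have hd' : z = 0 := by
        have : 1 - z = 1 := by simpa [Test.holds, h1, hz'] using hd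
        omega
      apply WP.block
      simp only [wpOps, Op.wp, State.set_reg, State.set_mem, State.put_reg, State.put_mem]
      simp [h1, hx, b7, hd']
      rw [hd'] at hc'
      refine ⟨fun r hr h7 => ?_, by omega, fun a h5 h6 h7 h9 => ?_⟩
      · have : r ≠ 30 ∧ r ≠ 31 ∧ r ≠ 32 := by omega
        simp [this, h7]
      · simp [h5, h6, h7, h9]
    · intro hd
      have hn : ¬ (s.mem 5 x - (1 - z) = 2 ∧ z = 0) := by
        rintro ⟨-, rfl⟩
        exact hd (by simp [Test.holds, h1, hz'])
      apply WP.op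
      simp only [Op.wp, State.set_reg, State.set_mem, State.put_reg, State.put_mem, reduceIte,
        Nat.reduceEqDiff, h1, hW, hn, true_and, and_true, not_false_eq_true, forall_const,
        false_imp_iff, Nat.reduceAdd]
      refine ⟨fun r hr h7 => ?_, fun a h5 h6 h7 h9 => ?_, by omega⟩
      · have : r ≠ 30 ∧ r ≠ 31 ∧ r ≠ 32 := by omega
        simp [this]
      · simp [h5, h6, h7]
  · intro hc
    have hn : ¬ (s.mem 5 x - (1 - z) = 2 ∧ z = 0) := by
      rintro ⟨hc', -⟩
      exact hc (by simp [Test.holds, h4, hc'])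
    apply WP.op
    simp only [Op.wp, State.set_reg, State.set_mem, State.put_reg, State.put_mem, reduceIte,
      Nat.reduceEqDiff, h1, hW, hn, true_and, and_true, not_false_eq_true, forall_const,
      false_imp_iff, Nat.reduceAdd]
    refine ⟨fun r hr h7 => ?_, fun a h5 h6 h7 h9 => ?_, by omega⟩
    · have : r ≠ 30 ∧ r ≠ 31 ∧ r ≠ 32 := by omega
      simp [this]
    · simp [h5, h6, h7]

/-- At a neighbour `x` of the eliminated vertex `v`, the latter is replaced by the other neighbour
`y`, or just removed if `x` and `y` are adjacent. -/
lemma Sums.move {E E' : ℕ → ℕ → Prop} {S0 S1 S2 S0' S1' S2' : ℕ → ℕ} {x y v z : ℕ}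
    (h : Sums E S0 S1 S2 x) (hv : E x v) (hyv : y ≠ v)
    (hE : ∀ t, E' x t ↔ (E x t ∧ t ≠ v) ∨ t = y) (hz : (E x y ∧ z = 0) ∨ (¬ E x y ∧ z = 1))
    (h0 : S0' x = S0 x - (1 - z)) (h1 : S1' x = S1 x + y * z - v)
    (h2 : S2' x = S2 x + y * z * y - v * v) : Sums E' S0' S1' S2' x := by
  obtain ⟨A, hA, e0, e1, e2⟩ := h
  have hvA : v ∈ A := (hA v).2 hv
  have c0 := Finset.card_erase_add_one hvA
  have c1 := Finset.add_sum_erase A (fun t => t) hvA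
  have c2 := Finset.add_sum_erase A (fun t => t * t) hvA
  rcases hz with ⟨hy, rfl⟩ | ⟨hy, rfl⟩
  · refine ⟨A.erase v, fun t => ?_, by omega, by omega, by
      simp only [Nat.mul_zero, Nat.zero_mul, Nat.add_zero] at h2; omega⟩
    rw [Finset.mem_erase, hA, hE]
    constructor
    · exact fun h => Or.inl ⟨h.2, h.1⟩
    · rintro (h | rfl)
      · exact ⟨h.2, h.1⟩
      · exact ⟨hyv, hy⟩
  · have hyA : y ∉ A.erase v := fun h => hy ((hA y).1 (Finset.mem_of_mem_erase h))
    refine ⟨insert y (A.erase v), fun t => ?_, ?_, ?_, ?_⟩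
    · rw [Finset.mem_insert, Finset.mem_erase, hA, hE]
      tauto
    · rw [Finset.card_insert_of_notMem hyA]; omega
    · rw [Finset.sum_insert hyA]; omega
    · rw [Finset.sum_insert hyA]; simp only [Nat.mul_one] at h2; omega

/-- The state after `i` eliminations; `s0` is the state before the first one. -/
structure ElimState (n m : ℕ) (inp eu ev : ℕ → ℕ) (s0 : State) (i : ℕ) (s : State) : Prop where
  std : Std n m inp s
  reg6 : s.reg 6 = i
  reg9 : s.reg 9 = n - 2
  inv : ∃ E X eu' ev', ElimInv n m i E X (fun a b => s.mem 4 (a * n + b)) (s.reg 5) eu' ev'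
      (s.mem 10) (s.mem 11) (s.mem 12) ∧ (∀ h < m, eu' h = eu h ∧ ev' h = ev h) ∧
    (∀ x, (∃ y, E x y) → Sums E (s.mem 5) (s.mem 6) (s.mem 7) x) ∧
    (i + 2 < n → IsStack (s.mem 9) (s.reg 7) fun x => (∃ y, E x y) ∧ s.mem 5 x = 2)
  cnt_le : s.reg 5 ≤ m + i
  sp_le : s.reg 7 ≤ n + i
  table : ∀ k < n, s.mem 8 (k * k) = k
  frame : ∀ a, a = 1 ∨ 13 ≤ a → s.mem a = s0.mem a

/-- Eliminate a vertex of degree two. -/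
def progElim : Program :=
  .seq progNbrs <| .seq progEdges <| .seq progLink <| .seq progMove <| .seq progSwap <|
    .seq progMove <| .op (.add 6 6 1)

lemma progElim_wp {W n m i : ℕ} {inp eu ev : ℕ → ℕ} {s0 s : State} (hB : Bounds n m W)
    (hI : ElimState n m inp eu ev s0 i s) (hi : i + 2 < n) :
    WP W progElim (fun s' t => ElimState n m inp eu ev s0 (i + 1) s' ∧ t ≤ 77) s := by
  obtain ⟨std, h6, h9, ⟨E, X, eu', ev', inv, heu, hsum, hstk⟩, hcnt, hsp, htab, hfr⟩ := hI
  have hB' := hB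
  obtain ⟨b1, b2, b3, b4, b5⟩ := hB'
  have hred := inv.red hi
  have hst := hstk hi
  have hltr : ∀ a c, E a c → c < n := fun a c h => inv.lt _ _ (inv.symm _ _ h)
  -- the stack is not empty
  obtain ⟨sp, hsp1⟩ : ∃ sp, s.reg 7 = sp + 1 := by
    obtain ⟨v, u, w, huw, hv⟩ := hred.exists_degree_two
    have hvl : ∃ y, E v y := ⟨u, (hv u).2 (Or.inl rfl)⟩
    obtain ⟨A, hA, e0, -⟩ := hsum v hvl
    have hA2 : A = {u, w} := by
      ext y; rw [hA, hv]; simp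
    rw [hA2, Finset.card_pair huw] at e0
    obtain ⟨k, hk, -⟩ := (hst.mem v).2 ⟨hvl, e0⟩
    exact ⟨s.reg 7 - 1, by omega⟩
  rw [hsp1] at hst hsp
  obtain ⟨⟨hvl, hv2⟩, hst'⟩ := hst.pop
  set v := s.mem 9 sp with hvdef
  -- the two neighbours
  obtain ⟨u, w, hwu, hv, hS1, hS2⟩ : ∃ u w, w < u ∧ (∀ y, E v y ↔ y = u ∨ y = w) ∧
      s.mem 6 v = u + w ∧ s.mem 7 v = u * u + w * w := by
    obtain ⟨A, hA, e0, e1, e2⟩ := hsum v hvl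
    rw [hv2] at e0
    obtain ⟨a, b, hab, rfl⟩ := Finset.card_eq_two.1 e0.symm
    rw [Finset.sum_pair hab] at e1 e2
    have hE : ∀ y, E v y ↔ y = a ∨ y = b := fun y => by rw [← hA]; simp
    rcases lt_or_gt_of_ne hab with h | h
    · exact ⟨b, a, h, fun y => by rw [hE]; tauto, by omega, by omega⟩
    · exact ⟨a, b, h, hE, by omega, by omega⟩
  have huw : u ≠ w := by omega
  have hvu : E v u := (hv u).2 (Or.inl rfl)
  have hvw : E v w := (hv w).2 (Or.inr rfl)
  have hvn : v < n := inv.lt _ _ hvu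
  have hun := hltr _ _ hvu
  have hwn := hltr _ _ hvw
  have nvu : u ≠ v := by intro h; rw [h] at hvu; exact inv.irrefl _ hvu
  have nvw : w ≠ v := by intro h; rw [h] at hvw; exact inv.irrefl _ hvw
  have hlive_u : ∃ y, E u y := ⟨v, inv.symm _ _ hvu⟩
  have hlive_w : ∃ y, E w y := ⟨v, inv.symm _ _ hvw⟩
  obtain ⟨l, hl, hlc, -, -, -⟩ := inv.adj _ _ hvu
  obtain ⟨r, hr, hrc, -, -, -⟩ := inv.adj _ _ hvw
  -- the number `b` of the third edge, and whether it is new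
  obtain ⟨z, b, hzE, hb15, hbc⟩ : ∃ z b, ((E u w ∧ z = 0) ∨ (¬ E u w ∧ z = 1)) ∧
      (s.mem 4 (u * n + w) + (s.reg 5 + 1) * z = b + 1 ∧ z = 1 - s.mem 4 (u * n + w)) ∧
      b < s.reg 5 + 1 := by
    by_cases hE : E u w
    · obtain ⟨b, hb, hbc, -⟩ := inv.adj _ _ hE
      exact ⟨0, b, Or.inl ⟨hE, rfl⟩, ⟨by simpa using hb, by omega⟩, by omega⟩
    · have hb := inv.nadj u w hlive_u hlive_w hE
      exact ⟨1, s.reg 5, Or.inr ⟨hE, rfl⟩, ⟨by omega, by omega⟩, by omega⟩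
  obtain ⟨hb15, hz⟩ := hb15
  have hz1 : z ≤ 1 := by omega
  have su := (hsum u hlive_u).le (hltr u)
  have sw := (hsum w hlive_w).le (hltr w)
  have q1 : u * u < n * n := Nat.mul_self_lt_mul_self hun
  have q2 : w * w < n * n := Nat.mul_self_lt_mul_self hwn
  have q3 : v * v < n * n := Nat.mul_self_lt_mul_self hvn
  refine WP.seq ((progNbrs_wp hB std htab (by omega) (v := v) (u := u) (w := w)
    (by rw [hsp1, Nat.add_sub_cancel]) hvn hun hwu hS1 hS2).mono ?_)
  rintro s1 t1 ⟨r1, r17, r110, r111, r112, m1, rfl⟩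
  rw [hsp1, Nat.add_sub_cancel] at r17
  have std1 : Std n m inp s1 := std.congr (fun r hr => r1 r (by omega) (by omega)) (by rw [m1])
  refine WP.seq ((progEdges_wp hB std1 r110 r111 r112 hvn hun hwn (l := l) (r := r)
    (b := s.mem 4 (u * n + w)) (by rw [m1]; exact hl) (by rw [m1]; exact hr) (by rw [m1])
    (by omega) (by omega) (by omega)).mono ?_)
  rintro s2 t2 ⟨r2, r213, r214, r215, r216, r217, r218, r219, m2, rfl⟩
  rw [m1] at m2
  rw [← hz] at r216 r217
  have std2 : Std n m inp s2 := std1.congr (fun r hr => r2 r (by omega)) (by rw [m2, m1])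
  have r25 : s2.reg 5 = s.reg 5 := by rw [r2 5 (by simp), r1 5 (by simp) (by simp)]
  refine WP.seq ((progLink_wp (i := i) (z := z) (b := b) (p := u * n + w) (q := w * n + u)
    (cnt := s.reg 5) (u := u) (w := w) (l := l) (r := r) std2.one
    (by rw [r2 6 (by simp), r1 6 (by simp) (by simp), h6]) r25 (by rw [r2 11 (by simp), r111])
    (by rw [r2 12 (by simp), r112]) r213 r214 (by rw [r215]; exact hb15) r216 r218 r219 hz1
    (by omega) (by omega) (by omega) (by omega)).mono ?_)
  rintro s3 t3 ⟨r3, r35, r316, r317, r320, r321, m34, m310, m311, m312, f3, rfl⟩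
  rw [m2] at m34 m310 m311 m312
  rw [r216] at r316
  rw [r217] at r317
  have std3 : Std n m inp s3 := std2.congr (fun r hr => r3 r (by omega) (by omega))
    (f3 0 (by simp) (by simp) (by simp) (by simp))
  have f3' : ∀ a, a ≠ 4 → a ≠ 10 → a ≠ 11 → a ≠ 12 → s3.mem a = s.mem a := fun a a1 a2 a3 a4 => by
    rw [f3 a a1 a2 a3 a4, m2]
  have m35 := f3' 5 (by simp) (by simp) (by simp) (by simp)
  have m36 := f3' 6 (by simp) (by simp) (by simp) (by simp)
  have m37 := f3' 7 (by simp) (by simp) (by simp) (by simp)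
  have m39 := f3' 9 (by simp) (by simp) (by simp) (by simp)
  have r37 : s3.reg 7 = sp := by rw [r3 7 (by simp) (by simp), r2 7 (by simp), r17]
  have r310 : s3.reg 10 = v := by rw [r3 10 (by simp) (by simp), r2 10 (by simp), r110]
  refine WP.seq ((progMove_wp (x := u) (y := w) (v := v) (z := z) std3.one std3.two r310 r316 r317
    hz1 r320 r321 (by rw [m35]; omega) (by rw [m36]; omega) (by rw [m37]; omega) (by omega)
    (by omega) (by omega)).mono ?_)
  rintro s4 t4 ⟨r4, m45, m46, m47, push, nopush, f4, ht4⟩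
  rw [m35] at m45 push nopush
  rw [m36] at m46
  rw [m37] at m47
  rw [m39, r37] at push nopush
  have r47 : s4.reg 7 ≤ sp + 1 := by
    by_cases h : s.mem 5 u - (1 - z) = 2 ∧ z = 0
    · rw [(push h).2]
    · rw [(nopush h).2]; omega
  have std4 : Std n m inp s4 := std3.congr (fun r hr => r4 r (by omega) (by omega))
    (f4 0 (by simp) (by simp) (by simp) (by simp))
  have r420 : s4.reg 20 = u := by rw [r4 20 (by simp) (by simp), r320]
  have r421 : s4.reg 21 = w := by rw [r4 21 (by simp) (by simp), r321]
  refine WP.seq ((progSwap_wp (by omega) (by omega)).mono ?_)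
  rintro s5 t5 ⟨r5, -, r520, r521, m5, rfl⟩
  rw [r421] at r520
  rw [r420] at r521
  have std5 : Std n m inp s5 := std4.congr (fun r hr => r5 r (by omega)) (by rw [m5])
  have hru : ∀ r < 20, r ≠ 7 → s5.reg r = s3.reg r := fun r hr h7 => by
    rw [r5 r hr, r4 r (by omega) h7]
  have r57 : s5.reg 7 = s4.reg 7 := r5 7 (by simp)
  refine WP.seq ((progMove_wp (x := w) (y := u) (v := v) (z := z) std5.one std5.two
    (by rw [hru 10 (by simp) (by simp), r310]) (by rw [hru 16 (by simp) (by simp), r316])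
    (by rw [hru 17 (by simp) (by simp), r317])
    hz1 r520 r521 (by rw [m5, m45, Function.update_of_ne huw.symm]; omega)
    (by rw [m5, m46, Function.update_of_ne huw.symm]; omega)
    (by rw [m5, m47, Function.update_of_ne huw.symm]; omega) (by omega)
    (by omega) (by omega)).mono ?_)
  rintro s6 t6 ⟨r6, m65, m66, m67, push', nopush', f6, ht6⟩
  rw [m5, m45, Function.update_of_ne huw.symm] at m65
  rw [m5, m46, Function.update_of_ne huw.symm] at m66
  rw [m5, m47, Function.update_of_ne huw.symm] at m67
  rw [m5, m45, Function.update_of_ne huw.symm, r57] at push' nopush'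
  have r67 : s6.reg 7 ≤ sp + 2 := by
    by_cases h : s.mem 5 w - (1 - z) = 2 ∧ z = 0
    · rw [(push' h).2]; omega
    · rw [(nopush' h).2]; omega
  have std6 : Std n m inp s6 := std5.congr (fun r hr => r6 r (by omega) (by omega))
    (f6 0 (by simp) (by simp) (by simp) (by simp))
  have hr6 : ∀ r < 10, r ≠ 7 → r ≠ 5 → s6.reg r = s.reg r := fun r hr h7 h5 => by
    rw [r6 r (by omega) h7, hru r (by omega) h7, r3 r (by omega) h5, r2 r (by omega),
      r1 r (by omega) h7]
  have r65 : s6.reg 5 = s.reg 5 + z := by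
    rw [r6 5 (by simp) (by simp), hru 5 (by simp) (by simp), r35]
  have hm6 : ∀ a, a ≠ 5 → a ≠ 6 → a ≠ 7 → a ≠ 9 → s6.mem a = s3.mem a := fun a a1 a2 a3 a4 => by
    rw [f6 a a1 a2 a3 a4, m5, f4 a a1 a2 a3 a4]
  apply WP.op
  simp only [Op.wp, std6.one, hr6 6 (by simp) (by simp) (by simp), h6]
  refine ⟨by omega, ?_, by omega⟩
  have hE'u : ∀ t, elimE E v u w u t ↔ (E u t ∧ t ≠ v) ∨ t = w := by
    intro t; simp only [elimE]
    constructor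
    · rintro (⟨g1, g2, g3⟩ | ⟨g1, g2⟩ | ⟨g1, g2⟩)
      · exact Or.inl ⟨g1, g3⟩
      · exact Or.inr g2
      · exact absurd g1 huw
    · rintro (⟨g1, g2⟩ | g1)
      · exact Or.inl ⟨g1, nvu, g2⟩
      · exact Or.inr (Or.inl ⟨trivial, g1⟩)
  have hE'w : ∀ t, elimE E v u w w t ↔ (E w t ∧ t ≠ v) ∨ t = u := by
    intro t; simp only [elimE]
    constructor
    · rintro (⟨g1, g2, g3⟩ | ⟨g1, g2⟩ | ⟨g1, g2⟩)
      · exact Or.inl ⟨g1, g3⟩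
      · exact absurd g1.symm huw
      · exact Or.inr g2
    · rintro (⟨g1, g2⟩ | g1)
      · exact Or.inl ⟨g1, nvw, g2⟩
      · exact Or.inr (Or.inr ⟨trivial, g1⟩)
  have hE'x : ∀ x, x ≠ u → x ≠ w → x ≠ v → ∀ t, elimE E v u w x t ↔ E x t := by
    intro x xu xw xv t; simp only [elimE]
    constructor
    · rintro (⟨g1, g2, g3⟩ | ⟨g1, g2⟩ | ⟨g1, g2⟩)
      · exact g1
      · exact absurd g1 xu
      · exact absurd g1 xw
    · intro g1
      refine Or.inl ⟨g1, xv, ?_⟩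
      rintro rfl
      rcases (hv x).1 (inv.symm _ _ g1) with h | h
      · exact xu h
      · exact xw h
  have hE'v : ∀ t, ¬ elimE E v u w v t := by
    intro t; simp only [elimE]
    rintro (⟨g1, g2, g3⟩ | ⟨g1, g2⟩ | ⟨g1, g2⟩)
    · exact g2 rfl
    · exact nvu g1.symm
    · exact nvw g1.symm
  have hlive : ∀ x, (∃ t, elimE E v u w x t) ↔ (∃ t, E x t) ∧ x ≠ v := by
    intro x
    by_cases xv : x = v
    · subst xv
      exact iff_of_false (fun ⟨t, ht⟩ => hE'v t ht) (fun h => h.2 rfl)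
    by_cases xu : x = u
    · subst xu
      exact iff_of_true ⟨w, (hE'u w).2 (Or.inr rfl)⟩ ⟨hlive_u, xv⟩
    by_cases xw : x = w
    · subst xw
      exact iff_of_true ⟨u, (hE'w u).2 (Or.inr rfl)⟩ ⟨hlive_w, xv⟩
    simp only [hE'x x xu xw xv]
    exact ⟨fun h => ⟨h, xv⟩, fun h => h.1⟩
  have hsum' : ∀ x, (∃ t, elimE E v u w x t) →
      Sums (elimE E v u w) (s6.mem 5) (s6.mem 6) (s6.mem 7) x := by
    intro x hx
    obtain ⟨hxl, xv⟩ := (hlive x).1 hx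
    by_cases xu : x = u
    · subst xu
      refine (hsum x hxl).move (y := w) (v := v) (z := z) (inv.symm _ _ hvu) nvw hE'u hzE ?_ ?_ ?_
      · rw [m65, Function.update_of_ne huw, Function.update_self]
      · rw [m66, Function.update_of_ne huw, Function.update_self]
      · rw [m67, Function.update_of_ne huw, Function.update_self]
    by_cases xw : x = w
    · subst xw
      have hzE' : (E x u ∧ z = 0) ∨ (¬ E x u ∧ z = 1) := by
        rcases hzE with ⟨g1, g2⟩ | ⟨g1, g2⟩
        · exact Or.inl ⟨inv.symm _ _ g1, g2⟩
        · exact Or.inr ⟨fun h => g1 (inv.symm _ _ h), g2⟩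
      refine (hsum x hxl).move (y := u) (v := v) (z := z) (inv.symm _ _ hvw) nvu hE'w hzE' ?_ ?_ ?_
      · rw [m65, Function.update_self]
      · rw [m66, Function.update_self]
      · rw [m67, Function.update_self]
    · refine (hsum x hxl).of_eq (hE'x x xu xw xv) ?_ ?_ ?_
      · rw [m65, Function.update_of_ne xw, Function.update_of_ne xu]
      · rw [m66, Function.update_of_ne xw, Function.update_of_ne xu]
      · rw [m67, Function.update_of_ne xw, Function.update_of_ne xu]
  obtain ⟨eu2, ev2, hstep, heu2⟩ : ∃ eu2 ev2,
      ElimInv n m (i + 1) (elimE E v u w) (elimX E X v u w) (fun a b => s6.mem 4 (a * n + b))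
        (s.reg 5 + z) eu2 ev2 (s6.mem 10) (s6.mem 11) (s6.mem 12) ∧
      (∀ h < m, eu2 h = eu h ∧ ev2 h = ev h) := by
    have hAD : ∀ a c, a < n → c < n → s6.mem 4 (a * n + c) =
        if (a = u ∧ c = w) ∨ (a = w ∧ c = u) then b + 1 else s.mem 4 (a * n + c) := by
      intro a c ha hc
      rw [hm6 4 (by simp) (by simp) (by simp) (by simp), m34, update_idx hc hun hwn]
    have hL := (hm6 10 (by simp) (by simp) (by simp) (by simp)).trans m310
    have hR := (hm6 11 (by simp) (by simp) (by simp) (by simp)).trans m311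
    have hBB := (hm6 12 (by simp) (by simp) (by simp) (by simp)).trans m312
    rcases hzE with ⟨g1, rfl⟩ | ⟨g1, rfl⟩
    · exact ⟨eu', ev', inv.step hi huw hv hl hr
        (Or.inl ⟨by simpa using hb15, rfl, rfl, rfl⟩) hAD hL hR hBB, heu⟩
    · have hb0 : s.mem 4 (u * n + w) = 0 := by omega
      have hbeq : b = s.reg 5 := by omega
      refine ⟨_, _, inv.step hi huw hv hl hr
        (Or.inr ⟨hb0, hbeq, rfl, rfl, rfl⟩) hAD hL hR hBB, fun h hh => ?_⟩
      have := inv.le_cnt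
      rw [Function.update_of_ne (by omega), Function.update_of_ne (by omega)]
      exact heu h hh
  have hstk' : i + 1 + 2 < n →
      IsStack (s6.mem 9) (s6.reg 7) fun x => (∃ y, elimE E v u w x y) ∧ s6.mem 5 x = 2 := by
    intro hi'
    have hred' := hstep.red hi'
    -- if the degree of a neighbour of `v` drops, then it was greater than two
    have hdeg : ∀ x, (∃ t, elimE E v u w x t) → 2 ≤ s6.mem 5 x := by
      intro x hx
      obtain ⟨A, hA, e0, -⟩ := hsum' x hx
      obtain ⟨t, ht⟩ := hx
      obtain ⟨t', hne, ht'⟩ := hred'.two_nbrs ht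
      rw [e0]
      exact Finset.one_lt_card.2 ⟨t, (hA t).2 ht, t', (hA t').2 ht', hne.symm⟩
    have du := hdeg u ⟨w, (hE'u w).2 (Or.inr rfl)⟩
    have dw := hdeg w ⟨u, (hE'w u).2 (Or.inr rfl)⟩
    have d5u : s6.mem 5 u = s.mem 5 u - (1 - z) := by
      rw [m65, Function.update_of_ne huw, Function.update_self]
    have d5w : s6.mem 5 w = s.mem 5 w - (1 - z) := by rw [m65, Function.update_self]
    have d5x : ∀ x, x ≠ u → x ≠ w → s6.mem 5 x = s.mem 5 x := fun x xu xw => by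
      rw [m65, Function.update_of_ne xw, Function.update_of_ne xu]
    rw [d5u] at du
    rw [d5w] at dw
    have st4 : IsStack (s4.mem 9) (s4.reg 7) fun x => (((∃ y, E x y) ∧ s.mem 5 x = 2) ∧ x ≠ v) ∨
        ((s.mem 5 u - (1 - z) = 2 ∧ z = 0) ∧ x = u) := by
      refine hst'.push_if push nopush fun h => ?_
      rintro ⟨⟨-, g1⟩, -⟩; omega
    have st6 : IsStack (s6.mem 9) (s6.reg 7) fun x => ((((∃ y, E x y) ∧ s.mem 5 x = 2) ∧ x ≠ v) ∨
        ((s.mem 5 u - (1 - z) = 2 ∧ z = 0) ∧ x = u)) ∨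
          ((s.mem 5 w - (1 - z) = 2 ∧ z = 0) ∧ x = w) := by
      refine st4.push_if push' nopush' fun h => ?_
      rintro (⟨⟨-, g1⟩, -⟩ | ⟨-, g1⟩) <;> omega
    refine st6.congr fun x => ?_
    rw [hlive x]
    by_cases xu : x = u
    · subst xu
      rw [d5u]
      constructor
      · rintro ((⟨⟨g1, g2⟩, g3⟩ | ⟨⟨g1, g2⟩, -⟩) | ⟨-, g⟩)
        · exact ⟨⟨g1, g3⟩, by omega⟩
        · exact ⟨⟨hlive_u, nvu⟩, g1⟩
        · exact absurd g huw
      · rintro ⟨⟨g1, g2⟩, g3⟩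
        rcases Nat.eq_zero_or_pos z with h | h
        · exact Or.inl (Or.inr ⟨⟨g3, h⟩, rfl⟩)
        · exact Or.inl (Or.inl ⟨⟨g1, by omega⟩, g2⟩)
    by_cases xw : x = w
    · subst xw
      rw [d5w]
      constructor
      · rintro ((⟨⟨g1, g2⟩, g3⟩ | ⟨-, g⟩) | ⟨⟨g1, g2⟩, -⟩)
        · exact ⟨⟨g1, g3⟩, by omega⟩
        · exact absurd g huw.symm
        · exact ⟨⟨hlive_w, nvw⟩, g1⟩
      · rintro ⟨⟨g1, g2⟩, g3⟩
        rcases Nat.eq_zero_or_pos z with h | h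
        · exact Or.inr ⟨⟨g3, h⟩, rfl⟩
        · exact Or.inl (Or.inl ⟨⟨g1, by omega⟩, g2⟩)
    · rw [d5x x xu xw]
      constructor
      · rintro ((⟨⟨g1, g2⟩, g3⟩ | ⟨-, g⟩) | ⟨-, g⟩)
        · exact ⟨⟨g1, g3⟩, g2⟩
        · exact absurd g xu
        · exact absurd g xw
      · rintro ⟨⟨g1, g2⟩, g3⟩
        exact Or.inl (Or.inl ⟨⟨g1, g3⟩, g2⟩)
  refine ⟨std6.congr ?_ ?_, by simp, ?_, ⟨elimE E v u w, elimX E X v u w, eu2, ev2, ?_, heu2, ?_,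
    ?_⟩,
    ?_, ?_, ?_, ?_⟩
  · intro r hr; simp [show r ≠ 6 by omega]
  · simp
  · simp [hr6, h9]
  · simpa [r65] using hstep
  · simpa using hsum'
  · simpa using hstk'
  · simp [r65]; omega
  · simp; omega
  · intro k hk
    simp [hm6, f3', htab k hk]
  · intro a ha
    have ha' : a ≠ 4 ∧ a ≠ 5 ∧ a ≠ 6 ∧ a ≠ 7 ∧ a ≠ 9 ∧ a ≠ 10 ∧ a ≠ 11 ∧ a ≠ 12 := by omega
    simp only [State.set_mem]
    rw [hm6 a ha'.2.1 ha'.2.2.1 ha'.2.2.2.1 ha'.2.2.2.2.1,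
      f3' a ha'.1 ha'.2.2.2.2.2.1 ha'.2.2.2.2.2.2.1 ha'.2.2.2.2.2.2.2, hfr a ha]

/-- The elimination of all but two vertices. -/
def progElimAll : Program :=
  .seq (block (.copy 6 0) [.sub 9 2 4, .copy 5 3]) (.loop (.lt 6 9) progElim)

/-- The array `inp` contains the graph `G` with `m` edges, the `h`-th of which is `pr h`. -/
structure GraphInput {n : ℕ} (G : SimpleGraph (Fin n)) (m : ℕ) (inp : ℕ → ℕ)
    (pr : ℕ → Fin n × Fin n) : Prop where
  size : inp 0 = n
  edges : inp 1 = m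
  left : ∀ h < m, inp (2 + 2 * h) = (pr h).1
  right : ∀ h < m, inp (3 + 2 * h) = (pr h).2
  adj : ∀ e, e ∈ G.edgeSet ↔ ∃ h < m, s((pr h).1, (pr h).2) = e
  inj : ∀ h < m, ∀ h' < m, s((pr h).1, (pr h).2) = s((pr h').1, (pr h').2) → h = h'
  le : m ≤ n * n

lemma getD_flatMap_pair {n : ℕ} (d : Fin n × Fin n) (L : List (Fin n × Fin n)) {h : ℕ}
    (hh : h < L.length) :
    (L.flatMap fun p => [(p.1 : ℕ), (p.2 : ℕ)]).getD (2 * h) 0 = (L.getD h d).1 ∧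
    (L.flatMap fun p => [(p.1 : ℕ), (p.2 : ℕ)]).getD (2 * h + 1) 0 = (L.getD h d).2 := by
  induction L generalizing h with
  | nil => simp at hh
  | cons p L ih =>
    cases h with
    | zero => simp
    | succ h =>
      have := ih (h := h) (by simpa using hh)
      have e1 : 2 * (h + 1) = 2 * h + 1 + 1 := by ring
      simpa [e1] using this

/-- The input words as an array. -/
lemma EncodesGraph.exists_input {n : ℕ} {G : SimpleGraph (Fin n)} {l : List ℕ}
    (h : EncodesGraph G l) (hn : 0 < n) :
    ∃ m pr, GraphInput G m (fun i => l.getD i 0) pr := by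
  obtain ⟨L, ⟨hnd, hL⟩, rfl⟩ := h
  have hmem : ∀ e, e ∈ L.map (fun p => s(p.1, p.2)) ↔
      ∃ h < L.length, s((L.getD h (⟨0, hn⟩, ⟨0, hn⟩)).1, (L.getD h (⟨0, hn⟩, ⟨0, hn⟩)).2) = e := by
    intro e
    rw [List.mem_iff_getElem]
    constructor
    · rintro ⟨h, hh, rfl⟩
      rw [List.length_map] at hh
      exact ⟨h, hh, by simp [hh]⟩
    · rintro ⟨h, hh, rfl⟩
      exact ⟨h, by simpa using hh, by simp [hh]⟩
  refine ⟨L.length, fun h => L.getD h (⟨0, hn⟩, ⟨0, hn⟩), by simp, by simp [encodeEdges], ?_, ?_,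
    fun e => by rw [hL, hmem], ?_, ?_⟩
  · intro h hh
    have := (getD_flatMap_pair (⟨0, hn⟩, ⟨0, hn⟩) L hh).1
    have e1 : 2 + 2 * h = 2 * h + 1 + 1 := by ring
    simpa [encodeEdges, e1] using this
  · intro h hh
    have := (getD_flatMap_pair (⟨0, hn⟩, ⟨0, hn⟩) L hh).2
    have e1 : 3 + 2 * h = 2 * h + 1 + 1 + 1 := by ring
    simpa [encodeEdges, e1] using this
  · intro h hh h' hh' he
    have h1 : h < (L.map fun p => s(p.1, p.2)).length := by simpa using hh
    have h2 : h' < (L.map fun p => s(p.1, p.2)).length := by simpa using hh'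
    refine (hnd.getElem_inj_iff (hi := h1) (hj := h2)).1 ?_
    simpa [hh, hh'] using he
  · have := hnd.of_map.length_le_card
    simpa using this

namespace GraphInput
variable {n m : ℕ} {G : SimpleGraph (Fin n)} {inp : ℕ → ℕ} {pr : ℕ → Fin n × Fin n}

lemma edgeList (h : GraphInput G m inp pr) :
    EdgeList n m inp (fun h => (pr h).1) (fun h => (pr h).2) := by
  refine ⟨fun k _ => ⟨(pr k).1.2, (pr k).2.2⟩, fun k hk he => ?_, fun k hk k' hk' he => ?_, h.left,
    h.right⟩
  · have h1 := (h.adj _).2 ⟨k, hk, rfl⟩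
    rw [SimpleGraph.mem_edgeSet] at h1
    exact h1.ne (Fin.ext he)
  · exact h.inj k hk k' hk' (Sym2.map.injective Fin.val_injective he)

lemma adj_iff (h : GraphInput G m inp pr) (a b : Fin n) :
    G.Adj a b ↔ ∃ k < m, s(((pr k).1 : ℕ), ((pr k).2 : ℕ)) = s(a.val, b.val) := by
  rw [← SimpleGraph.mem_edgeSet, h.adj]
  constructor
  · rintro ⟨k, hk, he⟩
    exact ⟨k, hk, congrArg (Sym2.map Fin.val) he⟩
  · rintro ⟨k, hk, he⟩
    exact ⟨k, hk, Sym2.map.injective Fin.val_injective he⟩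

end GraphInput

/-- The first part of the program: it reads the graph and eliminates its vertices. -/
def progFront : Program :=
  .seq progConst <| .seq progSqrt <| .seq progRead <| .seq progStack progElimAll

/-- The state after the elimination: the triangles are in arrays `10`, `11`, `12`, and array `14`
contains the costs of the edges. -/
structure FrontState {n : ℕ} {G : SimpleGraph (Fin n)} (Λ : Layout G) (inp : ℕ → ℕ) (s : State) :
    Prop where
  std : Std n Λ.m inp s
  reg9 : s.reg 9 = Λ.K
  L : s.mem 10 = Λ.L
  R : s.mem 11 = Λ.R
  B : s.mem 12 = Λ.B

lemma FrontState.congr {n : ℕ} {G : SimpleGraph (Fin n)} {Λ : Layout G} {inp : ℕ → ℕ}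
    {s s' : State} (h : FrontState Λ inp s) (hr : ∀ r, r < 5 ∨ r = 9 → s'.reg r = s.reg r)
    (hm : ∀ a, a = 0 ∨ a = 10 ∨ a = 11 ∨ a = 12 → s'.mem a = s.mem a) : FrontState Λ inp s' :=
  ⟨h.std.congr (fun r hr' => hr r (Or.inl hr')) (hm 0 (by simp)), by rw [hr 9 (by simp), h.reg9],
    by rw [hm 10 (by simp), h.L], by rw [hm 11 (by simp), h.R], by rw [hm 12 (by simp), h.B]⟩

theorem progFront_wp {W n m : ℕ} {G : SimpleGraph (Fin n)} (hG : IsPolygonalTwoTree G)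
    {inp : ℕ → ℕ} {pr : ℕ → Fin n × Fin n} (hin : GraphInput G m inp pr) (hB : Bounds n m W)
    {s : State} (h0 : s.reg 0 = 0) (hs0 : s.mem 0 = inp) (hz : ∀ a, a ≠ 0 → ∀ k, s.mem a k = 0) :
    WP W progFront (fun s' t => ∃ Λ : Layout G, Λ.m = m ∧
      (∀ h < m, Λ.en h = s((pr h).1, (pr h).2)) ∧ FrontState Λ inp s' ∧
      (∀ h, s'.mem 14 h = Λ.cost h) ∧ (∀ a, 15 ≤ a → ∀ k, s'.mem a k = 0) ∧
      t ≤ 4 + ((4 * n + 2) + ((38 * m + 2) + ((6 * n + 3) + (3 + (78 * (n - 2) + 1)))))) s := by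
  have hL := hin.edgeList
  have hB' := hB
  obtain ⟨b1, b2, b3, b4, b5⟩ := hB'
  refine WP.seq ((progConst_wp (n := n) (m := m) (by omega) (by omega) (by omega) h0 hs0 hin.size
    hin.edges).mono ?_)
  rintro s1 t1 ⟨std1, -, m1, ht1⟩
  refine WP.seq ((progSqrt_wp (by omega) (by omega) std1).mono ?_)
  rintro s2 t2 ⟨std2, tab2, m2, ht2⟩
  refine WP.seq ((progRead_wp hB hL std2 ?_).mono ?_)
  · intro a ha k
    rw [m2 a (by omega), m1]
    exact hz a (by omega) k
  rintro s3 t3 ⟨std3, rd3, m3, ht3⟩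
  have hlt3 : ∀ x y, adjUpTo (fun h => ((pr h).1 : ℕ)) (fun h => ((pr h).2 : ℕ)) m x y → y < n := by
    rintro x y ⟨h, hh, he⟩
    have h1 := (pr h).1.2
    have h2 := (pr h).2.2
    rcases Sym2.eq_iff.1 he with ⟨h3, h4⟩ | ⟨h3, h4⟩ <;> simp only at h3 h4 <;> omega
  have inv3 := ElimInv.init hG (AD := fun a b => s3.mem 4 (a * n + b)) (s3.mem 10) (s3.mem 11)
    (s3.mem 12) (fun h hh => hL.lt h hh) hin.adj_iff rd3.adj (by
      intro a b ha hb hne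
      exact rd3.nadj a b ha hb (fun ⟨h, hh, he⟩ => hne h hh he))
  have hE3 : ∀ a b, Relation.Map G.Adj Fin.val Fin.val a b ↔
      adjUpTo (fun h => ((pr h).1 : ℕ)) (fun h => ((pr h).2 : ℕ)) m a b := by
    intro a b
    constructor
    · rintro ⟨a, b, hab, rfl, rfl⟩; exact (hin.adj_iff a b).1 hab
    · rintro ⟨h, hh, he⟩
      have h1 := (pr h).1.2
      have h2 := (pr h).2.2
      have : a < n ∧ b < n := by
        rcases Sym2.eq_iff.1 he with ⟨h3, h4⟩ | ⟨h3, h4⟩ <;> simp only at h3 h4 <;> omega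
      exact ⟨⟨a, this.1⟩, ⟨b, this.2⟩, (hin.adj_iff _ _).2 ⟨h, hh, he⟩, rfl, rfl⟩
  refine WP.seq ((progStack_wp hB std3 (fun x hx => ?_)).mono ?_)
  · have := ((rd3.sums x hx).le (hlt3 x)).1
    omega
  rintro s4 t4 ⟨std4, stk4, sp4, m4, ht4⟩
  apply WP.seq
  apply WP.block
  simp only [wpOps, Op.wp, State.set_reg]
  simp only [reduceIte, Nat.reduceEqDiff, std4.zero, std4.size, std4.two, std4.edges,
    List.length]
  refine ⟨by omega, by omega, by omega, ?_⟩
  refine WP.loop (ElimState n m inp (fun h => ((pr h).1 : ℕ)) (fun h => ((pr h).2 : ℕ)) s4)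
    (fun _ => 77) (n - 2) ?_ ?_ ?_ ?_
  · refine ⟨std4.congr ?_ ?_, by simp, by simp, ⟨Relation.Map G.Adj Fin.val Fin.val,
      fun _ _ => False, _, _, ?_, fun h hh => ⟨rfl, rfl⟩, ?_, ?_⟩, by simp, by simp; omega, ?_, ?_⟩
    · intro r hr
      have : r ≠ 5 ∧ r ≠ 6 ∧ r ≠ 9 := by omega
      simp [this]
    · simp
    · simpa [m4] using inv3
    · rintro x ⟨y, hy⟩
      refine (rd3.sums x (inv3.lt _ _ hy)).of_eq (hE3 x) ?_ ?_ ?_ <;> simp [m4]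
    · intro _
      simp only [State.set_mem, State.set_reg, Nat.reduceEqDiff, reduceIte]
      refine stk4.congr fun x => ?_
      rw [m4 5 (by simp)]
      constructor
      · rintro ⟨hx, h2⟩
        obtain ⟨b, hb⟩ := hG.exists_adj ⟨x, hx⟩
        exact ⟨⟨b, _, _, hb, rfl, rfl⟩, h2⟩
      · rintro ⟨⟨y, hy⟩, h2⟩
        exact ⟨inv3.lt _ _ hy, h2⟩
    · intro k hk
      simp [m4, m3, tab2 k hk]
    · simp
  · intro i hi s5 hs5
    refine ⟨by simp [Test.holds, hs5.reg6, hs5.reg9, hi], ?_⟩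
    exact progElim_wp hB hs5 (by omega)
  · intro s5 hs5
    simp [Test.holds, hs5.reg6, hs5.reg9]
  · intro s5 t5 hs5 ht5
    obtain ⟨std5, -, r59, ⟨E, X, eu', ev', inv5, heu5, -⟩, -, -, -, fr5⟩ := hs5
    have hpr : ∀ h < m, s(eu' h, ev' h) = s(((pr h).1 : ℕ), ((pr h).2 : ℕ)) := fun h hh => by
      rw [(heu5 h hh).1, (heu5 h hh).2]
    obtain ⟨Λ, hK, hN, hLL, hR, hBB, hm, hen⟩ := inv5.exists_layout (by omega) hG.connected
      (fun a b => by
        rw [hin.adj_iff]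
        exact exists_congr fun h => and_congr_right fun hh => by rw [hpr h hh])
      (fun h hh h' hh' he => hL.inj h hh h' hh' (by rw [← hpr h hh, ← hpr h' hh', he]))
    refine ⟨Λ, hm, fun h hh => ?_, ⟨by rw [hm]; exact std5, by rw [r59, hK], hLL.symm, hR.symm,
      hBB.symm⟩, fun h => ?_, fun a ha k => ?_, ?_⟩
    · apply Sym2.map.injective Fin.val_injective
      have := Λ.m_le
      rw [hen h (by omega), hpr h hh]
      rfl
    · rw [fr5 14 (by simp), m4 14 (by simp), rd3.cost, Layout.cost, hm]
    · rw [fr5 a (by omega), m4 a (by omega), m3 a (by omega) (by omega) (by omega) (by omega)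
        (by omega), m2 a (by omega), m1]
      exact hz a (by omega) k
    · simp at ht5
      omega

/-! ### The program: cuts below the triangles -/

/-- The ascending computation of the minimum cuts: `DL` in array `13`, and `CS` in array `14`, which
starts with the costs. The minimum of `x` and `y` is `x - (x - y)` in truncated subtraction. -/
def progUp : Program :=
  .seq (.op (.copy 6 0)) <| .loop (.lt 6 9) <|
    block (.load 20 10 6) [.load 21 11 6, .load 22 12 6, .load 23 14 20, .load 24 14 21,
      .sub 25 23 24, .sub 25 23 25, .store 13 6 25, .load 26 14 22, .add 26 26 25, .store 14 22 26,
      .add 6 6 1]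

variable {n : ℕ} {G : SimpleGraph (Fin n)}

lemma Layout.card_fin (Λ : Layout G) : n = Λ.K + 2 := by
  have := Λ.card_V
  rwa [Fintype.card_fin] at this

lemma Layout.sum_cost_le (Λ : Layout G) : ∑ h ∈ Finset.range Λ.N, Λ.cost h ≤ Λ.m := by
  have h1 : ∑ h ∈ Finset.range Λ.N, Λ.cost h = ∑ h ∈ Finset.range Λ.m, 1 := by
    rw [← Finset.sum_subset (Finset.range_mono Λ.m_le)]
    · exact Finset.sum_congr rfl fun h hh => by simp [cost, Finset.mem_range.1 hh]
    · intro h _ hh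
      rw [Finset.mem_range] at hh
      simp [cost, hh]
  simp [h1]

/-- The state after the first `i` rounds of the ascending computation. -/
structure UpState (Λ : Layout G) (inp : ℕ → ℕ) (s0 : State) (i : ℕ) (s : State) : Prop where
  front : FrontState Λ inp s
  CS : ∀ h, s.mem 14 h = Λ.cost h + ∑ j ∈ (Finset.range i).filter (fun j => Λ.B j = h), s.mem 13 j
  DL : ∀ j < i, s.mem 13 j = min (s.mem 14 (Λ.L j)) (s.mem 14 (Λ.R j))
  sum_le : ∑ h ∈ Λ.E i, s.mem 14 h ≤ Λ.m
  le : ∀ h < Λ.N, s.mem 14 h ≤ Λ.m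
  frame : ∀ a, a ≠ 13 → a ≠ 14 → s.mem a = s0.mem a

lemma progUp_wp {W : ℕ} {Λ : Layout G} {inp : ℕ → ℕ} {s : State} (hB : Bounds n Λ.m W)
    (hs : FrontState Λ inp s) (h14 : ∀ h, s.mem 14 h = Λ.cost h) :
    WP W progUp (fun s' t => UpState Λ inp s Λ.K s' ∧ t ≤ 13 * n + 2) s := by
  have hcard := Λ.card_fin
  have hN := Λ.card
  have hmN := Λ.m_le
  obtain ⟨b1, b2, b3, b4, b5⟩ := hB
  have hNW : 4 * Λ.N < W := by omega
  apply WP.seq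
  apply WP.op
  simp only [Op.wp, hs.std.zero]
  refine ⟨by omega, ?_⟩
  refine WP.loop (fun i s' => UpState Λ inp s i s' ∧ s'.reg 6 = i) (fun _ => 12) Λ.K ?_ ?_ ?_ ?_
  · have hsum : ∑ h ∈ Λ.E 0, s.mem 14 h ≤ Λ.m := by
      rw [Λ.toScheme.E_zero, Finset.sum_congr rfl fun h _ => h14 h]
      exact Λ.sum_cost_le
    refine ⟨⟨hs.congr ?_ ?_, ?_, ?_, ?_, ?_, ?_⟩, by simp⟩
    · intro r hr; simp [show r ≠ 6 by omega]
    · simp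
    · simpa using h14
    · simp
    · simpa using hsum
    · intro h hh
      have hmem : h ∈ Λ.E 0 := by rw [Λ.toScheme.E_zero]; exact Finset.mem_range.2 hh
      exact (Finset.single_le_sum (f := fun h => s.mem 14 h) (fun _ _ => Nat.zero_le _) hmem).trans
        hsum
    · simp
  · rintro i hi s1 ⟨⟨fr, hCS, hDL, hsum, hle, hfr⟩, h6⟩
    refine ⟨by simp [Test.holds, h6, fr.reg9, hi], ?_⟩
    have oL := Λ.L_lt i hi; have oR := Λ.R_lt i hi; have oB := Λ.B_lt i hi
    have hLR := Λ.LR i hi; have hLB := Λ.LB i hi; have hRB := Λ.RB i hi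
    have cL := hle _ oL; have cR := hle _ oR; have cB := hle _ oB
    have hEB := Λ.toScheme.B_mem_E hi
    have hsplit : ∑ h ∈ Λ.E i, s1.mem 14 h = s1.mem 14 (Λ.L i) + (s1.mem 14 (Λ.R i) +
        ∑ h ∈ Λ.E (i + 1), s1.mem 14 h) := by
      rw [Λ.toScheme.E_eq_insert hi, Finset.sum_insert, Finset.sum_insert]
      · exact Λ.toScheme.R_notMem_E
      · rw [Finset.mem_insert, not_or]
        exact ⟨hLR, Λ.toScheme.L_notMem_E⟩
    have hBle := Finset.single_le_sum (f := fun h => s1.mem 14 h) (fun _ _ => Nat.zero_le _) hEB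
    generalize hd : s1.mem 14 (Λ.L i) - (s1.mem 14 (Λ.L i) - s1.mem 14 (Λ.R i)) = d
    have hdmin : d = min (s1.mem 14 (Λ.L i)) (s1.mem 14 (Λ.R i)) := by omega
    have o1 : Λ.L i < W := by omega
    have o2 : Λ.R i < W := by omega
    have o3 : Λ.B i < W := by omega
    have o4 : s1.mem 14 (Λ.L i) < W := by omega
    have o5 : s1.mem 14 (Λ.R i) < W := by omega
    have o6 : s1.mem 14 (Λ.L i) - s1.mem 14 (Λ.R i) < W := by omega
    have o7 : d < W := by omega
    have o8 : s1.mem 14 (Λ.B i) < W := by omega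
    have o9 : s1.mem 14 (Λ.B i) + d < W := by omega
    have o10 : i + 1 < W := by omega
    apply WP.block
    simp only [wpOps, Op.wp, State.set_reg, State.set_mem, State.put_reg, State.put_mem]
    simp only [reduceIte, Nat.reduceEqDiff, fr.std.one, h6, fr.L, fr.R, fr.B, hd, o1, o2, o3, o4,
      o5, o6, o7, o8, o9, o10, true_and, List.length, Nat.reduceAdd, le_refl, and_true]
    have hm14 : ∀ h, Function.update (s1.mem 14) (Λ.B i) (s1.mem 14 (Λ.B i) + d) h
        = s1.mem 14 h + if h = Λ.B i then d else 0 := by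
      intro h
      by_cases hh : h = Λ.B i
      · simp [hh]
      · simp [hh]
    refine ⟨fr.congr ?_ ?_, ?_, ?_, ?_, ?_, ?_⟩
    · intro r hr
      have : r ≠ 6 ∧ r ≠ 20 ∧ r ≠ 21 ∧ r ≠ 22 ∧ r ≠ 23 ∧ r ≠ 24 ∧ r ≠ 25 ∧ r ≠ 26 := by omega
      simp [this]
    · intro a ha
      have : a ≠ 13 ∧ a ≠ 14 := by omega
      simp [this]
    · intro h
      simp only [State.set_mem, State.put_mem, reduceIte, Nat.reduceEqDiff, hm14]
      rw [Finset.range_add_one, Finset.filter_insert]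
      have hc : ∑ j ∈ (Finset.range i).filter (fun j => Λ.B j = h),
          Function.update (s1.mem 13) i d j
          = ∑ j ∈ (Finset.range i).filter (fun j => Λ.B j = h), s1.mem 13 j := by
        refine Finset.sum_congr rfl fun j hj => ?_
        rw [Finset.mem_filter, Finset.mem_range] at hj
        rw [Function.update_of_ne hj.1.ne]
      by_cases hh : Λ.B i = h
      · rw [if_pos hh.symm, if_pos hh, Finset.sum_insert (by simp), hc, hCS h, Function.update_self]
        omega
      · rw [if_neg (Ne.symm hh), if_neg hh, hc, hCS h]
        rfl
    · intro j hj
      simp only [State.set_mem, State.put_mem, reduceIte, Nat.reduceEqDiff, hm14]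
      rcases Nat.lt_succ_iff_lt_or_eq.1 hj with hj | rfl
      · have hfl := (Λ.L_fresh j i hj hi).2.2; have hfr' := (Λ.R_fresh j i hj hi).2.2
        rw [Function.update_of_ne hj.ne, hDL j hj, if_neg hfl, if_neg hfr']
        rfl
      · rw [Function.update_self, if_neg hLB, if_neg hRB]
        exact hdmin
    · simp only [State.set_mem, State.put_mem, reduceIte, Nat.reduceEqDiff, hm14]
      rw [Finset.sum_add_distrib, Finset.sum_ite_eq' , if_pos hEB]
      omega
    · intro h hh
      simp only [State.set_mem, State.put_mem, reduceIte, Nat.reduceEqDiff, hm14]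
      have := hle h hh
      by_cases hhb : h = Λ.B i
      · rw [if_pos hhb, hhb]
        omega
      · rw [if_neg hhb]
        omega
    · intro a h13 h14'
      simp [h13, h14', hfr]
  · rintro s1 ⟨hs1, h6⟩
    simp [Test.holds, h6, hs1.front.reg9]
  · rintro s1 t ⟨hs1, -⟩ ht
    refine ⟨hs1, ?_⟩
    simp at ht
    omega

/-! ### The program: choosing an edge in each triangle -/

/-- Load the next triangle and the cuts at its edges; the cut above the base is left in register
`28`. -/
def progTri : Program :=
  block (.sub 6 6 1) [.load 20 10 6, .load 21 11 6, .load 22 12 6, .load 23 14 20, .load 24 14 21,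
    .load 25 14 22, .load 26 15 22, .load 27 13 6, .add 28 26 25, .sub 28 28 27]

/-- Compute the minimum cuts above the two edges at the eliminated vertex. -/
def progAbove : Program :=
  block (.sub 29 24 28) [.sub 29 24 29, .store 15 20 29, .sub 29 23 28, .sub 29 23 29,
    .store 15 21 29, .load 30 16 22]

/-- Choose the edge with the smaller cut of the two edges at the eliminated vertex. -/
def progChooseSide : Program :=
  .ite (.lt 24 23) (block (.copy 31 21) [.copy 32 20, .copy 33 22])
    (block (.copy 31 20) [.copy 32 21, .copy 33 22])

/-- Put the chosen edge into register `31` and the other ones into the next two registers. -/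
def progChoose : Program :=
  .ite (.eq 30 0)
    (.ite (.lt 27 28) progChooseSide (block (.copy 31 22) [.copy 32 20, .copy 33 21]))
    progChooseSide

/-- The descending computation of the cuts (array `15`) and of the chosen edges: array `16` marks
them, and arrays `17` and `18` contain the other two edges of their triangles. -/
def progDown : Program :=
  .seq (.op (.copy 6 9)) <| .loop (.lt 0 6) <| .seq progTri <| .seq progAbove <| .seq progChoose <|
    block (.store 16 31 1) [.store 17 31 32, .store 18 31 33]

lemma progChooseSide_wp {W : ℕ} {s : State} (h20 : s.reg 20 < W) (h21 : s.reg 21 < W)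
    (h22 : s.reg 22 < W) :
    WP W progChooseSide (fun s' t => (∀ r < 31, s'.reg r = s.reg r) ∧ s'.mem = s.mem ∧ t = 4 ∧
      (s.reg 23 ≤ s.reg 24 →
        s'.reg 31 = s.reg 20 ∧ s'.reg 32 = s.reg 21 ∧ s'.reg 33 = s.reg 22) ∧
      (¬ s.reg 23 ≤ s.reg 24 →
        s'.reg 31 = s.reg 21 ∧ s'.reg 32 = s.reg 20 ∧ s'.reg 33 = s.reg 22)) s := by
  apply WP.ite
  · intro hc
    have hc' : ¬ s.reg 23 ≤ s.reg 24 := by simpa [Test.holds] using hc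
    apply WP.block
    simp only [wpOps, Op.wp, State.set_reg, State.set_mem]
    simp [h20, h21, h22, hc']
    intro r hr
    have : r ≠ 31 ∧ r ≠ 32 ∧ r ≠ 33 := by omega
    simp [this]
  · intro hc
    have hc' : s.reg 23 ≤ s.reg 24 := by simpa [Test.holds] using hc
    apply WP.block
    simp only [wpOps, Op.wp, State.set_reg, State.set_mem]
    simp [h20, h21, h22, hc']
    intro r hr
    have : r ≠ 31 ∧ r ≠ 32 ∧ r ≠ 33 := by omega
    simp [this]

lemma progChoose_wp {W : ℕ} {s : State} (h0 : s.reg 0 = 0) (h20 : s.reg 20 < W)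
    (h21 : s.reg 21 < W) (h22 : s.reg 22 < W) :
    WP W progChoose (fun s' t => (∀ r < 31, s'.reg r = s.reg r) ∧ s'.mem = s.mem ∧ t ≤ 6 ∧
      ((s.reg 30 = 0 ∧ s.reg 28 ≤ s.reg 27) →
        s'.reg 31 = s.reg 22 ∧ s'.reg 32 = s.reg 20 ∧ s'.reg 33 = s.reg 21) ∧
      (¬ (s.reg 30 = 0 ∧ s.reg 28 ≤ s.reg 27) → s.reg 23 ≤ s.reg 24 →
        s'.reg 31 = s.reg 20 ∧ s'.reg 32 = s.reg 21 ∧ s'.reg 33 = s.reg 22) ∧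
      (¬ (s.reg 30 = 0 ∧ s.reg 28 ≤ s.reg 27) → ¬ s.reg 23 ≤ s.reg 24 →
        s'.reg 31 = s.reg 21 ∧ s'.reg 32 = s.reg 20 ∧ s'.reg 33 = s.reg 22)) s := by
  apply WP.ite
  · intro hc
    have hc' : s.reg 30 = 0 := by simpa [Test.holds, h0] using hc
    apply WP.ite
    · intro hd
      have hd' : s.reg 27 < s.reg 28 := hd
      refine (progChooseSide_wp h20 h21 h22).mono ?_
      rintro s' t ⟨h1, h2, h3, h4, h5⟩
      exact ⟨h1, h2, by omega, fun h => by omega, fun _ => h4, fun _ => h5⟩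
    · intro hd
      have hd' : s.reg 28 ≤ s.reg 27 := by simpa [Test.holds] using hd
      apply WP.block
      simp only [wpOps, Op.wp, State.set_reg, State.set_mem]
      simp [h20, h21, h22, hc', hd']
      intro r hr
      have : r ≠ 31 ∧ r ≠ 32 ∧ r ≠ 33 := by omega
      simp [this]
  · intro hc
    have hc' : s.reg 30 ≠ 0 := by simpa [Test.holds, h0] using hc
    refine (progChooseSide_wp h20 h21 h22).mono ?_
    rintro s' t ⟨h1, h2, h3, h4, h5⟩
    exact ⟨h1, h2, by omega, fun h => absurd h.1 hc', fun _ => h4, fun _ => h5⟩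

lemma Scheme.tri_eq_base (S : Scheme) (i : ℕ) : S.tri i = {S.B i, S.L i, S.R i} := by
  ext h; simp only [tri, Finset.mem_insert, Finset.mem_singleton]; tauto

lemma Scheme.tri_eq_right (S : Scheme) (i : ℕ) : S.tri i = {S.R i, S.L i, S.B i} := by
  ext h; simp only [tri, Finset.mem_insert, Finset.mem_singleton]; tauto

/-- The array `M` marks the edges chosen by `e` in the triangles from the `i`-th on, and `X`, `Y`
give the other two edges of the triangle of a marked edge. -/
structure Marks (S : Scheme) (e : ℕ → ℕ) (i : ℕ) (M X Y : ℕ → ℕ) : Prop where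
  mark : ∀ j, i ≤ j → j < S.K → M (e j) ≠ 0
  marked : ∀ h, M h ≠ 0 → ∃ j, i ≤ j ∧ j < S.K ∧ e j = h ∧ S.tri j = {h, X h, Y h} ∧ X h ≠ h ∧
    Y h ≠ h ∧ X h ≠ Y h

/-- The state of the descending computation before the triangles below the `i`-th one. The
choice `e` matters only from `i` on. -/
structure DownState (Λ : Layout G) (inp : ℕ → ℕ) (CS DL : ℕ → ℕ) (i : ℕ) (e : ℕ → ℕ) (s : State) :
    Prop where
  front : FrontState Λ inp s
  mDL : s.mem 13 = DL
  mCS : s.mem 14 = CS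
  U_L : ∀ j, i ≤ j → j < Λ.K → s.mem 15 (Λ.L j) =
    min (CS (Λ.R j)) (s.mem 15 (Λ.B j) + CS (Λ.B j) - DL j)
  U_R : ∀ j, i ≤ j → j < Λ.K → s.mem 15 (Λ.R j) =
    min (CS (Λ.L j)) (s.mem 15 (Λ.B j) + CS (Λ.B j) - DL j)
  U_root : ∀ h, (∀ j, i ≤ j → j < Λ.K → h ≠ Λ.L j ∧ h ≠ Λ.R j) → s.mem 15 h = 0
  U_le : ∀ h, s.mem 15 h ≤ Λ.m
  e_base : ∀ j, i ≤ j → j < Λ.K → (∀ k, j < k → k < Λ.K → e k ≠ Λ.B j) →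
    s.mem 15 (Λ.B j) + CS (Λ.B j) - DL j ≤ DL j → e j = Λ.B j
  e_left : ∀ j, i ≤ j → j < Λ.K → ¬ ((∀ k, j < k → k < Λ.K → e k ≠ Λ.B j) ∧
    s.mem 15 (Λ.B j) + CS (Λ.B j) - DL j ≤ DL j) → CS (Λ.L j) ≤ CS (Λ.R j) → e j = Λ.L j
  e_right : ∀ j, i ≤ j → j < Λ.K → ¬ ((∀ k, j < k → k < Λ.K → e k ≠ Λ.B j) ∧
    s.mem 15 (Λ.B j) + CS (Λ.B j) - DL j ≤ DL j) → ¬ CS (Λ.L j) ≤ CS (Λ.R j) → e j = Λ.R j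
  marks : Marks Λ.toScheme e i (s.mem 16) (s.mem 17) (s.mem 18)
  M_le : ∀ h, s.mem 16 h ≤ 1

lemma progTri_wp {W m i up : ℕ} {inp L R B CS DL : ℕ → ℕ} {s : State} (std : Std n m inp s)
    (h6 : s.reg 6 = i + 1) (hL : s.mem 10 = L) (hR : s.mem 11 = R) (hB : s.mem 12 = B)
    (hCS : s.mem 14 = CS) (hDL : s.mem 13 = DL) (hup : s.mem 15 (B i) + CS (B i) - DL i = up)
    (o0 : i < W) (o1 : L i < W) (o2 : R i < W) (o3 : B i < W) (o4 : CS (L i) < W)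
    (o5 : CS (R i) < W) (o9 : s.mem 15 (B i) + CS (B i) < W) (o8 : DL i < W) :
    WP W progTri (fun s' t => (∀ r, r < 6 ∨ r = 9 → s'.reg r = s.reg r) ∧ s'.reg 6 = i ∧
      s'.reg 20 = L i ∧ s'.reg 21 = R i ∧ s'.reg 22 = B i ∧ s'.reg 23 = CS (L i) ∧
      s'.reg 24 = CS (R i) ∧ s'.reg 27 = DL i ∧ s'.reg 28 = up ∧ s'.mem = s.mem ∧ t = 11) s := by
  apply WP.block
  have o6 : CS (B i) < W := by omega
  have o7 : s.mem 15 (B i) < W := by omega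
  have o10 : up < W := by omega
  simp only [wpOps, Op.wp, State.set_reg, State.set_mem]
  simp only [reduceIte, Nat.reduceEqDiff, std.one, h6, hL, hR, hB, hCS, hDL, o0, o1, o2, o3,
    o4, o5, o6, o7, o8, o9, o10, hup, true_and, and_true, List.length, Nat.add_sub_cancel]
  intro r hr
  have : r ≠ 6 ∧ r ≠ 20 ∧ r ≠ 21 ∧ r ≠ 22 ∧ r ≠ 23 ∧ r ≠ 24 ∧ r ≠ 25 ∧ r ≠ 26 ∧ r ≠ 27 ∧
      r ≠ 28 := by
    omega
  simp [this]

lemma progAbove_wp {W l r b cl cr up : ℕ} {s : State} (h20 : s.reg 20 = l) (h21 : s.reg 21 = r)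
    (h22 : s.reg 22 = b) (h23 : s.reg 23 = cl) (h24 : s.reg 24 = cr) (h28 : s.reg 28 = up)
    (ocl : cl < W) (ocr : cr < W) (oM : s.mem 16 b < W) :
    WP W progAbove (fun s' t => (∀ r, r < 29 → s'.reg r = s.reg r) ∧ s'.reg 30 = s.mem 16 b ∧
      s'.mem 15 = Function.update (Function.update (s.mem 15) l (min cr up)) r (min cl up) ∧
      (∀ a, a ≠ 15 → s'.mem a = s.mem a) ∧ t = 7) s := by
  apply WP.block
  generalize hx : cr - (cr - up) = x
  generalize hy : cl - (cl - up) = y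
  have hx' : min cr up = x := by omega
  have hy' : min cl up = y := by omega
  have o11 : cr - up < W := by omega
  have o12 : cl - up < W := by omega
  have o13 : x < W := by omega
  have o14 : y < W := by omega
  simp only [wpOps, Op.wp, State.set_reg, State.set_mem, State.put_reg, State.put_mem]
  simp only [reduceIte, Nat.reduceEqDiff, h20, h21, h22, h23, h24, h28, hx, hy, hx', hy', o11, o12,
    o13, o14, oM, true_and, and_true, List.length]
  refine ⟨fun r hr => ?_, fun a ha => by simp [ha]⟩
  have : r ≠ 29 ∧ r ≠ 30 := by omega
  simp [this]

set_option maxHeartbeats 800000 in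
/-- The round for the `i`-th triangle. -/
lemma progDownStep_wp {W i : ℕ} {Λ : Layout G} {inp CS DL e : ℕ → ℕ} {s : State}
    (hB : Bounds n Λ.m W) (hi : i < Λ.K) (hs : DownState Λ inp CS DL (i + 1) e s)
    (h6 : s.reg 6 = i + 1) (hCS : ∀ h < Λ.N, CS h ≤ Λ.m)
    (hDL : ∀ j < Λ.K, DL j = min (CS (Λ.L j)) (CS (Λ.R j))) :
    WP W (.seq progTri <| .seq progAbove <| .seq progChoose <|
      block (.store 16 31 1) [.store 17 31 32, .store 18 31 33])
      (fun s' t => ((∃ e', DownState Λ inp CS DL i e' s') ∧ s'.reg 6 = i) ∧ t ≤ 27) s := by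
  have hcard := Λ.card_fin
  have hN := Λ.card
  have hmN := Λ.m_le
  obtain ⟨b1, b2, b3, b4, b5⟩ := hB
  obtain ⟨fr, mDL, mCS, U_L, U_R, U_root, U_le, e_base, e_left, e_right, marks, M_le⟩ := hs
  have hNW : 4 * Λ.N < W := by omega
  have oL := Λ.L_lt i hi; have oR := Λ.R_lt i hi; have oB := Λ.B_lt i hi
  have hLR := Λ.LR i hi; have hLB := Λ.LB i hi; have hRB := Λ.RB i hi
  have cL := hCS _ oL; have cR := hCS _ oR; have cB := hCS _ oB
  have uB := U_le (Λ.B i)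
  have hdl := hDL i hi
  generalize hup : s.mem 15 (Λ.B i) + CS (Λ.B i) - DL i = up
  refine WP.seq ((progTri_wp fr.std h6 fr.L fr.R fr.B mCS mDL hup (by omega) (by omega) (by omega)
    (by omega) (by omega) (by omega) (by omega) (by omega)).mono ?_)
  rintro s1 t1 ⟨r1, r16, r120, r121, r122, r123, r124, r127, r128, m1, rfl⟩
  have hMB := M_le (Λ.B i)
  refine WP.seq ((progAbove_wp r120 r121 r122 r123 r124 r128 (by omega) (by omega)
    (by rw [m1]; omega)).mono ?_)
  rintro s2 t2 ⟨r2, r230, m215, m2, rfl⟩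
  rw [m1] at r230 m215
  refine WP.seq ((progChoose_wp (by rw [r2 0 (by simp), r1 0 (by simp), fr.std.zero])
    (by rw [r2 20 (by simp), r120]; omega) (by rw [r2 21 (by simp), r121]; omega)
    (by rw [r2 22 (by simp), r122]; omega)).mono ?_)
  rintro s3 t3 ⟨r3, m3, ht3, c1, c2, c3⟩
  rw [r230, r2 28 (by simp), r2 27 (by simp), r2 20 (by simp), r2 21 (by simp), r2 22 (by simp),
    r120, r121, r122, r127, r128] at c1
  rw [r230, r2 28 (by simp), r2 27 (by simp), r2 20 (by simp), r2 21 (by simp), r2 22 (by simp),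
    r2 23 (by simp), r2 24 (by simp), r120, r121, r122, r123, r124, r127, r128] at c2 c3
  have hr3 : ∀ r, r < 6 ∨ r = 9 → s3.reg r = s.reg r := fun r hr => by
    rw [r3 r (by omega), r2 r (by omega), r1 r hr]
  have hm3 : ∀ a, a ≠ 15 → s3.mem a = s.mem a := fun a ha => by rw [m3, m2 a ha, m1]
  have hm315 : s3.mem 15 = Function.update (Function.update (s.mem 15) (Λ.L i)
      (min (CS (Λ.R i)) up)) (Λ.R i) (min (CS (Λ.L i)) up) := by rw [m3, m215]
  -- the mark of the base edge tells whether it is chosen already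
  have hM : s.mem 16 (Λ.B i) = 0 ↔ ∀ k, i < k → k < Λ.K → e k ≠ Λ.B i := by
    constructor
    · intro h k hk hk' he
      exact marks.mark k hk hk' (by rw [he]; exact h)
    · intro h
      by_contra hne
      obtain ⟨k, hk, hk', he, -⟩ := marks.marked _ hne
      exact h k hk hk' he
  rw [hM] at c1 c2 c3
  have hUL : s3.mem 15 (Λ.L i) = min (CS (Λ.R i)) up := by
    rw [hm315, Function.update_of_ne hLR, Function.update_self]
  have hUR : s3.mem 15 (Λ.R i) = min (CS (Λ.L i)) up := by rw [hm315, Function.update_self]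
  have hU : ∀ h, h ≠ Λ.L i → h ≠ Λ.R i → s3.mem 15 h = s.mem 15 h := fun h hl hr => by
    rw [hm315, Function.update_of_ne hr, Function.update_of_ne hl]
  have hUB : s3.mem 15 (Λ.B i) = s.mem 15 (Λ.B i) := hU _ hLB.symm hRB.symm
  have hUj : ∀ j, i + 1 ≤ j → j < Λ.K → s3.mem 15 (Λ.L j) = s.mem 15 (Λ.L j) ∧
      s3.mem 15 (Λ.R j) = s.mem 15 (Λ.R j) ∧ s3.mem 15 (Λ.B j) = s.mem 15 (Λ.B j) := by
    intro j hj hj'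
    obtain ⟨f1, f2, f3⟩ := Λ.L_fresh i j hj hj'
    obtain ⟨f4, f5, f6⟩ := Λ.R_fresh i j hj hj'
    exact ⟨hU _ f1.symm f4.symm, hU _ f2.symm f5.symm, hU _ f3.symm f6.symm⟩
  generalize hx : s3.reg 31 = x at c1 c2 c3
  generalize hX : s3.reg 32 = y at c1 c2 c3
  generalize hY : s3.reg 33 = z at c1 c2 c3
  have htri : Λ.tri i = {x, y, z} ∧ y ≠ x ∧ z ≠ x ∧ y ≠ z := by
    by_cases h1 : (∀ k, i < k → k < Λ.K → e k ≠ Λ.B i) ∧ up ≤ DL i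
    · obtain ⟨rfl, rfl, rfl⟩ := c1 h1
      exact ⟨Λ.toScheme.tri_eq_base i, hLB, hRB, hLR⟩
    · by_cases h2 : CS (Λ.L i) ≤ CS (Λ.R i)
      · obtain ⟨rfl, rfl, rfl⟩ := c2 h1 h2
        exact ⟨rfl, hLR.symm, hLB.symm, hRB⟩
      · obtain ⟨rfl, rfl, rfl⟩ := c3 h1 h2
        exact ⟨Λ.toScheme.tri_eq_right i, hLR, hRB.symm, hLB⟩
  have he' : ∀ j, i < j → Function.update e i x j = e j := fun j hj =>
    Function.update_of_ne hj.ne' _ _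
  have hcond : ∀ j, i ≤ j → ((∀ k, j < k → k < Λ.K → Function.update e i x k ≠ Λ.B j) ↔
      ∀ k, j < k → k < Λ.K → e k ≠ Λ.B j) := fun j hj =>
    forall_congr' fun k => forall_congr' fun hk => by rw [he' k (by omega)]
  apply WP.block
  simp only [wpOps, Op.wp, State.put_reg]
  simp only [hx, hX, hY, hr3 1 (by simp), fr.std.one, List.length,
    r3 6 (by simp), r2 6 (by simp), r16, and_true]
  refine ⟨⟨Function.update e i x, fr.congr ?_ ?_, ?_, ?_, ?_, ?_, ?_, ?_, ?_, ?_, ?_, ⟨?_, ?_⟩, ?_⟩,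
    by omega⟩
  · intro r hr
    simp only [State.put_reg]
    exact hr3 r (by omega)
  · intro a ha
    have : a ≠ 16 ∧ a ≠ 17 ∧ a ≠ 18 ∧ a ≠ 15 := by omega
    simp [this, hm3]
  · simp [hm3, mDL]
  · simp [hm3, mCS]
  · intro j hj hj'
    simp only [State.put_mem, reduceIte, Nat.reduceEqDiff]
    rcases Nat.eq_or_lt_of_le hj with rfl | hj
    · rw [hUL, hUB, hup]
    · obtain ⟨f1, -, f3⟩ := hUj j hj hj'
      rw [f1, f3, U_L j hj hj']
  · intro j hj hj'
    simp only [State.put_mem, reduceIte, Nat.reduceEqDiff]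
    rcases Nat.eq_or_lt_of_le hj with rfl | hj
    · rw [hUR, hUB, hup]
    · obtain ⟨-, f2, f3⟩ := hUj j hj hj'
      rw [f2, f3, U_R j hj hj']
  · intro h hh
    simp only [State.put_mem, reduceIte, Nat.reduceEqDiff]
    obtain ⟨g1, g2⟩ := hh i le_rfl hi
    rw [hU h g1 g2]
    exact U_root h fun j hj hj' => hh j (by omega) hj'
  · intro h
    simp only [State.put_mem, reduceIte, Nat.reduceEqDiff]
    by_cases g1 : h = Λ.L i
    · rw [g1, hUL]; omega
    by_cases g2 : h = Λ.R i
    · rw [g2, hUR]; omega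
    · rw [hU h g1 g2]; exact U_le h
  · intro j hj hj'
    simp only [State.put_mem, reduceIte, Nat.reduceEqDiff]
    rw [hcond j hj]
    rcases Nat.eq_or_lt_of_le hj with rfl | hj
    · rw [hUB, hup, Function.update_self]
      exact fun g1 g2 => (c1 ⟨g1, g2⟩).1
    · rw [(hUj j hj hj').2.2, he' j hj]
      exact e_base j hj hj'
  · intro j hj hj'
    simp only [State.put_mem, reduceIte, Nat.reduceEqDiff]
    rw [hcond j hj]
    rcases Nat.eq_or_lt_of_le hj with rfl | hj
    · rw [hUB, hup, Function.update_self]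
      exact fun g1 g2 => (c2 g1 g2).1
    · rw [(hUj j hj hj').2.2, he' j hj]
      exact e_left j hj hj'
  · intro j hj hj'
    simp only [State.put_mem, reduceIte, Nat.reduceEqDiff]
    rw [hcond j hj]
    rcases Nat.eq_or_lt_of_le hj with rfl | hj
    · rw [hUB, hup, Function.update_self]
      exact fun g1 g2 => (c3 g1 g2).1
    · rw [(hUj j hj hj').2.2, he' j hj]
      exact e_right j hj hj'
  · intro j hj hj'
    simp only [State.put_mem, reduceIte, Nat.reduceEqDiff, hm3 16 (by simp)]
    rw [Function.update_apply]
    split_ifs with g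
    · simp
    · rcases Nat.eq_or_lt_of_le hj with rfl | hj
      · exact absurd (Function.update_self _ _ _) g
      · rw [he' j hj]
        exact marks.mark j hj hj'
  · intro h
    simp only [State.put_mem, reduceIte, Nat.reduceEqDiff, hm3 16 (by simp), hm3 17 (by simp),
      hm3 18 (by simp)]
    by_cases g : h = x
    · intro _
      subst g
      simp only [Function.update_self]
      exact ⟨i, le_rfl, hi, Function.update_self _ _ _, htri⟩
    · simp only [Function.update_of_ne g]
      intro g1
      obtain ⟨j, hj, hj', h1, h2⟩ := marks.marked h g1
      exact ⟨j, by omega, hj', by rw [he' j hj, h1], h2⟩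
  · intro h
    simp only [State.put_mem, reduceIte, Nat.reduceEqDiff, hm3 16 (by simp)]
    rw [Function.update_apply]
    split_ifs
    · exact le_rfl
    · exact M_le h

lemma progDown_wp {W : ℕ} {Λ : Layout G} {inp : ℕ → ℕ} {s0 s : State} (hB : Bounds n Λ.m W)
    (hs : UpState Λ inp s0 Λ.K s) (hz : ∀ a, 15 ≤ a → ∀ k, s.mem a k = 0) :
    WP W progDown (fun s' t => FrontState Λ inp s' ∧
      (∃ D : Λ.Tables Λ.cost, Marks Λ.toScheme D.e 0 (s'.mem 16) (s'.mem 17) (s'.mem 18)) ∧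
      (∀ h, s'.mem 16 h ≤ 1) ∧ t ≤ 28 * n + 2) s := by
  have hcard := Λ.card_fin
  have hWn : Λ.K < W := by
    have := hB.word; have := hB.cube; have := hB.sq
    omega
  apply WP.seq
  apply WP.op
  simp only [Op.wp, hs.front.reg9]
  refine ⟨hWn, ?_⟩
  refine WP.loop (fun t s' => (∃ e, DownState Λ inp (s.mem 14) (s.mem 13) (Λ.K - t) e s') ∧
    s'.reg 6 = Λ.K - t) (fun _ => 27) Λ.K ?_ ?_ ?_ ?_
  · refine ⟨⟨id, hs.front.congr ?_ ?_, by simp, by simp, ?_, ?_, ?_, ?_, ?_, ?_, ?_, ⟨?_, ?_⟩, ?_⟩,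
      by simp⟩
    · intro r hr; simp [show r ≠ 6 by omega]
    · simp
    · intro j hj hj'; omega
    · intro j hj hj'; omega
    · intro h _; simp [hz]
    · intro h; simp [hz]
    · intro j hj hj'; omega
    · intro j hj hj'; omega
    · intro j hj hj'; omega
    · intro j hj hj'; omega
    · intro h hh; simp [hz] at hh
    · intro h; simp [hz]
  · rintro t ht s1 ⟨⟨e, hs1⟩, h6⟩
    obtain ⟨i, hi⟩ : ∃ i, Λ.K - t = i + 1 := ⟨Λ.K - t - 1, by omega⟩
    have hi' : Λ.K - (t + 1) = i := by omega
    rw [hi] at hs1 h6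
    rw [hi']
    refine ⟨by simp [Test.holds, h6, hs1.front.std.zero], ?_⟩
    exact progDownStep_wp hB (by omega) hs1 h6 hs.le hs.DL
  · rintro s1 ⟨⟨e, hs1⟩, h6⟩
    simp [Test.holds, h6, hs1.front.std.zero]
  · rintro s1 t ⟨⟨e, hs1⟩, h6⟩ ht
    rw [Nat.sub_self] at hs1
    refine ⟨hs1.front, ⟨{ CS := s.mem 14, DL := s.mem 13, U := s1.mem 15, e := e
                          CS_eq := fun h _ => hs.CS h
                          DL_eq := hs.DL
                          U_L := fun i hi => hs1.U_L i (Nat.zero_le _) hi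
                          U_R := fun i hi => hs1.U_R i (Nat.zero_le _) hi
                          U_root := fun h hh => hs1.U_root h fun j _ hj => hh j hj
                          e_base := fun i hi => hs1.e_base i (Nat.zero_le _) hi
                          e_left := fun i hi => hs1.e_left i (Nat.zero_le _) hi
                          e_right := fun i hi => hs1.e_right i (Nat.zero_le _) hi }, hs1.marks⟩,
      hs1.M_le, ?_⟩
    simp at ht
    omega

/-! ### The program: writing a cycle -/

/-- The list `l` is found in the array `f` from the index `a` on. -/
def Seg (f : ℕ → ℕ) (a : ℕ) (l : List ℕ) : Prop := ∀ i (hi : i < l.length), f (a + i) = l[i]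

lemma Seg.append {f : ℕ → ℕ} {a : ℕ} {l l' : List ℕ} (h : Seg f a l)
    (h' : Seg f (a + l.length) l') :
    Seg f a (l ++ l') := by
  intro i hi
  rw [List.getElem_append]
  split_ifs with h1
  · exact h i h1
  · have h2 := h' (i - l.length) (by rw [List.length_append] at hi; omega)
    rw [← h2]
    congr 1; omega

lemma Seg.update {f : ℕ → ℕ} {a : ℕ} {l : List ℕ} (h : Seg f a l) {b v : ℕ}
    (hb : b < a ∨ a + l.length ≤ b) : Seg (Function.update f b v) a l := by
  intro i hi
  rw [Function.update_of_ne (by omega)]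
  exact h i hi

lemma Seg.nil (f : ℕ → ℕ) (a : ℕ) : Seg f a [] := by intro i hi; simp at hi

lemma Seg.singleton {f : ℕ → ℕ} {a v : ℕ} (h : f a = v) : Seg f a [v] := by
  intro i hi
  obtain rfl : i = 0 := by simpa using hi
  simpa using h

/-- The ends of the edges of a list, as found in the input array. -/
def endsList (inp : ℕ → ℕ) (ol : List ℕ) : List ℕ :=
  ol.flatMap fun g => [inp (2 + 2 * g), inp (3 + 2 * g)]

lemma length_endsList (inp : ℕ → ℕ) (ol : List ℕ) : (endsList inp ol).length = 2 * ol.length := by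
  induction ol with
  | nil => rfl
  | cons g ol ih =>
    simp only [endsList, List.flatMap_cons, List.length_append, List.length_cons] at ih ⊢
    simp only [List.length_nil]
    omega

lemma endsList_append (inp : ℕ → ℕ) (ol : List ℕ) (g : ℕ) :
    endsList inp (ol ++ [g]) = endsList inp ol ++ [inp (2 + 2 * g), inp (3 + 2 * g)] := by
  simp [endsList]

/-- Write the ends of the edge in register `12`. -/
def progEmit : Program :=
  block (.add 13 12 12) [.add 13 13 4, .load 14 0 13, .store 1 8 14, .add 8 8 1, .add 13 13 1,
    .load 14 0 13, .store 1 8 14, .add 8 8 1]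

lemma progEmit_wp {W n m g o : ℕ} {inp : ℕ → ℕ} {s : State} (std : Std n m inp s)
    (h12 : s.reg 12 = g) (h8 : s.reg 8 = o) (og : 3 + 2 * g < W) (oo : o + 2 < W)
    (o1 : inp (2 + 2 * g) < W) (o2 : inp (3 + 2 * g) < W) :
    WP W progEmit (fun s' t => (∀ r, r < 13 → r ≠ 8 → s'.reg r = s.reg r) ∧ s'.reg 8 = o + 2 ∧
      s'.mem 1 = Function.update (Function.update (s.mem 1) o (inp (2 + 2 * g))) (o + 1)
        (inp (3 + 2 * g)) ∧ (∀ a, a ≠ 1 → s'.mem a = s.mem a) ∧ t = 9) s := by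
  have e1 : g + g + 2 = 2 + 2 * g := by omega
  have e2 : 2 + 2 * g + 1 = 3 + 2 * g := by omega
  have e3 : o + 1 + 1 = o + 2 := by omega
  have o3 : g + g < W := by omega
  have o4 : 2 + 2 * g < W := by omega
  have o5 : o + 1 < W := by omega
  apply WP.block
  simp only [wpOps, Op.wp, State.set_reg, State.set_mem, State.put_reg, State.put_mem]
  simp only [reduceIte, Nat.reduceEqDiff, zero_ne_one, OfNat.one_ne_ofNat, h12, h8, std.one,
    std.two, std.input, e1, e2, e3, o1, o2, o3, o4, o5, og, oo, true_and, and_true, List.length]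
  refine ⟨fun r hr h8 => ?_, fun a ha => by simp [ha]⟩
  have : r ≠ 13 ∧ r ≠ 14 := by omega
  simp [this, h8]

lemma Seg.emit {f inp : ℕ → ℕ} {a o g : ℕ} {ol : List ℕ} (h : Seg f a (endsList inp ol))
    (ho : o = a + 2 * ol.length) :
    Seg (Function.update (Function.update f o (inp (2 + 2 * g))) (o + 1) (inp (3 + 2 * g))) a
      (endsList inp (ol ++ [g])) := by
  have hl := length_endsList inp ol
  rw [endsList_append]
  refine Seg.append ((h.update (by omega)).update (by omega)) ?_
  rw [hl, ← ho]
  intro i hi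
  have : i = 0 ∨ i = 1 := by simp at hi; omega
  rcases this with rfl | rfl
  · show Function.update (Function.update f o _) (o + 1) _ o = _
    rw [Function.update_of_ne (by omega), Function.update_self]; rfl
  · rw [Function.update_self]; rfl

/-- Replace the edge in register `12` by the other two edges of its triangle, on the stack. -/
def progPush : Program :=
  block (.load 14 17 12) [.store 9 7 14, .add 7 7 1, .load 14 18 12, .store 9 7 14, .add 7 7 1]

lemma progPush_wp {W g sp : ℕ} {s : State} (h1 : s.reg 1 = 1) (h12 : s.reg 12 = g)
    (h7 : s.reg 7 = sp) (o1 : s.mem 17 g < W) (o2 : s.mem 18 g < W) (o3 : sp + 2 < W) :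
    WP W progPush (fun s' t => (∀ r, r < 13 → r ≠ 7 → s'.reg r = s.reg r) ∧ s'.reg 7 = sp + 2 ∧
      s'.mem 9 = Function.update (Function.update (s.mem 9) sp (s.mem 17 g)) (sp + 1) (s.mem 18 g) ∧
      (∀ a, a ≠ 9 → s'.mem a = s.mem a) ∧ t = 6) s := by
  have e3 : sp + 1 + 1 = sp + 2 := by omega
  have o5 : sp + 1 < W := by omega
  apply WP.block
  simp only [wpOps, Op.wp, State.set_reg, State.set_mem, State.put_reg, State.put_mem]
  simp only [reduceIte, Nat.reduceEqDiff, OfNat.one_ne_ofNat, h12, h7, h1, e3, o1, o2, o3, o5,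
    true_and, and_true, List.length]
  refine ⟨fun r hr h7 => ?_, fun a ha => by simp [ha]⟩
  have : r ≠ 14 := by omega
  simp [this, h7]

/-- The arrays `M`, `X`, `Y` describe the tree `τ` and the composition of its paths. -/
structure TreeData (Λ : Layout G) (τ : Λ.Tree) (M X Y : ℕ → ℕ) : Prop where
  sub : τ.T ⊆ Finset.range Λ.m
  zero : ∀ h < Λ.N, M h = 0 ↔ h ∈ τ.T
  le_one : ∀ h, M h ≤ 1
  split : ∀ h < Λ.N, M h ≠ 0 → X h < Λ.N ∧ Y h < Λ.N ∧ Disjoint (τ.path (X h)) (τ.path (Y h)) ∧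
    τ.path h = τ.path (X h) ∪ τ.path (Y h)

/-- The state while the output is written: the layout, and the arrays that describe the tree. -/
structure OutState (Λ : Layout G) (inp M X Y : ℕ → ℕ) (s : State) : Prop where
  front : FrontState Λ inp s
  M : s.mem 16 = M
  X : s.mem 17 = X
  Y : s.mem 18 = Y

lemma OutState.congr {Λ : Layout G} {inp M X Y : ℕ → ℕ} {s s' : State}
    (h : OutState Λ inp M X Y s) (hr : ∀ r, r < 5 ∨ r = 9 → s'.reg r = s.reg r)
    (hm : ∀ a, a ≠ 1 → a ≠ 9 → s'.mem a = s.mem a) : OutState Λ inp M X Y s' :=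
  ⟨h.front.congr hr fun a ha => hm a (by omega) (by omega), by rw [hm 16 (by simp) (by simp), h.M],
    by rw [hm 17 (by simp) (by simp), h.X], by rw [hm 18 (by simp) (by simp), h.Y]⟩

/-- Pop an edge, and write it if it is in the tree, otherwise replace it by the other two edges of
its triangle. -/
def progExpandStep : Program :=
  .seq (block (.sub 7 7 1) [.load 12 9 7, .load 10 16 12]) <| .ite (.eq 10 0) progEmit progPush

/-- The state after `r` rounds of writing the cycle of the edge `h`, behind the earlier output `out`
and a free cell: the edges in `ol` are written already, and the paths of the edges on the stack are
still to be written. The path of an edge `g` takes `2 * dist g - 1` rounds. -/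
structure ExpandState (Λ : Layout G) (τ : Λ.Tree) (inp M X Y : ℕ → ℕ) (out : List ℕ) (h r : ℕ)
    (ol : List ℕ) (s : State) : Prop where
  state : OutState Λ inp M X Y s
  reg6 : s.reg 6 = h
  reg11 : s.reg 11 = out.length
  lt : ∀ k < s.reg 7, s.mem 9 k < Λ.N
  perm : (ol : Multiset ℕ) + ∑ k ∈ Finset.range (s.reg 7), (τ.path (s.mem 9 k)).val
    = h ::ₘ (τ.path h).val
  pot : ∑ k ∈ Finset.range (s.reg 7), (2 * τ.dist (s.mem 9 k) - 1) + r = 2 * τ.dist h - 1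
  reg8 : s.reg 8 = out.length + 1 + 2 * ol.length
  prev : Seg (s.mem 1) 0 out
  seg : Seg (s.mem 1) (out.length + 1) (endsList inp ol)

lemma Scheme.Tree.dist_le {S : Scheme} (τ : S.Tree) (h : ℕ) : τ.dist h ≤ S.N := by
  have h1 : τ.path h ⊆ Finset.range S.N := (Finset.filter_subset _ _).trans τ.sub
  have h2 := Finset.card_le_card h1
  rw [Finset.card_range] at h2
  exact h2

lemma progExpandStep_wp {W h r : ℕ} {Λ : Layout G} {τ : Λ.Tree} {inp M X Y : ℕ → ℕ}
    {out ol : List ℕ} {s : State} (hD : TreeData Λ τ M X Y)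
    (hinp : ∀ g < Λ.m, inp (2 + 2 * g) < W ∧ inp (3 + 2 * g) < W)
    (hW : out.length + 4 * Λ.N + 10 < W) (hr : r < 2 * τ.dist h - 1)
    (hs : ExpandState Λ τ inp M X Y out h r ol s) :
    0 < s.reg 7 ∧ WP W progExpandStep (fun s' t =>
      (∃ ol', ExpandState Λ τ inp M X Y out h (r + 1) ol' s') ∧ t ≤ 13) s := by
  obtain ⟨st, h6, h11, hlt, hperm, hpot, h8, hprev, hseg⟩ := hs
  obtain ⟨sp, hsp⟩ : ∃ sp, s.reg 7 = sp + 1 := by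
    rcases Nat.eq_zero_or_pos (s.reg 7) with h0 | h0
    · rw [h0] at hpot; simp at hpot; omega
    · exact ⟨s.reg 7 - 1, by omega⟩
  refine ⟨by omega, ?_⟩
  have hdist := τ.dist_le h
  have hspd : s.reg 7 ≤ ∑ k ∈ Finset.range (s.reg 7), (2 * τ.dist (s.mem 9 k) - 1) := by
    have h1 : ∑ k ∈ Finset.range (s.reg 7), 1 ≤
        ∑ k ∈ Finset.range (s.reg 7), (2 * τ.dist (s.mem 9 k) - 1) := by
      refine Finset.sum_le_sum fun k hk => ?_
      have := τ.dist_pos (hlt k (Finset.mem_range.1 hk))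
      omega
    simpa using h1
  have hsp2 : s.reg 7 ≤ 2 * τ.dist h - 1 := by omega
  have hlen : ol.length ≤ Λ.N + 1 := by
    have h1 := congrArg Multiset.card hperm
    rw [Multiset.card_add, Multiset.card_cons, Multiset.coe_card] at h1
    have h2 : (τ.path h).val.card = τ.dist h := rfl
    omega
  rw [hsp] at hlt hperm hpot hsp2
  rw [Finset.sum_range_succ] at hperm hpot
  have hg := hlt sp (by omega)
  generalize hgd : s.mem 9 sp = g at hperm hpot hg
  have hM1 := hD.le_one g
  apply WP.seq
  refine WP.mono (Q := fun s' t => (∀ r, r < 10 → r ≠ 7 → s'.reg r = s.reg r) ∧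
    s'.reg 11 = s.reg 11 ∧ s'.reg 7 = sp ∧
    s'.reg 12 = g ∧ s'.reg 10 = M g ∧ s'.mem = s.mem ∧ t = 3) ?_ ?_
  · apply WP.block
    simp only [wpOps, Op.wp, State.set_reg, State.set_mem]
    simp only [reduceIte, Nat.reduceEqDiff, st.front.std.one, hsp, Nat.add_sub_cancel, hgd, st.M,
      and_true, List.length]
    refine ⟨by omega, by omega, by omega, fun r hr h7 => ?_⟩
    have : r ≠ 10 ∧ r ≠ 12 := by omega
    simp [this, h7]
  rintro s1 t1 ⟨r1, r111, r17, r112, r110, m1, rfl⟩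
  have st1 : OutState Λ inp M X Y s1 := st.congr (fun r hr => r1 r (by omega) (by omega))
    (fun a _ _ => by rw [m1])
  apply WP.ite
  · intro hc
    have hc' : M g = 0 := by simpa [Test.holds, st1.front.std.zero, r110] using hc
    have hgT := (hD.zero g hg).1 hc'
    have hgm : g < Λ.m := by simpa using hD.sub hgT
    have hpath := τ.path_of_mem hgT
    have hdist1 := τ.dist_of_mem hgT
    have hmN := Λ.m_le
    refine (progEmit_wp st1.front.std r112 (o := out.length + 1 + 2 * ol.length)
      (by rw [r1 8 (by simp) (by simp), h8]) (by omega) (by omega) (hinp g hgm).1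
      (hinp g hgm).2).mono ?_
    rintro s2 t2 ⟨r2, r28, m21, m2, rfl⟩
    rw [m1] at m21
    refine ⟨⟨ol ++ [g], st1.congr (fun r hr => r2 r (by omega) (by omega)) (fun a ha _ => m2 a ha),
      ?_, ?_, ?_, ?_, ?_, ?_, ?_, ?_⟩, by omega⟩
    · rw [r2 6 (by simp) (by simp), r1 6 (by simp) (by simp), h6]
    · rw [r2 11 (by simp) (by simp), r111, h11]
    · rw [r2 7 (by simp) (by simp), r17, m2 9 (by simp), m1]
      exact fun k hk => hlt k (by omega)
    · rw [r2 7 (by simp) (by simp), r17, m2 9 (by simp), m1, ← hperm, hpath, ← Multiset.coe_add,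
        Finset.singleton_val, Multiset.coe_singleton, add_assoc, add_comm ({g} : Multiset ℕ)]
    · rw [r2 7 (by simp) (by simp), r17, m2 9 (by simp), m1, ← hpot, hdist1]
      omega
    · rw [r28, List.length_append]; simp; omega
    · rw [m21]
      exact (hprev.update (by omega)).update (by omega)
    · rw [m21]
      exact hseg.emit rfl
  · intro hc
    have hc' : M g ≠ 0 := by simpa [Test.holds, st1.front.std.zero, r110] using hc
    obtain ⟨hX, hY, hdis, hun⟩ := hD.split g hg hc'
    have hdu : τ.dist g = τ.dist (X g) + τ.dist (Y g) := by
      rw [Scheme.Tree.dist, hun, Finset.card_union_of_disjoint hdis]; rfl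
    have hval : (τ.path g).val = (τ.path (X g)).val + (τ.path (Y g)).val := by
      rw [hun, ← Finset.disjUnion_eq_union _ _ hdis]; rfl
    have dX := τ.dist_pos hX
    have dY := τ.dist_pos hY
    refine (progPush_wp st1.front.std.one r112 r17 (by rw [st1.X]; omega) (by rw [st1.Y]; omega)
      (by omega)).mono ?_
    rintro s2 t2 ⟨r2, r27, m29, m2, rfl⟩
    rw [st1.X, st1.Y, m1] at m29
    have hk : ∀ k < sp, s2.mem 9 k = s.mem 9 k := fun k hk => by
      rw [m29, Function.update_of_ne (by omega), Function.update_of_ne (by omega)]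
    have hk0 : s2.mem 9 sp = X g := by
      rw [m29, Function.update_of_ne (by omega), Function.update_self]
    have hk1 : s2.mem 9 (sp + 1) = Y g := by rw [m29, Function.update_self]
    refine ⟨⟨ol, st1.congr (fun r hr => r2 r (by omega) (by omega)) (fun a _ ha => m2 a ha),
      ?_, ?_, ?_, ?_, ?_, ?_, ?_, ?_⟩, by omega⟩
    · rw [r2 6 (by simp) (by simp), r1 6 (by simp) (by simp), h6]
    · rw [r2 11 (by simp) (by simp), r111, h11]
    · rw [r27]
      intro k hk'
      by_cases g1 : k = sp
      · rw [g1, hk0]; exact hX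
      by_cases g2 : k = sp + 1
      · rw [g2, hk1]; exact hY
      · rw [hk k (by omega)]; exact hlt k (by omega)
    · rw [r27, Finset.sum_range_succ, Finset.sum_range_succ, hk0, hk1, ← hperm, hval]
      rw [Finset.sum_congr rfl fun k hk' => by rw [hk k (Finset.mem_range.1 hk')]]
      rw [add_assoc (∑ k ∈ Finset.range sp, _)]
    · rw [r27, Finset.sum_range_succ, Finset.sum_range_succ, hk0, hk1, ← hpot, hdu]
      rw [Finset.sum_congr rfl fun k hk' => by rw [hk k (Finset.mem_range.1 hk')]]
      omega
    · rw [r2 8 (by simp) (by simp), r1 8 (by simp) (by simp), h8]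
    · rw [m2 1 (by simp), m1]; exact hprev
    · rw [m2 1 (by simp), m1]; exact hseg

/-! ### The program: writing all cycles -/

/-- The marks describe the spanning tree of the edges that are not chosen. -/
lemma Marks.treeData {Λ : Layout G} (D : Λ.Tables Λ.cost) {τ : Λ.Tree} {M X Y : ℕ → ℕ}
    (hM : Marks Λ.toScheme D.e 0 M X Y) (hle : ∀ h, M h ≤ 1) (hT : τ.T = Λ.T 0 D.e)
    (hsub : τ.T ⊆ Finset.range Λ.m) : TreeData Λ τ M X Y := by
  have hd : ∀ j < Λ.K, D.e j ∉ τ.T := fun j hj hmem => by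
    rw [hT, Scheme.mem_T] at hmem
    exact hmem.2 j (Nat.zero_le _) hj rfl
  refine ⟨hsub, fun h hh => ⟨fun h0 => ?_, fun hmem => ?_⟩, hle, fun h _ h0 => ?_⟩
  · rw [hT, Scheme.mem_T, Scheme.E_zero, Finset.mem_range]
    exact ⟨hh, fun j _ hj he => hM.mark j (Nat.zero_le _) hj (he ▸ h0)⟩
  · by_contra h0
    obtain ⟨j, -, hj, rfl, -⟩ := hM.marked h h0
    exact hd j hj hmem
  · obtain ⟨j, -, hj, rfl, htri, h1, h2, h3⟩ := hM.marked h h0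
    have hlt : ∀ x ∈ Λ.tri j, x < Λ.N := fun x hx => by
      rcases Scheme.mem_tri.1 hx with rfl | rfl | rfl
      exacts [Λ.L_lt j hj, Λ.R_lt j hj, Λ.B_lt j hj]
    exact ⟨hlt _ (by simp [htri]), hlt _ (by simp [htri]),
      τ.path_choice D.isChoice hd hj htri h1 h2 h3⟩

/-- The stack is empty when the rounds are used up. -/
lemma ExpandState.reg7 {Λ : Layout G} {τ : Λ.Tree} {inp M X Y : ℕ → ℕ} {out ol : List ℕ} {h : ℕ}
    {s : State} (hs : ExpandState Λ τ inp M X Y out h (2 * τ.dist h - 1) ol s) : s.reg 7 = 0 := by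
  by_contra h0
  have hpot := hs.pot
  have h1 : 2 * τ.dist (s.mem 9 0) - 1 ≤
      ∑ k ∈ Finset.range (s.reg 7), (2 * τ.dist (s.mem 9 k) - 1) :=
    Finset.single_le_sum (f := fun k => 2 * τ.dist (s.mem 9 k) - 1) (fun _ _ => Nat.zero_le _)
      (Finset.mem_range.2 (by omega))
  have h2 := τ.dist_pos (hs.lt 0 (by omega))
  omega

/-- Write the cycle of the edge in register `6`: the edge itself, and then its path, which is
expanded from the stack. The number of edges is known, and written, only at the end. -/
def progCycle : Program :=
  .seq (block (.copy 11 8) [.add 8 8 1, .copy 12 6, .store 9 7 12, .add 7 7 1]) <|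
  .seq progEmit <| .seq (.loop (.lt 0 7) progExpandStep) <|
  block (.sub 13 8 11) [.div 13 13 4, .store 1 11 13, .add 6 6 1]

lemma progCycle_wp {W h : ℕ} {Λ : Layout G} {τ : Λ.Tree} {inp M X Y : ℕ → ℕ}
    {out : List ℕ} {s : State} (hD : TreeData Λ τ M X Y)
    (hinp : ∀ g < Λ.m, inp (2 + 2 * g) < W ∧ inp (3 + 2 * g) < W)
    (hW : out.length + 4 * Λ.N + 10 < W) (hh : h < Λ.m)
    (st : OutState Λ inp M X Y s) (h6 : s.reg 6 = h) (h7 : s.reg 7 = 0)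
    (h8 : s.reg 8 = out.length) (hprev : Seg (s.mem 1) 0 out) :
    WP W progCycle (fun s' t => OutState Λ inp M X Y s' ∧ s'.reg 6 = h + 1 ∧ s'.reg 7 = 0 ∧
      (∃ ol : List ℕ, (ol : Multiset ℕ) = h ::ₘ (τ.path h).val ∧
        Seg (s'.mem 1) 0 (out ++ ol.length :: endsList inp ol) ∧
        s'.reg 8 = out.length + (1 + 2 * ol.length)) ∧ t ≤ 28 * τ.dist h + 5) s := by
  have hmN := Λ.m_le
  have hpos := τ.dist_pos (show h < Λ.N by omega)
  have hdist := τ.dist_le h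
  apply WP.seq
  refine WP.mono (Q := fun s' t => (∀ r, r < 7 → s'.reg r = s.reg r) ∧ s'.reg 9 = s.reg 9 ∧
    s'.reg 7 = 1 ∧ s'.reg 8 = out.length + 1 ∧ s'.reg 11 = out.length ∧ s'.reg 12 = h ∧
    s'.mem 9 = Function.update (s.mem 9) 0 h ∧ (∀ a, a ≠ 9 → s'.mem a = s.mem a) ∧ t = 5) ?_ ?_
  · have o1 : out.length < W := by omega
    have o2 : out.length + 1 < W := by omega
    have o3 : h < W := by omega
    have o4 : 0 + 1 < W := by omega
    apply WP.block
    simp only [wpOps, Op.wp, State.set_reg, State.set_mem, State.put_reg, State.put_mem]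
    simp only [reduceIte, Nat.reduceEqDiff, st.front.std.one, h6, h7, h8, o1, o2, o3, o4, true_and,
      and_true, List.length, OfNat.one_ne_ofNat]
    refine ⟨fun r hr => ?_, fun a ha => by simp [ha]⟩
    have : r ≠ 7 ∧ r ≠ 8 ∧ r ≠ 11 ∧ r ≠ 12 := by omega
    simp [this]
  rintro s1 t1 ⟨r1, r19, r17, r18, r111, r112, m19, m1, rfl⟩
  have st1 : OutState Λ inp M X Y s1 := st.congr
    (fun r hr => by
      rcases hr with hr | rfl
      exacts [r1 r (by omega), r19]) (fun a _ ha => m1 a ha)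
  apply WP.seq
  refine (progEmit_wp st1.front.std r112 r18 (by omega) (by omega) (hinp h hh).1
    (hinp h hh).2).mono ?_
  rintro s2 t2 ⟨r2, r28, m21, m2, rfl⟩
  rw [m1 1 (by simp)] at m21
  have hseg : Seg (s2.mem 1) (out.length + 1) (endsList inp [h]) := by
    rw [m21]
    exact (Seg.nil (s.mem 1) (out.length + 1)).emit (ol := []) (by simp)
  have hex : ExpandState Λ τ inp M X Y out h 0 [h] s2 := by
    have e7 : s2.reg 7 = 1 := by rw [r2 7 (by simp) (by simp), r17]
    have e9 : s2.mem 9 0 = h := by rw [m2 9 (by simp), m19, Function.update_self]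
    refine ⟨st1.congr (fun r hr => r2 r (by omega) (by omega)) (fun a ha _ => m2 a ha), ?_, ?_, ?_,
      ?_, ?_, ?_, ?_, hseg⟩
    · rw [r2 6 (by simp) (by simp), r1 6 (by simp), h6]
    · rw [r2 11 (by simp) (by simp), r111]
    · intro k hk
      obtain rfl : k = 0 := by omega
      omega
    · rw [e7, Finset.sum_range_one, e9]; rfl
    · rw [e7, Finset.sum_range_one, e9]; rfl
    · rw [r28]; simp
    · rw [m21]
      exact (hprev.update (by omega)).update (by omega)
  apply WP.seq
  refine WP.loop (I := fun r s => ∃ ol, ExpandState Λ τ inp M X Y out h r ol s) (c := fun _ => 13)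
    (N := 2 * τ.dist h - 1) ⟨[h], hex⟩ ?_ ?_ ?_
  · rintro r hr s ⟨ol, hs⟩
    obtain ⟨hp, hwp⟩ := progExpandStep_wp hD hinp hW hr hs
    exact ⟨by simpa [Test.holds, hs.state.front.std.zero] using hp, hwp⟩
  · rintro s ⟨ol, hs⟩
    simp [Test.holds, hs.reg7]
  rintro s3 t3 ⟨ol, hs⟩ ht3
  have hz := hs.reg7
  obtain ⟨st3, e6, e11, -, hperm, -, e8, hprev3, hseg3⟩ := hs
  rw [hz, Finset.sum_range_zero, add_zero] at hperm
  have hlen : ol.length = τ.dist h + 1 := by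
    have h1 := congrArg Multiset.card hperm
    rwa [Multiset.card_cons, Multiset.coe_card] at h1
  have ht3' : t3 ≤ (2 * τ.dist h - 1) * 14 + 1 := by simpa using ht3
  have q1 : out.length + 1 + 2 * ol.length - out.length = 1 + 2 * ol.length := by omega
  have q2 : (1 + 2 * ol.length) / 2 = ol.length := by omega
  have o1 : 1 + 2 * ol.length < W := by omega
  have o2 : ol.length < W := by omega
  have o3 : h + 1 < W := by omega
  apply WP.block
  simp only [wpOps, Op.wp, State.set_reg, State.set_mem, State.put_reg, State.put_mem]
  simp only [reduceIte, Nat.reduceEqDiff, st3.front.std.one, st3.front.std.two, e6, e8, e11, hz,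
    q1, q2, o1, o2, o3, true_and, List.length, OfNat.one_ne_ofNat]
  refine ⟨?_, ⟨ol, hperm, ?_, by omega⟩, by omega⟩
  · apply st3.congr
    · intro r hr
      have : r ≠ 6 ∧ r ≠ 13 := by omega
      simp [this]
    · intro a ha _
      simp [ha]
  · refine Seg.append (hprev3.update (by omega)) ?_
    rw [zero_add]
    refine Seg.append (l := [ol.length]) (Seg.singleton (by rw [Function.update_self])) ?_
    exact hseg3.update (by omega)

/-- The words that are written for cycles with given lists of edges. -/
def cyclesList (inp : ℕ → ℕ) (ols : List (List ℕ)) : List ℕ :=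
  ols.flatMap fun ol => ol.length :: endsList inp ol

/-- Write the number of cycles, which is `m + 1 - n`, and the cycles of the marked edges of the
graph. -/
def progOut : Program :=
  .seq (block (.add 10 3 1) [.sub 10 10 2, .store 1 0 10, .copy 8 1, .copy 6 0, .copy 7 0]) <|
  .loop (.lt 6 3) <| .seq (.op (.load 10 16 6)) <| .ite (.eq 10 0) (.op (.add 6 6 1)) progCycle

/-- The state after the edges below `h` have been treated. -/
structure CyclesState (Λ : Layout G) (τ : Λ.Tree) (inp M X Y : ℕ → ℕ) (k h : ℕ)
    (ols : List (List ℕ)) (s : State) : Prop where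
  state : OutState Λ inp M X Y s
  reg6 : s.reg 6 = h
  reg7 : s.reg 7 = 0
  reg8 : s.reg 8 = (k :: cyclesList inp ols).length
  le : (k :: cyclesList inp ols).length ≤ 1 + h * (3 + 2 * Λ.N)
  seg : Seg (s.mem 1) 0 (k :: cyclesList inp ols)
  cycles : List.Forall₂ (fun (g : ℕ) (ol : List ℕ) => (ol : Multiset ℕ) = g ::ₘ (τ.path g).val)
    ((List.range h).filter fun g => M g ≠ 0) ols

/-- The steps are counted by `4` for each edge and `28 * dist h + 4` for each cycle. -/
lemma progOut_wp {W : ℕ} {Λ : Layout G} {τ : Λ.Tree} {inp M X Y : ℕ → ℕ} {s : State}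
    (hB : Bounds n Λ.m W) (hD : TreeData Λ τ M X Y)
    (hinp : ∀ g < Λ.m, inp (2 + 2 * g) < n ∧ inp (3 + 2 * g) < n) (st : OutState Λ inp M X Y s) :
    WP W progOut (fun s' t =>
      (∃ ols, CyclesState Λ τ inp M X Y (Λ.m + 1 - n) Λ.m ols s') ∧
      t ≤ 7 + 4 * Λ.m + ∑ h ∈ Finset.range Λ.m \ τ.T, (28 * τ.dist h + 4)) s := by
  have hmN := Λ.m_le
  have hcard := Λ.card_fin
  have hN := Λ.card
  obtain ⟨b1, b2, b3, b4, b5⟩ := hB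
  have hbound : ∀ h ≤ Λ.m, h * (3 + 2 * Λ.N) ≤ 8 * (n * n) := fun h hh => by
    calc h * (3 + 2 * Λ.N) ≤ (2 * n) * (4 * n) := Nat.mul_le_mul (by omega) (by omega)
      _ = 8 * (n * n) := by ring
  apply WP.seq
  refine WP.mono (Q := fun s' t => (∀ r, r < 6 ∨ r = 9 → s'.reg r = s.reg r) ∧ s'.reg 6 = 0 ∧
    s'.reg 7 = 0 ∧ s'.reg 8 = 1 ∧ s'.mem 1 = Function.update (s.mem 1) 0 (Λ.m + 1 - n) ∧
    (∀ a, a ≠ 1 → s'.mem a = s.mem a) ∧ t = 6) ?_ ?_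
  · have o1 : Λ.m + 1 < W := by omega
    have o2 : Λ.m + 1 - n < W := by omega
    have o3 : 1 < W := by omega
    have o4 : 0 < W := by omega
    apply WP.block
    simp only [wpOps, Op.wp, State.set_reg, State.set_mem, State.put_reg, State.put_mem]
    simp only [reduceIte, Nat.reduceEqDiff, st.front.std.one, st.front.std.zero, st.front.std.size,
      st.front.std.edges, o1, o2, o3, o4, true_and, and_true, List.length, OfNat.one_ne_ofNat,
      OfNat.zero_ne_ofNat]
    refine ⟨fun r hr => ?_, fun a ha => by simp [ha]⟩
    have : r ≠ 6 ∧ r ≠ 7 ∧ r ≠ 8 ∧ r ≠ 10 := by omega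
    simp [this]
  rintro s1 t1 ⟨r1, r16, r17, r18, m11, m1, rfl⟩
  refine WP.loop (I := fun h s => ∃ ols, CyclesState Λ τ inp M X Y (Λ.m + 1 - n) h ols s)
    (c := fun h => 3 + if M h ≠ 0 then 28 * τ.dist h + 4 else 0) (N := Λ.m)
    ⟨[], ?_, r16, r17, r18, by simp [cyclesList], ?_, by simp⟩ ?_ ?_ ?_
  · exact st.congr (fun r hr => r1 r (by omega)) fun a ha _ => m1 a ha
  · exact Seg.singleton (by rw [m11, Function.update_self])
  · rintro h hh s2 ⟨ols, st2, e6, e7, e8, hle, hseg, hcyc⟩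
    refine ⟨by simp [Test.holds, e6, st2.front.std.edges, hh], ?_⟩
    have hM1 := hD.le_one h
    apply WP.seq
    refine WP.op ?_
    simp only [Op.wp]
    rw [e6, st2.M]
    refine ⟨by omega, ?_⟩
    have st3 : OutState Λ inp M X Y (s2.set 10 (M h)) := st2.congr
      (fun r hr => by
        have : r ≠ 10 := by omega
        simp [this]) fun a _ _ => rfl
    apply WP.ite
    · intro hc
      have h0 : M h = 0 := by simpa [Test.holds, st2.front.std.zero] using hc
      refine WP.op ?_
      have o1 : h + 1 < W := by omega
      simp only [Op.wp, State.set_reg]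
      simp only [reduceIte, Nat.reduceEqDiff, e6, st2.front.std.one, OfNat.one_ne_ofNat, o1,
        true_and]
      refine ⟨⟨ols, st3.congr (fun r hr => ?_) fun a _ _ => rfl, ?_, ?_, ?_, ?_, hseg, ?_⟩,
        by simp [h0]⟩
      · have : r ≠ 6 := by omega
        simp [this]
      · simp
      · simpa using e7
      · simpa using e8
      · refine hle.trans ?_
        rw [add_mul]; omega
      · simpa [List.range_succ, h0] using hcyc
    · intro hc
      have h0 : M h ≠ 0 := by simpa [Test.holds, st2.front.std.zero] using hc
      have hb := hbound h hh.le
      refine (progCycle_wp (out := (Λ.m + 1 - n) :: cyclesList inp ols) hD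
        (fun g hg => ⟨?_, ?_⟩) (by omega) hh st3 (by simpa using e6) (by simpa using e7)
        (by simpa using e8) hseg).mono ?_
      · have := (hinp g hg).1; omega
      · have := (hinp g hg).2; omega
      rintro s4 t4 ⟨st4, f6, f7, ⟨ol, hol, hseg4, f8⟩, ht4⟩
      have hlen : ol.length = τ.dist h + 1 := by
        have h1 := congrArg Multiset.card hol
        rwa [Multiset.card_cons, Multiset.coe_card] at h1
      have hdist := τ.dist_le h
      have happ : (Λ.m + 1 - n) :: cyclesList inp (ols ++ [ol]) =
          ((Λ.m + 1 - n) :: cyclesList inp ols) ++ ol.length :: endsList inp ol := by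
        simp [cyclesList]
      have hlen2 : ((Λ.m + 1 - n) :: cyclesList inp (ols ++ [ol])).length =
          ((Λ.m + 1 - n) :: cyclesList inp ols).length + (1 + 2 * ol.length) := by
        rw [happ, List.length_append, List.length_cons (a := ol.length), length_endsList]
        omega
      refine ⟨⟨ols ++ [ol], st4, f6, f7, ?_, ?_, ?_, ?_⟩, ?_⟩
      · rw [f8, hlen2]
      · rw [hlen2, add_mul]; omega
      · rw [happ]; exact hseg4
      · rw [List.range_succ, List.filter_append]
        have : List.filter (fun g => decide (M g ≠ 0)) [h] = [h] := by simp [h0]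
        rw [this]
        exact List.rel_append hcyc (.cons hol .nil)
      · rw [if_pos h0]; omega
  · rintro s2 ⟨ols, hs⟩
    simp [Test.holds, hs.reg6, hs.state.front.std.edges]
  · intro s2 t2 hs ht
    refine ⟨hs, ?_⟩
    have hsum : ∑ h ∈ Finset.range Λ.m, (3 + (if M h ≠ 0 then 28 * τ.dist h + 4 else 0) + 1) =
        4 * Λ.m + ∑ h ∈ Finset.range Λ.m \ τ.T, (28 * τ.dist h + 4) := by
      have hset : Finset.range Λ.m \ τ.T = (Finset.range Λ.m).filter fun h => M h ≠ 0 := by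
        ext h
        rw [Finset.mem_sdiff, Finset.mem_filter]
        refine and_congr_right fun hh => ?_
        rw [← hD.zero h (by rw [Finset.mem_range] at hh; omega)]
      rw [hset, Finset.sum_filter, Finset.sum_add_distrib, Finset.sum_add_distrib]
      simp
      omega
    rw [hsum] at ht
    omega

/-! ### The output and the running time -/

/-- A list of the numbers in `S` gives a list of the edges with these numbers. -/
lemma enumerates_map {pr : ℕ → Fin n × Fin n} {en : ℕ → Sym2 (Fin n)} {S : Finset ℕ} {ol : List ℕ}
    (hol : (ol : Multiset ℕ) = S.val) (hen : ∀ h ∈ S, en h = s((pr h).1, (pr h).2))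
    (hinj : Set.InjOn en S) :
    Enumerates (ol.map pr) ((S.image en : Finset (Sym2 (Fin n))) : Set (Sym2 (Fin n))) := by
  have hmem : ∀ h, h ∈ ol ↔ h ∈ S := fun h => by
    rw [← Multiset.mem_coe, hol, Finset.mem_val]
  have hnd : ol.Nodup := by
    rw [← Multiset.coe_nodup, hol]
    exact S.nodup
  have hmap : (ol.map pr).map (fun p => s(p.1, p.2)) = ol.map en := by
    rw [List.map_map]
    exact List.map_congr_left fun h hh => (hen h ((hmem h).1 hh)).symm
  rw [Enumerates, hmap]
  refine ⟨hnd.map_on fun x hx y hy => hinj ((hmem x).1 hx) ((hmem y).1 hy), fun e => ?_⟩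
  simp [hmem]

lemma flatMap_encodeEdges {m : ℕ} {inp : ℕ → ℕ} {pr : ℕ → Fin n × Fin n}
    (hin : GraphInput G m inp pr) (ols : List (List ℕ)) (hlt : ∀ ol ∈ ols, ∀ h ∈ ol, h < m) :
    (ols.map (List.map pr)).flatMap encodeEdges = cyclesList inp ols := by
  rw [List.flatMap_map, cyclesList]
  refine List.flatMap_congr fun ol hol => ?_
  rw [encodeEdges, List.length_map, List.flatMap_map, endsList]
  congr 1
  refine List.flatMap_congr fun h hh => ?_
  rw [hin.left h (hlt ol hol h hh), hin.right h (hlt ol hol h hh)]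

/-- The words that are written encode the basis. -/
lemma encodesCycles {Λ : Layout G} {τ : Λ.Tree} {inp M X Y : ℕ → ℕ} {pr : ℕ → Fin n × Fin n}
    {ols : List (List ℕ)} {B : Finset (Finset (Sym2 (Fin n)))} (hin : GraphInput G Λ.m inp pr)
    (hen : ∀ h < Λ.m, Λ.en h = s((pr h).1, (pr h).2)) (hD : TreeData Λ τ M X Y)
    (hB : B = (Finset.range Λ.m \ τ.T).image fun h => (insert h (τ.path h)).image Λ.en)
    (hinj : ∀ h ∈ Finset.range Λ.m \ τ.T, ∀ h' ∈ Finset.range Λ.m \ τ.T,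
      (insert h (τ.path h)).image Λ.en = (insert h' (τ.path h')).image Λ.en → h = h')
    (hcyc : List.Forall₂ (fun (g : ℕ) (ol : List ℕ) => (ol : Multiset ℕ) = g ::ₘ (τ.path g).val)
      ((List.range Λ.m).filter fun g => M g ≠ 0) ols) :
    EncodesCycles B ((Λ.m + 1 - n) :: cyclesList inp ols) := by
  set gs := (List.range Λ.m).filter fun g => M g ≠ 0 with hgs
  have hmN := Λ.m_le
  have hmem : ∀ g, g ∈ gs ↔ g ∈ Finset.range Λ.m \ τ.T := fun g => by
    rw [hgs, List.mem_filter, List.mem_range, Finset.mem_sdiff, Finset.mem_range]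
    refine and_congr_right fun hg => ?_
    rw [← hD.zero g (by omega), decide_eq_true_iff]
  have hnd : gs.Nodup := List.nodup_range.filter _
  have hlen : gs.length = Λ.m + 1 - n := by
    have h1 : gs.toFinset = Finset.range Λ.m \ τ.T := by ext g; rw [List.mem_toFinset, hmem]
    have h2 := Λ.card_fin
    rw [← List.toFinset_card_of_nodup hnd, h1, Finset.card_sdiff_of_subset hD.sub,
      Finset.card_range, τ.card]
    omega
  have hpath : ∀ g, τ.path g ⊆ τ.T := fun g => Finset.filter_subset _ _
  have hcyc' : List.Forall₂ (fun (g : ℕ) (ol : List ℕ) => (g < Λ.m) ∧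
      (ol : Multiset ℕ) = (insert g (τ.path g)).val) gs ols := by
    refine ((List.forall₂_and_left _ _).2 ⟨fun g hg => (hmem g).1 hg, hcyc⟩).imp fun g ol h => ?_
    have h1 := Finset.mem_sdiff.1 h.1
    refine ⟨Finset.mem_range.1 h1.1, ?_⟩
    rw [Finset.insert_val_of_notMem fun h2 => h1.2 (hpath g h2), h.2]
  have hins : ∀ g < Λ.m, ∀ h ∈ insert g (τ.path g), h < Λ.m := fun g hg h hh => by
    rcases Finset.mem_insert.1 hh with rfl | hh
    · exact hg
    · exact Finset.mem_range.1 (hD.sub (hpath g hh))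
  have hlt : ∀ ol ∈ ols, ∀ h ∈ ol, h < Λ.m := by
    intro ol hol
    obtain ⟨i, hi, rfl⟩ := List.getElem_of_mem hol
    have hi' : i < gs.length := hcyc.length_eq ▸ hi
    obtain ⟨h1, h2⟩ := hcyc'.get hi' hi
    intro h hh
    refine hins _ h1 h ?_
    rw [← Finset.mem_val, ← h2]
    exact hh
  refine ⟨gs.map fun g => (insert g (τ.path g)).image Λ.en, ols.map (List.map pr), ?_, ?_, ?_, ?_⟩
  · exact hnd.map_on fun x hx y hy => hinj x ((hmem x).1 hx) y ((hmem y).1 hy)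
  · intro C
    rw [hB, Finset.mem_image, List.mem_map]
    simp only [hmem]
  · rw [bind_pure_comp, List.map_eq_map, List.forall₂_map_left_iff, List.forall₂_map_right_iff,
      List.forall₂_map_right_iff]
    refine hcyc'.flip.imp fun ol g h => ?_
    exact enumerates_map h.2 (fun x hx => hen x (hins g h.1 x hx))
      fun x hx y hy => Λ.inj x (hins g h.1 x hx) y (hins g h.1 y hy)
  · rw [flatMap_encodeEdges hin ols hlt, List.length_map, ← hcyc.length_eq, hlen]

/-- The algorithm. -/
def program : Program := .seq progFront <| .seq progUp <| .seq progDown progOut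

/-- Words below `n ^ 10` suffice. -/
lemma bounds_pow {m : ℕ} (hn : 3 ≤ n) (hm : m ≤ n * n) : Bounds n m (n ^ 10) := by
  refine ⟨hn, hm, Nat.le_mul_of_pos_left n (by omega), Nat.le_mul_of_pos_right _ (by omega), ?_⟩
  have h1 : 100 ≤ n ^ 7 := le_trans (by norm_num) (Nat.pow_le_pow_left hn 7)
  calc 100 * (n * n * n) ≤ n ^ 7 * (n * n * n) := Nat.mul_le_mul_right _ h1
    _ = n ^ 10 := by ring

/-- The program writes a minimum fundamental cycle basis in a linear number of steps. -/
lemma program_wp (hG : IsPolygonalTwoTree G) {input : List ℕ} (henc : EncodesGraph G input) :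
    3 ≤ n ∧ ∃ (B : Finset (Finset (Sym2 (Fin n)))) (output : List ℕ),
      IsMinFundamentalCycleBasis G B ∧ EncodesCycles B output ∧
      WP (n ^ 10) program (fun s t => s.Outputs output ∧ t ≤ 300 * (n + size B))
        (State.init input) := by
  have hn := hG.three_le
  obtain ⟨m, pr, hin⟩ := henc.exists_input (by omega)
  have hB := bounds_pow hn hin.le
  refine ⟨hn, ?_⟩
  obtain ⟨s1, t1, hr1, Λ, rfl, hen, hf1, h14, hz1, ht1⟩ := progFront_wp hG hin hB
    (s := State.init input) rfl (by simp [State.init]) (by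
      intro a ha k
      simp [State.init, ha])
  obtain ⟨s2, t2, hr2, hup, ht2⟩ := progUp_wp hB hf1 h14
  obtain ⟨s3, t3, hr3, hf3, ⟨D, hmarks⟩, hle, ht3⟩ := progDown_wp hB hup fun a ha k => by
    rw [hup.frame a (by omega) (by omega), hz1 a ha k]
  obtain ⟨τ, B, hT, hsub, hmin, hBeq, hsize, hinj⟩ := Λ.exists_basis D
  have hD := hmarks.treeData D hle hT hsub
  obtain ⟨s4, t4, hr4, ⟨ols, hcs⟩, ht4⟩ := progOut_wp hB hD
    (fun g hg => ⟨by rw [hin.left g hg]; exact (pr g).1.isLt, by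
      rw [hin.right g hg]; exact (pr g).2.isLt⟩) ⟨hf3, rfl, rfl, rfl⟩
  refine ⟨B, _, hmin, encodesCycles hin hen hD hBeq hinj hcs.cycles, s4, _,
    .seq hr1 (.seq hr2 (.seq hr3 hr4)), fun i hi => ?_, ?_⟩
  · rw [← hcs.seg i hi, zero_add]
  · have hcard := Λ.card_fin
    have hN := Λ.card
    have hmN := Λ.m_le
    have hsum : ∑ h ∈ Finset.range Λ.m \ τ.T, (28 * τ.dist h + 4) ≤ 28 * size B := by
      rw [hsize, Finset.mul_sum]
      exact Finset.sum_le_sum fun h _ => by omega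
    omega

end PolyTree

theorem mainTheorem2 :
    ∃ (P : PolyTree.Program) (c : ℕ) (K : ℝ),
      ∀ (n : ℕ) (G : SimpleGraph (Fin n)), PolyTree.IsPolygonalTwoTree G →
      ∀ input : List ℕ, PolyTree.EncodesGraph G input →
        ∃ (B : Finset (Finset (Sym2 (Fin n)))) (output : List ℕ) (s : PolyTree.State) (t : ℕ),
          PolyTree.IsMinFundamentalCycleBasis G B ∧
          PolyTree.EncodesCycles B output ∧
          PolyTree.Runs (n ^ c) P (PolyTree.State.init input) s t ∧
          s.Outputs output ∧
          (t : ℝ) ≤ K * (n * Real.log n + PolyTree.size B) := by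
  refine ⟨PolyTree.program, 10, 300, fun n G hG input henc => ?_⟩
  obtain ⟨hn, B, output, hB, hout, s, t, hrun, hs, ht⟩ := PolyTree.program_wp hG henc
  refine ⟨B, output, s, t, hB, hout, hrun, hs, ?_⟩
  have h3 : (3 : ℝ) ≤ n := by exact_mod_cast hn
  have hlog : 1 ≤ Real.log n := by
    rw [Real.le_log_iff_exp_le (by linarith)]
    linarith [Real.exp_one_lt_d9]
  have ht' : (t : ℝ) ≤ 300 * (n + PolyTree.size B) := by exact_mod_cast ht
  have hmul : (n : ℝ) ≤ n * Real.log n := le_mul_of_one_le_right (by linarith) hlog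
  linarith
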